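/- Setting. Let $n\ge 2$ and let $N$ be a smooth manifold of dimension $n+1$ (Hausdorff, second countable) with a locally flat projective structure $[\nabla]$, i.e. a class of torsion-free affine connections modulo $\nabla\mapsto\nabla+p$, $(\nabla+p)_iX^j=\nabla_iX^j+p_iX^j+p_lX^l\delta_i{}^j$, with vanishing projective Weyl tensor. Let $\mathcal E(w)=(\wedge^{n+1}T^*N)^{-w/(n+2)}$ be the projective density bundle of weight $w$ (real powers of volume densities). A projective scale is a positive section $\tau$ of $\mathcal E(1)$; it determines the unique $\nabla\in[\nabla]$ with $\nabla\tau=0$, whose projective Schouten tensor is $P_{ij}=\frac1n\mathrm{Ric}_{ij}$. Let $D_I$ be the projective tractor $D$-operator; for $\boldsymbol\rho\in\mathcal E(2)$, in any scale, $$D_ID_J\boldsymbol\rho=\begin{pmatrix}2\boldsymbol\rho&\nabla_j\boldsymbol\rho\\ \nabla_i\boldsymbol\rho&\nabla_i\nabla_j\boldsymbol\rho+2\boldsymbol\rho P_{ij}\end{pmatrix},\qquad \mathcal J[\boldsymbol\rho]=\det(D_ID_J\boldsymbol\rho).$$ Let $\Omega\subset N$ be a relatively compact domain with smooth strictly convex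 boundary $M=\partial\Omega$, and let $\boldsymbol\rho\in\mathcal E(2)$ be a Fefferman defining density: $\Omega=\{\boldsymbol\rho<0\}$, $d\boldsymbol\rho\ne0$ on $M$, and $\mathcal J[\boldsymbol\rho]=-1+O(\boldsymbol\rho^\infty)$ if $n$ is odd, $\mathcal J[\boldsymbol\rho]=-1+O(\boldsymbol\rho^{n/2+1})$ if $n$ is even, near $M$. Near $M$, $\tilde g_{IJ}=D_ID_J\boldsymbol\rho$ is regarded as a Lorentz metric (the ambient metric) on the bundle of positive elements of $\mathcal E(-1)$, sections of $\mathcal E(w)$ are regarded as functions on this bundle homogeneous of degree $w$, and $\tilde\Delta=-\tilde g^{IJ}\tilde\nabla_I\tilde\nabla_J$ is the Laplacian of $\tilde g$. A projective scale $\tau$ is called harmonic if $\tilde\Delta\tau=O(\boldsymbol\rho)$. For a projective scale $\tau$ with connection $\nabla$, a transverse field $\xi$ along $M$ pointing out of $\Omega$ induces $h$, $\nabla^\xi$, $S$, $\eta$ by $$\nabla_XY=\nabla^\xi_XY-h(X,Y)\xi,\qquad \nabla_X\xi=S(X)+\eta(X)\xi\qquad(X,Y\in\Gamma(TM)).$$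 The affine normal field of $\tau$ is the $\xi$ with $\eta=0$ and $(\xi\lrcorner\,\tau^{-(n+2)})|_{TM}=\mathrm{vol}_h$. For this $\xi$, $h$ is the affine metric, $\nabla^h$ its Levi-Civita connection, $\mathrm{Scal}_h$ its scalar curvature, $S$ the affine shape operator and $A=\nabla^h-\nabla^\xi$ the Fubini--Pick form, with $|A|^2$ taken with respect to $h$. A conformal scale on $M$ is a positive section of $\mathcal E[1]=(\wedge^nT^*M)^{-1/n}$, and $\tau|_M$ is identified with the conformal scale $(\mathrm{vol}_h)^{-1/n}$. Proposition (harmonic scales). (i) For every conformal scale $\kappa$ on $M$ there is a harmonic scale $\tau\in\mathcal E(1)$ with $\tau|_M=\kappa$, and any two such $\tau$ differ by $O(\boldsymbol\rho^2)$. (ii) Let $\tau$ be a harmonic scale with affine normal field $\xi$ and affine metric $h$, and let $\Upsilon\in C^\infty(N)$. Then $e^{-\Upsilon}\tau$ is harmonic if and only if, on $M$, $$\xi\Upsilon=\frac1n\bigl(\Delta_h\Upsilon+|d\Upsilon|_h^2\bigr),\qquad \Delta_h=-h^{\alpha\beta}\nabla^h_\alpha\nabla^h_\beta .$$ (iii)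 A projective scale $\tau$ is harmonic if and only if, on $M$, $$\mathrm{tr}\,S=\frac1{n-1}\bigl(\mathrm{Scal}_h-|A|^2\bigr).$$ -/

import Mathlib

open scoped Manifold ContDiff Topology

namespace HarmonicScale

noncomputable section

/-- The coordinate space `ℝ^d`. -/
abbrev Eu (d : ℕ) : Type := EuclideanSpace ℝ (Fin d)

/-! ### Local differential geometry on open subsets of `ℝ^d` -/

/-- The partial derivative `∂_i f` at `y`. -/
def pd {d : ℕ} (i : Fin d) (f : Eu d → ℝ) (y : Eu d) : ℝ :=
  fderiv ℝ f y (EuclideanSpace.single i 1)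

/-- Christoffel symbols of an affine connection: `Γ y i j k` is `Γ_{ij}^k` at `y`, that is
`∇_{∂_i} ∂_j = ∑ k, Γ_{ij}^k ∂_k`. -/
abbrev Symbols (d : ℕ) : Type := Eu d → Fin d → Fin d → Fin d → ℝ

/-- The curvature `R_{ij}^k_l`, with `(∇_i ∇_j - ∇_j ∇_i) X^k = R_{ij}^k_l X^l`. -/
def curv {d : ℕ} (Γ : Symbols d) (y : Eu d) (i j k l : Fin d) : ℝ :=
  pd i (fun z => Γ z j l k) y - pd j (fun z => Γ z i l k) y
    + ∑ m, (Γ y i m k * Γ y j l m - Γ y j m k * Γ y i l m)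

/-- The Ricci tensor `Ric_{jl} = R_{ij}^i_l`. -/
def ricci {d : ℕ} (Γ : Symbols d) (y : Eu d) (j l : Fin d) : ℝ :=
  ∑ i, curv Γ y i j i l

/-- The Hessian `∇_i ∇_j f` of a function. -/
def hess {d : ℕ} (Γ : Symbols d) (f : Eu d → ℝ) (y : Eu d) (i j : Fin d) : ℝ :=
  pd i (pd j f) y - ∑ k, Γ y i j k * pd k f y

/-- The Levi-Civita Christoffel symbols of a (pseudo-Riemannian) metric. -/
def leviCivita {d : ℕ} (g : Eu d → Matrix (Fin d) (Fin d) ℝ) : Symbols d := fun y i j k =>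
  (1 / 2) * ∑ l, (g y)⁻¹ k l *
    (pd i (fun z => g z j l) y + pd j (fun z => g z i l) y - pd l (fun z => g z i j) y)

/-- The Laplacian `Δ f = - g^{ij} ∇_i ∇_j f`; note the sign. -/
def laplacian {d : ℕ} (g : Eu d → Matrix (Fin d) (Fin d) ℝ) (f : Eu d → ℝ) (y : Eu d) : ℝ :=
  -∑ i, ∑ j, (g y)⁻¹ i j * hess (leviCivita g) f y i j

/-- The squared length `|df|^2 = g^{ij} ∂_i f ∂_j f`. -/
def gradSq {d : ℕ} (g : Eu d → Matrix (Fin d) (Fin d) ℝ) (f : Eu d → ℝ) (y : Eu d) : ℝ :=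
  ∑ i, ∑ j, (g y)⁻¹ i j * pd i f y * pd j f y

/-- The scalar curvature `g^{jl} Ric_{jl}`. -/
def scal {d : ℕ} (g : Eu d → Matrix (Fin d) (Fin d) ℝ) (y : Eu d) : ℝ :=
  ∑ j, ∑ l, (g y)⁻¹ j l * ricci (leviCivita g) y j l

/-! ### Projective geometry in a chart -/

/-- The one-form `p` for which the connection `∇ + p` annihilates the weight one density whose
component is `τ`. A connection acts on weight one densities in dimension `d` by
`∇_i τ = ∂_i τ + (d + 1)⁻¹ Γ_{il}^l τ`, because these are the `-1 / (d + 1)`-th powers of volume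
densities. -/
def scaleForm {d : ℕ} (Γ : Symbols d) (τ : Eu d → ℝ) (y : Eu d) (i : Fin d) : ℝ :=
  -((pd i τ y + (∑ l, Γ y i l l) / (d + 1) * τ y) / τ y)

/-- The representative `∇ + p` of the projective class of `Γ` determined by the scale `τ`; here
`(∇ + p)_i X^j = ∇_i X^j + p_i X^j + p_l X^l δ_i^j`. -/
def scaleSymbols {d : ℕ} (Γ : Symbols d) (τ : Eu d → ℝ) : Symbols d := fun y i j k =>
  Γ y i j k + (if j = k then scaleForm Γ τ y i else 0) + (if i = k then scaleForm Γ τ y j else 0)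

theorem sum_scaleSymbols {d : ℕ} (Γ : Symbols d) (τ : Eu d → ℝ) (y : Eu d) (i : Fin d) :
    ∑ l, scaleSymbols Γ τ y i l l = (∑ l, Γ y i l l) + (d + 1) * scaleForm Γ τ y i := by
  simp [scaleSymbols, Finset.sum_add_distrib]
  ring

/-- The connection of the scale `τ` satisfies `∇ τ = 0`. -/
theorem scaleSymbols_parallel {d : ℕ} (Γ : Symbols d) (τ : Eu d → ℝ) (y : Eu d) (hτ : τ y ≠ 0)
    (i : Fin d) : pd i τ y + (∑ l, scaleSymbols Γ τ y i l l) / (d + 1) * τ y = 0 := by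
  rw [sum_scaleSymbols]
  have h : (d + 1 : ℝ) ≠ 0 := by positivity
  simp only [scaleForm]
  field_simp
  ring

/-- The connection of the scale `τ` depends only on the projective class of `Γ`. -/
theorem scaleSymbols_congr {d : ℕ} (Γ Γ' : Symbols d) (τ : Eu d → ℝ) (p : Eu d → Fin d → ℝ)
    (hp : ∀ y i j k, Γ' y i j k =
      Γ y i j k + (if j = k then p y i else 0) + (if i = k then p y j else 0))
    (y : Eu d) (hτ : τ y ≠ 0) : scaleSymbols Γ' τ y = scaleSymbols Γ τ y := by
  have h : (d + 1 : ℝ) ≠ 0 := by positivity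
  have key : ∀ i, scaleForm Γ' τ y i = scaleForm Γ τ y i - p y i := by
    intro i
    have hs : ∑ l, Γ' y i l l = (∑ l, Γ y i l l) + (d + 1) * p y i := by
      simp [hp, Finset.sum_add_distrib]
      ring
    simp only [scaleForm, hs]
    field_simp
    ring
  funext i j k
  simp only [scaleSymbols, hp, key]
  split_ifs <;> ring

/-- The symbols of the representative determined by the local scale whose component in the chart
is `1`, i.e. by the coordinate volume. -/
def coordSymbols {d : ℕ} (Γ : Symbols d) : Symbols d := scaleSymbols Γ (fun _ => 1)

/-- The projective Schouten tensor `P_{ij} = n⁻¹ Ric_{ij}` in dimension `n + 1`, for the connection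
of a scale. -/
def projSchouten {n : ℕ} (Γ : Symbols (n + 1)) (y : Eu (n + 1)) (i j : Fin (n + 1)) : ℝ :=
  ricci Γ y i j / n

/-- The projective Weyl tensor `C_{ij}^k_l = R_{ij}^k_l - δ_i^k P_{jl} + δ_j^k P_{il}`, for the
connection of a scale. -/
def projWeyl {n : ℕ} (Γ : Symbols (n + 1)) (y : Eu (n + 1)) (i j k l : Fin (n + 1)) : ℝ :=
  curv Γ y i j k l - (if i = k then projSchouten Γ y j l else 0)
    + (if j = k then projSchouten Γ y i l else 0)

/-- The tractor `D`-operator on a density of weight `w`: `D_I f = (w f, ∇_i f)`, in the splitting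
given by the coordinate scale. The tractor index `0` is the top slot. -/
def densityD {n : ℕ} (w : ℝ) (f : Eu (n + 1) → ℝ) (y : Eu (n + 1)) : Fin (n + 2) → ℝ :=
  Fin.cons (w * f y) (fun i => pd i f y)

/-- The tractor `D`-operator on a cotractor `V_J = (σ, μ_j)` of weight `w`:
`D_I V_J = (w V_J, ∇_i V_J)` with the tractor connection
`∇_i (σ, μ_j) = (∇_i σ - μ_i, ∇_i μ_j + P_{ij} σ)`. Here `Γ` are the symbols of the coordinate
scale, in which the splitting is taken. -/
def cotractorD {n : ℕ} (Γ : Symbols (n + 1)) (w : ℝ) (V : Eu (n + 1) → Fin (n + 2) → ℝ)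
    (y : Eu (n + 1)) (I J : Fin (n + 2)) : ℝ :=
  Fin.cases (motive := fun _ => ℝ) (w * V y J)
    (fun i => Fin.cases (motive := fun _ => ℝ)
      (pd i (fun z => V z 0) y - V y i.succ)
      (fun j => pd i (fun z => V z j.succ) y - ∑ k, Γ y i j k * V y k.succ
        + projSchouten Γ y i j * V y 0) J) I

/-- The components of `D_I D_J r` for a density of weight `2` with component `r`. -/
def tractorHess {n : ℕ} (Γ : Symbols (n + 1)) (r : Eu (n + 1) → ℝ) (y : Eu (n + 1)) :
    Matrix (Fin (n + 2)) (Fin (n + 2)) ℝ :=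
  Matrix.of (cotractorD (coordSymbols Γ) 1 (densityD 2 r) y)

/-- The Monge-Ampere operator `J[r] = det (D_I D_J r)`; the determinant is taken in a frame that is
unimodular for the coordinate scale. -/
def mongeAmpere {n : ℕ} (Γ : Symbols (n + 1)) (r : Eu (n + 1) → ℝ) (y : Eu (n + 1)) : ℝ :=
  (tractorHess Γ r y).det

/-- The point `(t, y)` in the coordinates on the bundle of positive weight `-1` densities, whose
fibre coordinate `t` is the ratio to the coordinate density. -/
def conePt {n : ℕ} (t : ℝ) (y : Eu (n + 1)) : Eu (n + 2) := WithLp.toLp 2 (Fin.cons t y)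

/-- The base point `y` of the point `z = (t, y)`. -/
def coneBase {n : ℕ} (z : Eu (n + 2)) : Eu (n + 1) := WithLp.toLp 2 (fun i => z i.succ)

/-- The metric `D_I D_J r` on the bundle of positive weight `-1` densities in the coordinates
`(t, y)`. The tractor index `0` refers to the Euler field `t ∂_t`, the others to the `∂_i`, and
`D_I D_J r` is homogeneous of degree two, so the components with respect to `∂_t, ∂_i` are
`C_{00}`, `t C_{0i}` and `t ^ 2 C_{ij}`. -/
def ambientMetric {n : ℕ} (Γ : Symbols (n + 1)) (r : Eu (n + 1) → ℝ) (z : Eu (n + 2)) :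
    Matrix (Fin (n + 2)) (Fin (n + 2)) ℝ :=
  Matrix.of fun I J => (if I = 0 then 1 else z 0) * (if J = 0 then 1 else z 0) *
    tractorHess Γ r (coneBase z) I J

/-- The component of the ambient Laplacian of a weight one density with component `τ`: the density
is the homogeneous function `t τ(y)`, and its Laplacian, homogeneous of degree `-1`, is evaluated
at `t = 1`. -/
def ambientLaplacian {n : ℕ} (Γ : Symbols (n + 1)) (r τ : Eu (n + 1) → ℝ) (y : Eu (n + 1)) : ℝ :=
  laplacian (ambientMetric Γ r) (fun z => z 0 * τ (coneBase z)) (conePt 1 y)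

/-! ### Hypersurface theory in a chart where the hypersurface is `{y 0 = 0}` -/

/-- The point `(0, u)` of the hypersurface `{y 0 = 0}`. -/
def slicePt {n : ℕ} (u : Eu n) : Eu (n + 1) := WithLp.toLp 2 (Fin.cons 0 u)

/-- The last `n` coordinates. -/
def sliceProj {n : ℕ} (y : Eu (n + 1)) : Eu n := WithLp.toLp 2 (fun a => y a.succ)

/-- The coefficient of `ξ` in the decomposition of `v` along `TM ⊕ ℝ ξ`. -/
def transPart {n : ℕ} (ξ v : Fin (n + 1) → ℝ) : ℝ := v 0 / ξ 0

/-- The component in `TM` in the decomposition of `v` along `TM ⊕ ℝ ξ`. -/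
def tangPart {n : ℕ} (ξ v : Fin (n + 1) → ℝ) (b : Fin n) : ℝ :=
  v b.succ - transPart ξ v * ξ b.succ

/-- The affine second fundamental form, `∇_X Y = ∇^ξ_X Y - h(X, Y) ξ`. -/
def affineMetric {n : ℕ} (Γ : Symbols (n + 1)) (ξ : Eu n → Fin (n + 1) → ℝ) (u : Eu n) :
    Matrix (Fin n) (Fin n) ℝ :=
  Matrix.of fun a b => -transPart (ξ u) (Γ (slicePt u) a.succ b.succ)

/-- The Christoffel symbols of the induced connection `∇^ξ`. -/
def inducedSymbols {n : ℕ} (Γ : Symbols (n + 1)) (ξ : Eu n → Fin (n + 1) → ℝ) : Symbols n :=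
  fun u a b c => tangPart (ξ u) (Γ (slicePt u) a.succ b.succ) c

/-- The components of `∇_{∂_a} ξ`. -/
def covXi {n : ℕ} (Γ : Symbols (n + 1)) (ξ : Eu n → Fin (n + 1) → ℝ) (u : Eu n) (a : Fin n)
    (k : Fin (n + 1)) : ℝ :=
  pd a (fun v => ξ v k) u + ∑ j, Γ (slicePt u) a.succ j k * ξ u j

/-- The one-form `η` in `∇_X ξ = S(X) + η(X) ξ`. -/
def etaForm {n : ℕ} (Γ : Symbols (n + 1)) (ξ : Eu n → Fin (n + 1) → ℝ) (u : Eu n)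
    (a : Fin n) : ℝ :=
  transPart (ξ u) (covXi Γ ξ u a)

/-- The trace of the affine shape operator `S` in `∇_X ξ = S(X) + η(X) ξ`. -/
def traceShape {n : ℕ} (Γ : Symbols (n + 1)) (ξ : Eu n → Fin (n + 1) → ℝ) (u : Eu n) : ℝ :=
  ∑ a, tangPart (ξ u) (covXi Γ ξ u a) a

/-- The Fubini-Pick form `A_{ab}^c = ∇^h - ∇^ξ`. -/
def fubiniPick {n : ℕ} (Γ : Symbols (n + 1)) (ξ : Eu n → Fin (n + 1) → ℝ) : Symbols n :=
  fun u a b c => leviCivita (affineMetric Γ ξ) u a b c - inducedSymbols Γ ξ u a b c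

/-- The squared norm `|A|^2` with respect to the affine metric. -/
def fubiniPickSq {n : ℕ} (Γ : Symbols (n + 1)) (ξ : Eu n → Fin (n + 1) → ℝ) (u : Eu n) : ℝ :=
  ∑ a, ∑ b, ∑ c, ∑ a', ∑ b', ∑ c',
    (affineMetric Γ ξ u)⁻¹ a a' * (affineMetric Γ ξ u)⁻¹ b b' * affineMetric Γ ξ u c c' *
      fubiniPick Γ ξ u a b c * fubiniPick Γ ξ u a' b' c'

/-! ### Global objects -/

section Global

variable {n : ℕ} {N : Type*} [TopologicalSpace N] [ChartedSpace (Eu (n + 1)) N]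

variable (n N) in
/-- The smooth charts of `N`. -/
def charts : Set (OpenPartialHomeomorph N (Eu (n + 1))) :=
  IsManifold.maximalAtlas 𝓘(ℝ, Eu (n + 1)) ∞ N

variable (n N) in
/-- Smooth sections of the projective density bundle of weight `w` of the `(n + 1)`-manifold `N`,
`(Λ^{n+1} T*N)^{-w/(n+2)}` (real powers are powers of volume densities), given by the component
with respect to the coordinate volume in each chart. -/
structure ProjDensity (w : ℝ) where
  /-- The component in a chart; only its values on the target of the chart are relevant. -/
  comp : OpenPartialHomeomorph N (Eu (n + 1)) → Eu (n + 1) → ℝ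
  smooth : ∀ e ∈ charts n N, ContDiffOn ℝ ∞ (comp e) e.target
  trans : ∀ e ∈ charts n N, ∀ e' ∈ charts n N, ∀ x ∈ e.source ∩ e'.source,
    comp e' (e' x) =
      |(fderiv ℝ (fun z => e (e'.symm z)) (e' x)).det| ^ (-w / ((n : ℝ) + 2)) * comp e (e x)

/-- A projective scale is a positive density of weight one. -/
def IsProjScale (τ : ProjDensity n N 1) : Prop :=
  ∀ e ∈ charts n N, ∀ y ∈ e.target, 0 < τ.comp e y

/-- The rescaled density `e^{-Υ} τ`. -/
def rescale [IsManifold 𝓘(ℝ, Eu (n + 1)) ∞ N] (τ : ProjDensity n N 1) (Υ : N → ℝ)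
    (hΥ : ContMDiff 𝓘(ℝ, Eu (n + 1)) 𝓘(ℝ, ℝ) ∞ Υ) : ProjDensity n N 1 where
  comp e y := Real.exp (-Υ (e.symm y)) * τ.comp e y
  smooth e he := by
    have h1 : ContMDiffOn 𝓘(ℝ, Eu (n + 1)) 𝓘(ℝ, ℝ) ∞ (fun y => Υ (e.symm y)) e.target :=
      hΥ.comp_contMDiffOn (contMDiffOn_symm_of_mem_maximalAtlas he)
    exact (h1.contDiffOn.neg.exp).mul (τ.smooth e he)
  trans e he e' he' x hx := by
    rw [e.left_inv hx.1, e'.left_inv hx.2, τ.trans e he e' he' x hx]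
    ring

/-- The coordinate vector field `∂_j` of a chart (relevant only on the source of the chart). -/
def coordField (e : OpenPartialHomeomorph N (Eu (n + 1))) (j : Fin (n + 1)) (x : N) :
    TangentSpace 𝓘(ℝ, Eu (n + 1)) x :=
  show Eu (n + 1) from mfderiv 𝓘(ℝ, Eu (n + 1)) 𝓘(ℝ, Eu (n + 1)) e.symm (e x)
    (EuclideanSpace.single j (1 : ℝ) : Eu (n + 1))

/-- The `k`-th component of a tangent vector in a chart. -/
def coordComp (e : OpenPartialHomeomorph N (Eu (n + 1))) (x : N)
    (v : TangentSpace 𝓘(ℝ, Eu (n + 1)) x) (k : Fin (n + 1)) : ℝ :=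
  (show Eu (n + 1) from mfderiv 𝓘(ℝ, Eu (n + 1)) 𝓘(ℝ, Eu (n + 1)) e x v) k

/-- The Christoffel symbols of an affine connection in a chart. -/
def christoffel [IsManifold 𝓘(ℝ, Eu (n + 1)) ∞ N]
    (nabla : CovariantDerivative 𝓘(ℝ, Eu (n + 1)) (Eu (n + 1))
      (TangentSpace 𝓘(ℝ, Eu (n + 1)) : N → Type _))
    (e : OpenPartialHomeomorph N (Eu (n + 1))) : Symbols (n + 1) := fun y i j k =>
  coordComp e (e.symm y)
    (nabla (coordField e j) (e.symm y) (coordField e i (e.symm y))) k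

/-- The charts straightening the boundary: `Ω` corresponds to `{y 0 < 0}`, hence `M = ∂Ω` to
`{y 0 = 0}`, with `y 1, …, y n` as coordinates on `M`. -/
def boundaryCharts (Ω : Set N) : Set (OpenPartialHomeomorph N (Eu (n + 1))) :=
  {e | e ∈ charts n N ∧ ∀ x ∈ e.source, x ∈ Ω ↔ e x 0 < 0}

/-- Smooth sections of the conformal density bundle `E[w] = (Λ^n T*M)^{-w/n}` of `M = ∂Ω`, given by
the components with respect to the coordinate volumes of the charts that the boundary charts induce
on `M`. -/
structure ConfDensity (Ω : Set N) (w : ℝ) where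
  /-- The component in the chart of `M` induced by a boundary chart. -/
  comp : OpenPartialHomeomorph N (Eu (n + 1)) → Eu n → ℝ
  smooth : ∀ e ∈ boundaryCharts (n := n) Ω, ContDiffOn ℝ ∞ (comp e) {u | slicePt u ∈ e.target}
  trans : ∀ e ∈ boundaryCharts (n := n) Ω, ∀ e' ∈ boundaryCharts (n := n) Ω,
    ∀ u, slicePt u ∈ e'.target → e'.symm (slicePt u) ∈ e.source →
    comp e' u =
      |(fderiv ℝ (fun v => sliceProj (e (e'.symm (slicePt v)))) u).det| ^ (-w / (n : ℝ)) *
        comp e (sliceProj (e (e'.symm (slicePt u))))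

/-- A conformal scale is a positive conformal density of weight one. -/
def IsConfScale {Ω : Set N} (κ : ConfDensity (n := n) Ω 1) : Prop :=
  ∀ e ∈ boundaryCharts (n := n) Ω, ∀ u, slicePt u ∈ e.target → 0 < κ.comp e u

/-- `ρ` is a defining density of `Ω`: negative exactly on `Ω`, with nonzero differential along
`M = ∂Ω` (so `∂Ω` is a smooth hypersurface). -/
def IsDefiningDensity (Ω : Set N) (ρ : ProjDensity n N 2) : Prop :=
  (∀ e ∈ charts n N, ∀ x ∈ e.source, x ∈ Ω ↔ ρ.comp e (e x) < 0) ∧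
  (∀ e ∈ charts n N, ∀ x ∈ e.source, x ∈ frontier Ω → fderiv ℝ (ρ.comp e) (e x) ≠ 0)

/-- The quantity with components `F e` is `O(ρ^k)` along `M`: near every point of `M` it is `ρ^k`
times a smooth quantity. -/
def IsBigORho (Ω : Set N) (ρ : ProjDensity n N 2) (k : ℕ)
    (F : OpenPartialHomeomorph N (Eu (n + 1)) → Eu (n + 1) → ℝ) : Prop :=
  ∀ e ∈ boundaryCharts (n := n) Ω, ∀ u, slicePt u ∈ e.target →
    ∃ (U : Set (Eu (n + 1))) (φ : Eu (n + 1) → ℝ), IsOpen U ∧ slicePt u ∈ U ∧ U ⊆ e.target ∧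
      ContDiffOn ℝ ∞ φ U ∧ ∀ y ∈ U, F e y = ρ.comp e y ^ k * φ y

variable [IsManifold 𝓘(ℝ, Eu (n + 1)) ∞ N]
  (nabla : CovariantDerivative 𝓘(ℝ, Eu (n + 1)) (Eu (n + 1))
    (TangentSpace 𝓘(ℝ, Eu (n + 1)) : N → Type _))

/-- The projective structure of `nabla` is locally flat: the projective Weyl tensor, which does not
depend on the scale and is computed in the coordinate scales, vanishes. -/
def IsLocallyFlat : Prop :=
  ∀ e ∈ charts n N, ∀ y ∈ e.target, ∀ i j k l,
    projWeyl (coordSymbols (christoffel nabla e)) y i j k l = 0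

/-- `M = ∂Ω` is strictly convex: the Hessian of a defining function is positive definite on `TM`.
The component of a defining density in a chart is a local defining function. -/
def IsStrictlyConvex (Ω : Set N) (ρ : ProjDensity n N 2) : Prop :=
  ∀ e ∈ charts n N, ∀ x ∈ e.source, x ∈ frontier Ω → ∀ X : Fin (n + 1) → ℝ, X ≠ 0 →
    ∑ i, X i * pd i (ρ.comp e) (e x) = 0 →
    0 < ∑ i, ∑ j, hess (christoffel nabla e) (ρ.comp e) (e x) i j * X i * X j

/-- `ρ` is a Fefferman defining density: a defining density with `J[ρ] = -1 + O(ρ^∞)` for odd `n`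
and `J[ρ] = -1 + O(ρ^{n/2+1})` for even `n`. -/
def IsFefferman (Ω : Set N) (ρ : ProjDensity n N 2) : Prop :=
  IsDefiningDensity Ω ρ ∧
  (Odd n → ∀ k : ℕ, IsBigORho Ω ρ k
    (fun e y => mongeAmpere (christoffel nabla e) (ρ.comp e) y + 1)) ∧
  (Even n → IsBigORho Ω ρ (n / 2 + 1)
    (fun e y => mongeAmpere (christoffel nabla e) (ρ.comp e) y + 1))

/-- `τ` is a harmonic scale: a projective scale whose Laplacian with respect to the ambient metric
`D_I D_J ρ` is `O(ρ)`. -/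
def IsHarmonic (Ω : Set N) (ρ : ProjDensity n N 2) (τ : ProjDensity n N 1) : Prop :=
  IsProjScale τ ∧ IsBigORho Ω ρ 1
    (fun e => ambientLaplacian (christoffel nabla e) (ρ.comp e) (τ.comp e))

/-- The Christoffel symbols in a chart of the representative connection determined by the
projective scale `τ`. -/
def tauSymbols (τ : ProjDensity n N 1) (e : OpenPartialHomeomorph N (Eu (n + 1))) :
    Symbols (n + 1) :=
  scaleSymbols (christoffel nabla e) (τ.comp e)

/-- The components of a vector field along `M` in a boundary chart, as functions on `M`. -/
def alongM (ξ : ∀ x : N, TangentSpace 𝓘(ℝ, Eu (n + 1)) x)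
    (e : OpenPartialHomeomorph N (Eu (n + 1))) (u : Eu n) (k : Fin (n + 1)) : ℝ :=
  coordComp e (e.symm (slicePt u)) (ξ (e.symm (slicePt u))) k

/-- `ξ` restricts along `M = ∂Ω` to the affine normal field of the projective scale `τ`: it is
smooth, points outwards, `ξ ⌟ τ^{-(n+2)}` restricts to the volume density of the affine metric, and
`η = 0`. Only the values of `ξ` on `M` are relevant. -/
def IsAffineNormal (Ω : Set N) (τ : ProjDensity n N 1)
    (ξ : ∀ x : N, TangentSpace 𝓘(ℝ, Eu (n + 1)) x) : Prop :=
  ∀ e ∈ boundaryCharts (n := n) Ω,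
    (∀ k, ContDiffOn ℝ ∞ (fun u => alongM ξ e u k) {u | slicePt u ∈ e.target}) ∧
    ∀ u, slicePt u ∈ e.target →
      0 < alongM ξ e u 0 ∧
      τ.comp e (slicePt u) ^ (-((n : ℝ) + 2)) * alongM ξ e u 0 =
        Real.sqrt (affineMetric (tauSymbols nabla τ e) (alongM ξ e) u).det ∧
      ∀ a, etaForm (tauSymbols nabla τ e) (alongM ξ e) u a = 0

/-- The affine metric of the projective scale `τ` with affine normal field `ξ`, in a boundary
chart. -/
def hMetric (τ : ProjDensity n N 1) (ξ : ∀ x : N, TangentSpace 𝓘(ℝ, Eu (n + 1)) x)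
    (e : OpenPartialHomeomorph N (Eu (n + 1))) : Eu n → Matrix (Fin n) (Fin n) ℝ :=
  affineMetric (tauSymbols nabla τ e) (alongM ξ e)

/-- `τ|_M = κ` under the identification of weight one densities along `M` with conformal densities
that sends `τ|_M` to `(vol_h)^{-1/n}`, where `h` is the affine metric of `τ`. -/
def RestrictsTo (Ω : Set N) (τ : ProjDensity n N 1) (κ : ConfDensity (n := n) Ω 1) : Prop :=
  ∃ ξ, IsAffineNormal nabla Ω τ ξ ∧ ∀ e ∈ boundaryCharts (n := n) Ω, ∀ u, slicePt u ∈ e.target →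
    κ.comp e u = Real.sqrt (hMetric nabla τ ξ e u).det ^ (-1 / (n : ℝ))

end Global

end

end HarmonicScale

open HarmonicScale

/-! All three statements reduce to one trace along `M`. In a chart with `M = {y 0 = 0}` let `B_ab =
-Γ_ab^0` (`sliceForm`), which is projectively invariant and positive definite by convexity. A scale
is harmonic exactly when the `B`-trace of the tangential part of `D_i D_j τ` vanishes on `M`
(`isHarmonic_iff`).

Reason for the reduction. On the bundle of densities with fibre coordinate `t` there is the tractor
connection `ambSymbols`, and the ambient metric `G` is the Hessian of `t² r` with respect to it. The
Ricci identity makes `∇G` totally symmetric along `M`: vanishing projective Weyl curvature leaves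
only the component of curvature along `t`, and this is multiplied by `∂_t (t² r)`, which vanishes on
`M`. Hence the Levi-Civita connection of `G` is `∇ + ½ G⁻¹ ∇G` there. The correction has zero
`G`-trace, because that trace is the derivative of `log J[ρ]`, and `J[ρ] = -1 + O(ρ²)`. So the
ambient Laplacian of `τ` is minus the trace of its tractor Hessian (`ambientLaplacian_eq`). The rows
through the Euler direction vanish by homogeneity, and the block form of `D_I D_J ρ` on `M` leaves a
positive multiple of the `B`-trace (`sum_tractorHess_inv`). Only vanishing of `J[ρ] + 1` to second
order is needed, and the condition `O(ρ)` becomes vanishing on `M` by Hadamard's lemma.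

Part (iii). The connection of a scale has curvature `δ_i^k Q_jl - δ_j^k Q_il` with `Q = τ⁻¹ D D τ`
(`curv_scaleSymbols`). The Gauss equation for the affine normal field, with apolarity of the
Fubini-Pick form, gives `Scal_h - |A|² = (n - 1) (tr_h Q + tr S)` (`BlaschkeHypersurface.scal_eq`),
and `h` is a multiple of `B`.

Part (ii). Replacing `τ` by `e^{-Υ} τ` changes `Q` by `-∇dΥ + dΥ ⊗ dΥ`. The Gauss formula turns the
`h`-trace of `∇dΥ` into `-Δ_h Υ + n ξΥ`.

Part (i). In a boundary chart the trace is `n ∂_0 τ` plus a differential operator in `τ|_M`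
(`sliceTrace_eq`). Thus the boundary value determines the normal derivative, which gives uniqueness
modulo `ρ²`. For existence, the prescribed first order jet is realised in single charts. It is
compatible with coordinate changes because `Q` can be read off from the curvature
(`schouten_pullback`), and it survives gluing by a partition of unity because it is an affine
condition on jets. Finally `κ` is compared with `τ|_M` through an affine normal field, which exists
because `η = 0` is a linear system with matrix `B`. -/

namespace HarmonicScale

noncomputable section

/-! ### Calculus of coordinate partial derivatives. -/

section PartialDerivatives

variable {d m : ℕ} {f g : Eu d → ℝ} {y : Eu d} {i : Fin d}

theorem pd_congr {V : Set (Eu d)} (hV : IsOpen V) (hy : y ∈ V) (h : ∀ z ∈ V, f z = g z) :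
    pd i f y = pd i g y := by
  have : f =ᶠ[𝓝 y] g := Filter.eventuallyEq_of_mem (hV.mem_nhds hy) h
  simp only [pd, this.fderiv_eq]

theorem pd_congr' (h : f =ᶠ[𝓝 y] g) : pd i f y = pd i g y := by
  simp only [pd, h.fderiv_eq]

@[simp] theorem pd_const (c : ℝ) : pd i (fun _ => c) y = 0 := by
  simp [pd]

theorem pd_add (hf : DifferentiableAt ℝ f y) (hg : DifferentiableAt ℝ g y) :
    pd i (fun z => f z + g z) y = pd i f y + pd i g y := by
  simp [pd, fderiv_fun_add hf hg]

theorem pd_sub (hf : DifferentiableAt ℝ f y) (hg : DifferentiableAt ℝ g y) :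
    pd i (fun z => f z - g z) y = pd i f y - pd i g y := by
  simp [pd, fderiv_fun_sub hf hg]

theorem pd_neg : pd i (fun z => -f z) y = -pd i f y := by
  simp [pd, fderiv_fun_neg]

theorem pd_mul (hf : DifferentiableAt ℝ f y) (hg : DifferentiableAt ℝ g y) :
    pd i (fun z => f z * g z) y = pd i f y * g y + f y * pd i g y := by
  simp [pd, fderiv_fun_mul hf hg]
  ring

theorem pd_const_mul (c : ℝ) (hf : DifferentiableAt ℝ f y) :
    pd i (fun z => c * f z) y = c * pd i f y := by
  rw [pd_mul (by fun_prop) hf]; simp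

theorem pd_sum {ι : Type*} {s : Finset ι} {F : ι → Eu d → ℝ}
    (hF : ∀ a ∈ s, DifferentiableAt ℝ (F a) y) :
    pd i (fun z => ∑ a ∈ s, F a z) y = ∑ a ∈ s, pd i (F a) y := by
  simp [pd, fderiv_fun_sum hF]

theorem pd_real_comp {F : ℝ → ℝ} {F' : ℝ} (hF : HasDerivAt F F' (f y))
    (hf : DifferentiableAt ℝ f y) : pd i (fun z => F (f z)) y = F' * pd i f y := by
  have := hF.comp_hasFDerivAt y hf.hasFDerivAt
  simp only [pd]
  erw [this.fderiv]
  simp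

theorem pd_inv (hf : DifferentiableAt ℝ f y) (h : f y ≠ 0) :
    pd i (fun z => (f z)⁻¹) y = -pd i f y / f y ^ 2 := by
  rw [pd_real_comp (hasDerivAt_inv h) hf]; field_simp

theorem pd_div (hf : DifferentiableAt ℝ f y) (hg : DifferentiableAt ℝ g y) (h : g y ≠ 0) :
    pd i (fun z => f z / g z) y = pd i f y / g y - f y * pd i g y / g y ^ 2 := by
  have : (fun z => f z / g z) = fun z => f z * (fun w => (g w)⁻¹) z := by
    funext z; exact div_eq_mul_inv _ _
  rw [this, pd_mul hf (hg.fun_inv h), pd_inv hg h]; ring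

theorem pd_coord (k : Fin d) : pd i (fun z => z k) y = if i = k then 1 else 0 := by
  have : HasFDerivAt (fun z : Eu d => z k) (EuclideanSpace.proj k : Eu d →L[ℝ] ℝ) y :=
    (EuclideanSpace.proj k : Eu d →L[ℝ] ℝ).hasFDerivAt
  simp only [pd, this.fderiv]
  simp [eq_comm]

theorem fderiv_eq_sum_pd (f : Eu d → ℝ) (y v : Eu d) :
    fderiv ℝ f y v = ∑ k, v k * pd k f y := by
  conv_lhs => rw [← (EuclideanSpace.basisFun (Fin d) ℝ).sum_repr v]
  simp [pd]

theorem pd_eq_fderiv_apply {E : Type*} [NormedAddCommGroup E] [NormedSpace ℝ E] {F : Eu d → Eu m}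
    (hF : DifferentiableAt ℝ F y) (k : Fin m) :
    pd i (fun z => F z k) y = fderiv ℝ F y (EuclideanSpace.single i 1) k := by
  have := ((EuclideanSpace.proj k : Eu m →L[ℝ] ℝ).hasFDerivAt (x := F y)).comp y hF.hasFDerivAt
  simp only [pd]
  erw [this.fderiv]
  rfl

theorem pd_comp {φ : Eu d → Eu m} {f : Eu m → ℝ} (hf : DifferentiableAt ℝ f (φ y))
    (hφ : DifferentiableAt ℝ φ y) :
    pd i (fun z => f (φ z)) y = ∑ k, pd i (fun z => φ z k) y * pd k f (φ y) := by
  have := hf.hasFDerivAt.comp y hφ.hasFDerivAt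
  conv_lhs => rw [pd]
  erw [this.fderiv]
  rw [ContinuousLinearMap.comp_apply, fderiv_eq_sum_pd]
  simp only [pd_eq_fderiv_apply (E := ℝ) hφ]

@[fun_prop] theorem contDiffAt_pd (i : Fin d) (hf : ContDiffAt ℝ ∞ f y) :
    ContDiffAt ℝ ∞ (fun z => pd i f z) y := by
  unfold pd
  have : ContDiffAt ℝ ∞ (fderiv ℝ f) y := hf.fderiv_right (by simp)
  exact this.clm_apply contDiffAt_const

theorem pd_comm (hf : ContDiffAt ℝ ∞ f y) (i j : Fin d) : pd i (pd j f) y = pd j (pd i f) y := by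
  have hs : IsSymmSndFDerivAt ℝ f y := hf.isSymmSndFDerivAt (by
    rw [minSmoothness_of_isRCLikeNormedField]
    exact WithTop.coe_le_coe.2 (le_top : (2 : ℕ∞) ≤ ⊤))
  have hd : DifferentiableAt ℝ (fderiv ℝ f) y :=
    (hf.fderiv_right (m := ∞) (by simp)).differentiableAt (by simp)
  have key : ∀ i j, pd i (pd j f) y =
      fderiv ℝ (fderiv ℝ f) y (EuclideanSpace.single i 1) (EuclideanSpace.single j 1) := by
    intro i j
    have := hd.hasFDerivAt.clm_apply (hasFDerivAt_const (EuclideanSpace.single j (1:ℝ)) y)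
    unfold pd
    rw [this.fderiv]; simp
  rw [key, key, hs]

theorem contDiffAt_of_mem {V : Set (Eu d)} {F : Type*} [NormedAddCommGroup F] [NormedSpace ℝ F]
    {f : Eu d → F} (hV : IsOpen V) (hf : ContDiffOn ℝ ∞ f V) (hy : y ∈ V) : ContDiffAt ℝ ∞ f y :=
  hf.contDiffAt (hV.mem_nhds hy)

theorem _root_.ContDiffAt.diff {F : Type*} [NormedAddCommGroup F] [NormedSpace ℝ F]
    {f : Eu d → F} (hf : ContDiffAt ℝ ∞ f y) : DifferentiableAt ℝ f y :=
  hf.differentiableAt (by simp)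

end PartialDerivatives

/-! ### The hypersurface `{y 0 = 0}` and tangential derivatives. -/

section Slices

variable {n : ℕ}

theorem slicePt_zero (u : Eu n) : slicePt u 0 = 0 := rfl
theorem slicePt_succ (u : Eu n) (a : Fin n) : slicePt u a.succ = u a := rfl

theorem sliceProj_slicePt (u : Eu n) : sliceProj (slicePt u) = u := by
  ext a; rfl

theorem slicePt_sliceProj {y : Eu (n + 1)} (h : y 0 = 0) : slicePt (sliceProj y) = y := by
  ext i
  refine Fin.cases ?_ (fun a => ?_) i
  · exact h.symm
  · rfl

@[fun_prop] theorem contDiff_slicePt {_k : WithTop ℕ∞} : ContDiff ℝ _k (slicePt (n := n)) := by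
  rw [contDiff_euclidean]
  intro i
  refine Fin.cases ?_ (fun a => ?_) i
  · exact contDiff_const
  · exact (EuclideanSpace.proj a : Eu n →L[ℝ] ℝ).contDiff

@[fun_prop] theorem contDiff_sliceProj {_k : WithTop ℕ∞} : ContDiff ℝ _k (sliceProj (n := n)) := by
  rw [contDiff_euclidean]
  intro a
  exact (EuclideanSpace.proj a.succ : Eu (n + 1) →L[ℝ] ℝ).contDiff

theorem pd_slice {f : Eu (n + 1) → ℝ} {u : Eu n} (hf : DifferentiableAt ℝ f (slicePt u))
    (a : Fin n) : pd a (fun v => f (slicePt v)) u = pd a.succ f (slicePt u) := by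
  rw [pd_comp hf (contDiff_slicePt (_k := 1)).differentiable_one.differentiableAt]
  rw [Fin.sum_univ_succ]
  simp only [slicePt_zero, slicePt_succ, pd_const, pd_coord]
  simp

end Slices

/-! ### Derivatives of determinants and inverses. -/

section MatrixFunctions

variable {d : ℕ} {ι : Type*} [Fintype ι] [DecidableEq ι] {g : Eu d → Matrix ι ι ℝ} {y : Eu d}

@[fun_prop] theorem contDiffAt_det (hg : ∀ i j, ContDiffAt ℝ ∞ (fun z => g z i j) y) :
    ContDiffAt ℝ ∞ (fun z => (g z).det) y := by
  simp only [Matrix.det_apply']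
  refine ContDiffAt.sum fun σ _ => contDiffAt_const.mul ?_
  exact contDiffAt_prod fun i _ => hg _ _

theorem matrix_inv_apply (A : Matrix ι ι ℝ) (i j : ι) :
    A⁻¹ i j = A.det⁻¹ * (A.updateRow j (Pi.single i 1)).det := by
  rw [Matrix.inv_def, Matrix.smul_apply, Matrix.adjugate_apply, Ring.inverse_eq_inv', smul_eq_mul]

theorem contDiffAt_inv_apply (hg : ∀ i j, ContDiffAt ℝ ∞ (fun z => g z i j) y)
    (h : (g y).det ≠ 0) (i j : ι) : ContDiffAt ℝ ∞ (fun z => (g z)⁻¹ i j) y := by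
  simp only [matrix_inv_apply]
  refine (ContDiffAt.inv (contDiffAt_det hg) h).mul (contDiffAt_det fun p q => ?_)
  simp only [Matrix.updateRow_apply]
  split_ifs <;> fun_prop

/-- Jacobi's formula. In the Leibniz expansion, differentiating the factor from column `i` replaces
that column by its derivative, and Cramer's rule expresses the resulting determinant through the
adjugate. -/
theorem pd_det (hg : ∀ i j, ContDiffAt ℝ ∞ (fun z => g z i j) y) (k : Fin d) :
    pd k (fun z => (g z).det) y =
      ∑ i, ∑ j, (g y).adjugate i j * pd k (fun z => g z j i) y := by
  have hdet : ∀ z : Eu d, (g z).det = ∑ σ : Equiv.Perm ι,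
      ((Equiv.Perm.sign σ : ℤ) : ℝ) * ∏ i, g z (σ i) i := fun z => Matrix.det_apply' _
  have hprod : ∀ σ : Equiv.Perm ι, pd k (fun z => ∏ i, g z (σ i) i) y =
      ∑ i, (∏ j ∈ Finset.univ.erase i, g y (σ j) j) * pd k (fun z => g z (σ i) i) y := by
    intro σ
    have := HasFDerivAt.finsetProd (u := Finset.univ) (x := y)
      (g := fun i z => g z (σ i) i) (fun i _ => (hg (σ i) i).diff.hasFDerivAt)
    rw [pd, this.fderiv]
    simp [pd]
  have hadj : ∀ i, ∑ j, (g y).adjugate i j * pd k (fun z => g z j i) y =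
      ((g y).updateCol i (fun j => pd k (fun z => g z j i) y)).det := by
    intro i
    rw [← Matrix.cramer_apply, Matrix.cramer_eq_adjugate_mulVec]
    rfl
  simp only [hadj]
  simp_rw [hdet]
  rw [pd_sum (fun σ _ => ?_)]
  · simp_rw [Matrix.det_apply']
    rw [Finset.sum_comm]
    refine Finset.sum_congr rfl fun σ _ => ?_
    rw [pd_const_mul _ (ContDiffAt.diff (contDiffAt_prod fun i _ => hg _ _)), hprod,
      Finset.mul_sum]
    refine Finset.sum_congr rfl fun i _ => ?_
    rw [← Finset.mul_prod_erase _ _ (Finset.mem_univ i), Matrix.updateCol_self]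
    rw [mul_comm (∏ j ∈ _, _)]
    congr 2
    refine Finset.prod_congr rfl fun j hj => ?_
    rw [Matrix.updateCol_ne (Finset.ne_of_mem_erase hj)]
  · exact (contDiffAt_const.mul (contDiffAt_prod fun i _ => hg _ _)).diff

theorem pd_det_of_ne_zero (hg : ∀ i j, ContDiffAt ℝ ∞ (fun z => g z i j) y)
    (h : (g y).det ≠ 0) (k : Fin d) :
    pd k (fun z => (g z).det) y =
      (g y).det * ∑ i, ∑ j, (g y)⁻¹ i j * pd k (fun z => g z j i) y := by
  rw [pd_det hg, Finset.mul_sum]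
  refine Finset.sum_congr rfl fun i _ => ?_
  rw [Finset.mul_sum]
  refine Finset.sum_congr rfl fun j _ => ?_
  rw [Matrix.inv_def, Matrix.smul_apply, Ring.inverse_eq_inv', smul_eq_mul]
  field_simp

theorem sum_inv_mul {A : Matrix ι ι ℝ} (h : A.det ≠ 0) (i j : ι) :
    ∑ k, A⁻¹ i k * A k j = if i = j then 1 else 0 := by
  rw [← Matrix.mul_apply, Matrix.nonsing_inv_mul _ (isUnit_iff_ne_zero.2 h), Matrix.one_apply]

theorem sum_mul_inv {A : Matrix ι ι ℝ} (h : A.det ≠ 0) (i j : ι) :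
    ∑ k, A i k * A⁻¹ k j = if i = j then 1 else 0 := by
  rw [← Matrix.mul_apply, Matrix.mul_nonsing_inv _ (isUnit_iff_ne_zero.2 h), Matrix.one_apply]

/-- Differentiate `g g⁻¹ = 1`, which holds in a neighbourhood since `det g` stays nonzero there, and
multiply by `g⁻¹` from the left. -/
theorem sum_inv_mul_pd_inv (hg : ∀ i j, ContDiffAt ℝ ∞ (fun z => g z i j) y)
    (h : (g y).det ≠ 0) (k : Fin d) (i j : ι) :
    pd k (fun z => (g z)⁻¹ i j) y =
      -∑ p, ∑ q, (g y)⁻¹ i p * pd k (fun z => g z p q) y * (g y)⁻¹ q j := by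
  have hev : ∀ᶠ z in 𝓝 y, (g z).det ≠ 0 := (contDiffAt_det hg).continuousAt.eventually_ne h
  have hi := contDiffAt_inv_apply hg h
  have e : ∀ p, ∑ q, (pd k (fun z => g z p q) y * (g y)⁻¹ q j +
      g y p q * pd k (fun z => (g z)⁻¹ q j) y) = 0 := by
    intro p
    have h1 : pd k (fun z => ∑ q, g z p q * (g z)⁻¹ q j) y = 0 := by
      rw [pd_congr' (g := fun _ => if p = j then (1 : ℝ) else 0)
        (hev.mono fun z hz => sum_mul_inv hz p j), pd_const]
    rw [pd_sum fun q _ => ((hg p q).mul (hi q j)).diff] at h1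
    rw [← h1]
    exact Finset.sum_congr rfl fun q _ => (pd_mul (hg p q).diff (hi q j).diff).symm
  have e2 : ∑ p, (g y)⁻¹ i p * ∑ q, (pd k (fun z => g z p q) y * (g y)⁻¹ q j +
      g y p q * pd k (fun z => (g z)⁻¹ q j) y) = 0 := by simp [e]
  simp only [Finset.sum_add_distrib, mul_add, Finset.mul_sum, ← mul_assoc] at e2
  have e3 : ∑ p, ∑ q, (g y)⁻¹ i p * g y p q * pd k (fun z => (g z)⁻¹ q j) y =
      pd k (fun z => (g z)⁻¹ i j) y := by
    rw [Finset.sum_comm]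
    simp only [← Finset.sum_mul, sum_inv_mul h]
    simp
  linarith

theorem inv_symm {A : Matrix ι ι ℝ} (h : ∀ i j, A i j = A j i) (i j : ι) : A⁻¹ i j = A⁻¹ j i := by
  have : A.transpose = A := by ext i j; exact h j i
  conv_lhs => rw [← this, ← Matrix.transpose_nonsing_inv, Matrix.transpose_apply]

end MatrixFunctions

/-! ### Levi-Civita connections, the Ricci identity, projective changes. -/

section Connections

variable {d : ℕ}

/-- The covariant derivative `∇_k g_{ij}` of a symmetric two-tensor. -/
def covMetric (Γ : Symbols d) (g : Eu d → Matrix (Fin d) (Fin d) ℝ) (y : Eu d)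
    (k i j : Fin d) : ℝ :=
  pd k (fun z => g z i j) y - ∑ e, Γ y k i e * g y e j - ∑ e, Γ y k j e * g y i e

/-- If `∇ g` is totally symmetric, the Levi-Civita connection of `g` differs from `∇` by half of
`∇ g`. -/
theorem leviCivita_eq {Γ : Symbols d} {g : Eu d → Matrix (Fin d) (Fin d) ℝ} {y : Eu d}
    (hΓ : ∀ i j k, Γ y i j k = Γ y j i k) (hg : ∀ i j, g y i j = g y j i)
    (hdet : (g y).det ≠ 0) (h1 : ∀ k i j, covMetric Γ g y k i j = covMetric Γ g y i k j)
    (h2 : ∀ k i j, covMetric Γ g y k i j = covMetric Γ g y k j i) (i j k : Fin d) :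
    leviCivita g y i j k = Γ y i j k + (1 / 2) * ∑ l, (g y)⁻¹ k l * covMetric Γ g y l i j := by
  -- Koszul's combination, rewritten with covariant derivatives. By total symmetry the three terms
  -- `∇g` collapse to a single one, and the terms in the symbols add up to twice `g_le Γ_ij^e`.
  have e : ∀ l, pd i (fun z => g z j l) y + pd j (fun z => g z i l) y - pd l (fun z => g z i j) y =
      covMetric Γ g y l i j + 2 * ∑ e, g y l e * Γ y i j e := by
    intro l
    have a1 : covMetric Γ g y i j l = covMetric Γ g y l i j := by rw [h2, h1, h2, h1, h2, h1]
    have a2 : covMetric Γ g y j i l = covMetric Γ g y l i j := by rw [h2, h1, h2]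
    have b1 : ∑ e, Γ y i j e * g y e l = ∑ e, g y l e * Γ y i j e :=
      Finset.sum_congr rfl fun e _ => by rw [hg e l]; ring
    have b2 : ∑ e, Γ y j i e * g y e l = ∑ e, g y l e * Γ y i j e :=
      Finset.sum_congr rfl fun e _ => by rw [hg e l, hΓ j i]; ring
    have b3 : ∑ e, Γ y l i e * g y e j = ∑ e, Γ y i l e * g y j e :=
      Finset.sum_congr rfl fun e _ => by rw [hg e j, hΓ l i]
    have b4 : ∑ e, Γ y l j e * g y i e = ∑ e, Γ y j l e * g y i e :=
      Finset.sum_congr rfl fun e _ => by rw [hΓ l j]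
    simp only [covMetric, b1, b2, b3, b4] at a1 a2 ⊢
    linarith
  simp only [leviCivita, e, mul_add, Finset.sum_add_distrib]
  have : ∑ l, (g y)⁻¹ k l * (2 * ∑ e, g y l e * Γ y i j e) = 2 * Γ y i j k := by
    simp only [Finset.mul_sum]
    rw [Finset.sum_comm]
    have : ∀ e, ∑ l, (g y)⁻¹ k l * (2 * (g y l e * Γ y i j e)) =
        2 * ((∑ l, (g y)⁻¹ k l * g y l e) * Γ y i j e) := by
      intro e
      rw [Finset.sum_mul, Finset.mul_sum]
      exact Finset.sum_congr rfl fun _ _ => by ring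
    simp [this, sum_inv_mul hdet]
  rw [this]; ring

/-- The Ricci identity for the third derivatives of a function. -/
theorem covMetric_hess_sub {Γ : Symbols d} {f : Eu d → ℝ} {y : Eu d}
    (hΓ : ∀ i j k, Γ y i j k = Γ y j i k) (hΓs : ∀ i j k, ContDiffAt ℝ ∞ (fun z => Γ z i j k) y)
    (hf : ContDiffAt ℝ ∞ f y) (k i j : Fin d) :
    covMetric Γ (fun z => Matrix.of (hess Γ f z)) y k i j -
      covMetric Γ (fun z => Matrix.of (hess Γ f z)) y i k j =
      -∑ l, curv Γ y k i l j * pd l f y := by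
  have hd : ∀ k i j, pd k (fun z => hess Γ f z i j) y = pd k (pd i (pd j f)) y -
      ∑ l, (pd k (fun z => Γ z i j l) y * pd l f y + Γ y i j l * pd k (pd l f) y) := by
    intro k i j
    unfold hess
    rw [pd_sub (ContDiffAt.diff (by fun_prop)) (ContDiffAt.diff (by fun_prop)),
      pd_sum fun l _ => ContDiffAt.diff (by fun_prop)]
    congr 1
    exact Finset.sum_congr rfl fun l _ =>
      pd_mul (ContDiffAt.diff (by fun_prop)) (ContDiffAt.diff (by fun_prop))
  have e1 : pd k (pd i (pd j f)) y = pd i (pd k (pd j f)) y := pd_comm (by fun_prop) k i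
  have e2 : ∑ e, Γ y k i e * hess Γ f y e j = ∑ e, Γ y i k e * hess Γ f y e j :=
    Finset.sum_congr rfl fun e _ => by rw [hΓ]
  -- Expanding the Hessian inside this term produces the products of two symbols. After
  -- antisymmetrisation in `k, i` they are the quadratic part of the curvature.
  have e3 : ∀ k i, ∑ e, Γ y k j e * hess Γ f y i e = (∑ e, Γ y k j e * pd i (pd e f) y) -
      ∑ l, (∑ e, Γ y i e l * Γ y k j e) * pd l f y := by
    intro k i
    simp only [Finset.sum_mul]
    rw [Finset.sum_comm (s := Finset.univ) (t := Finset.univ), ← Finset.sum_sub_distrib]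
    refine Finset.sum_congr rfl fun e _ => ?_
    rw [hess, mul_sub, Finset.mul_sum]
    congr 1
    exact Finset.sum_congr rfl fun l _ => by ring
  simp only [covMetric, Matrix.of_apply, hd, e1, e2, e3, curv, Finset.sum_add_distrib,
    add_mul, sub_mul, Finset.sum_sub_distrib]
  ring

theorem hess_symm {Γ : Symbols d} {f : Eu d → ℝ} {y : Eu d}
    (hΓ : ∀ i j k, Γ y i j k = Γ y j i k) (hf : ContDiffAt ℝ ∞ f y) (i j : Fin d) :
    hess Γ f y i j = hess Γ f y j i := by
  simp only [hess, pd_comm hf i j, hΓ i j]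

/-- The change of the curvature under a projective change by a closed one-form. -/
theorem curv_projectiveChange {Γ Γ' : Symbols d} {p : Eu d → Fin d → ℝ} {V : Set (Eu d)} {y : Eu d}
    (hV : IsOpen V) (hy : y ∈ V)
    (hΓ : ∀ i j k, Γ y i j k = Γ y j i k) (hΓs : ∀ i j k, ContDiffAt ℝ ∞ (fun z => Γ z i j k) y)
    (hps : ∀ i, ContDiffAt ℝ ∞ (fun z => p z i) y)
    (hp : ∀ i j, pd i (fun z => p z j) y = pd j (fun z => p z i) y)
    (h : ∀ z ∈ V, ∀ i j k, Γ' z i j k =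
      Γ z i j k + (if j = k then p z i else 0) + (if i = k then p z j else 0))
    (i j k l : Fin d) :
    curv Γ' y i j k l = curv Γ y i j k l
      - (if i = k then pd j (fun z => p z l) y - ∑ m, Γ y j l m * p y m - p y j * p y l else 0)
      + (if j = k then pd i (fun z => p z l) y - ∑ m, Γ y i l m * p y m - p y i * p y l else 0) := by
  have hd : ∀ q i j k, pd q (fun z => Γ' z i j k) y = pd q (fun z => Γ z i j k) y +
      (if j = k then pd q (fun z => p z i) y else 0) +
      (if i = k then pd q (fun z => p z j) y else 0) := by
    intro q i j k
    rw [pd_congr hV hy fun z hz => h z hz i j k]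
    split_ifs with h1 h2 h2
    · rw [pd_add (ContDiffAt.diff (by fun_prop)) (ContDiffAt.diff (by fun_prop)),
        pd_add (ContDiffAt.diff (by fun_prop)) (ContDiffAt.diff (by fun_prop))]
    · simp only [add_zero]
      rw [pd_add (ContDiffAt.diff (by fun_prop)) (ContDiffAt.diff (by fun_prop))]
    · simp only [add_zero]
      rw [pd_add (ContDiffAt.diff (by fun_prop)) (ContDiffAt.diff (by fun_prop))]
    · simp only [add_zero]
  have hm : ∀ i j, ∑ m, Γ' y i m k * Γ' y j l m = ∑ m, Γ y i m k * Γ y j l m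
      + Γ y j l k * p y i + (if i = k then ∑ m, Γ y j l m * p y m else 0)
      + Γ y i l k * p y j + (if l = k then p y i * p y j else 0) + (if i = k then p y l * p y j else 0)
      + Γ y i j k * p y l + (if j = k then p y i * p y l else 0)
      + (if i = k then p y j * p y l else 0) := by
    intro i j
    simp only [h y hy, mul_add, add_mul, Finset.sum_add_distrib, mul_ite, ite_mul, mul_zero,
      zero_mul, Finset.sum_ite_eq, Finset.sum_ite_eq', Finset.mem_univ, if_true]
    by_cases hik : i = k
    · simp only [hik, if_true, mul_comm (p y _) (Γ y _ _ _)]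
      split_ifs <;> ring
    · simp only [hik, if_false, Finset.sum_const_zero]
      split_ifs <;> ring
  -- Closedness of `p` removes the term `∂_i p_j - ∂_j p_i`, which would multiply `δ_l^k`.
  have hp' : pd i (fun z => p z j) y = pd j (fun z => p z i) y := hp i j
  simp only [curv, Finset.sum_sub_distrib, hd, hm, hΓ j i, hp']
  by_cases hik : i = k <;> by_cases hjk : j = k <;> by_cases hlk : l = k <;>
    simp only [hik, hjk, hlk, if_true, if_false] <;> ring

end Connections

/-! ### The covariant derivative of a metric and its trace. -/

section CovMetric

variable {d : ℕ} {Γ : Symbols d} {g g' : Eu d → Matrix (Fin d) (Fin d) ℝ} {y : Eu d}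

theorem covMetric_congr {V : Set (Eu d)} (hV : IsOpen V) (hy : y ∈ V) (h : ∀ z ∈ V, g z = g' z)
    (k i j : Fin d) : covMetric Γ g y k i j = covMetric Γ g' y k i j := by
  rw [covMetric, covMetric, h y hy, pd_congr hV hy fun z hz => by rw [h z hz]]

theorem covMetric_comm {V : Set (Eu d)} (hV : IsOpen V) (hy : y ∈ V)
    (h : ∀ z ∈ V, ∀ i j, g z i j = g z j i) (k i j : Fin d) :
    covMetric Γ g y k i j = covMetric Γ g y k j i := by
  have : pd k (fun z => g z i j) y = pd k (fun z => g z j i) y := pd_congr hV hy fun z hz => h z hz i j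
  simp only [covMetric, this, h y hy _ i, h y hy _ j]
  ring

/-- This trace measures how far `∇` is from preserving the volume of `g`. It is used twice: for the
ambient metric, where it brings in the Monge-Ampere equation, and for the affine metric, where it
yields apolarity. -/
theorem sum_inv_mul_covMetric (hgs : ∀ i j, ContDiffAt ℝ ∞ (fun z => g z i j) y)
    (hg : ∀ i j, g y i j = g y j i) (hdet : (g y).det ≠ 0) (k : Fin d) :
    ∑ i, ∑ j, (g y)⁻¹ i j * covMetric Γ g y k i j =
      pd k (fun z => (g z).det) y / (g y).det - 2 * ∑ i, Γ y k i i := by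
  have e1 : ∑ i, ∑ j, (g y)⁻¹ i j * ∑ e, Γ y k i e * g y e j = ∑ i, Γ y k i i := by
    refine Finset.sum_congr rfl fun i _ => ?_
    simp only [Finset.mul_sum]
    rw [Finset.sum_comm]
    have : ∀ e, ∑ j, (g y)⁻¹ i j * (Γ y k i e * g y e j) =
        Γ y k i e * ∑ j, (g y)⁻¹ i j * g y j e := by
      intro e
      rw [Finset.mul_sum]
      exact Finset.sum_congr rfl fun j _ => by rw [hg e j]; ring
    simp [this, sum_inv_mul hdet]
  have e2 : ∑ i, ∑ j, (g y)⁻¹ i j * ∑ e, Γ y k j e * g y i e = ∑ i, Γ y k i i := by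
    rw [Finset.sum_comm]
    refine Finset.sum_congr rfl fun j _ => ?_
    simp only [Finset.mul_sum]
    rw [Finset.sum_comm]
    have : ∀ e, ∑ i, (g y)⁻¹ i j * (Γ y k j e * g y i e) =
        Γ y k j e * ∑ i, (g y)⁻¹ j i * g y i e := by
      intro e
      rw [Finset.mul_sum]
      exact Finset.sum_congr rfl fun i _ => by rw [inv_symm hg i j]; ring
    simp [this, sum_inv_mul hdet]
  have e3 : ∑ i, ∑ j, (g y)⁻¹ i j * pd k (fun z => g z i j) y =
      pd k (fun z => (g z).det) y / (g y).det := by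
    rw [pd_det_of_ne_zero hgs hdet, mul_div_cancel_left₀ _ hdet, Finset.sum_comm]
    exact Finset.sum_congr rfl fun i _ => Finset.sum_congr rfl fun j _ => by rw [inv_symm hg i j]
  simp only [covMetric, mul_sub, Finset.sum_sub_distrib, e1, e2, e3]
  ring

end CovMetric

/-! ### The connection of the coordinate scale. -/

section Coordinate

variable {n : ℕ} {Γ : Symbols (n + 1)}

theorem scaleSymbols_symm {d : ℕ} {Γ : Symbols d} {y : Eu d} (hΓ : ∀ i j k, Γ y i j k = Γ y j i k)
    (τ : Eu d → ℝ) (i j k : Fin d) : scaleSymbols Γ τ y i j k = scaleSymbols Γ τ y j i k := by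
  simp only [scaleSymbols, hΓ i j k]; ring

theorem contDiffAt_scaleForm {d : ℕ} {Γ : Symbols d} {y : Eu d}
    (hΓ : ∀ i j k, ContDiffAt ℝ ∞ (fun z => Γ z i j k) y) {τ : Eu d → ℝ} (hτ : ContDiffAt ℝ ∞ τ y)
    (h0 : τ y ≠ 0) (i : Fin d) : ContDiffAt ℝ ∞ (fun z => scaleForm Γ τ z i) y := by
  unfold scaleForm
  refine ContDiffAt.neg (ContDiffAt.div ?_ hτ h0)
  fun_prop

theorem contDiffAt_scaleSymbols {d : ℕ} {Γ : Symbols d} {y : Eu d}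
    (hΓ : ∀ i j k, ContDiffAt ℝ ∞ (fun z => Γ z i j k) y) {τ : Eu d → ℝ} (hτ : ContDiffAt ℝ ∞ τ y)
    (h0 : τ y ≠ 0) (i j k : Fin d) : ContDiffAt ℝ ∞ (fun z => scaleSymbols Γ τ z i j k) y := by
  unfold scaleSymbols
  have h1 := contDiffAt_scaleForm hΓ hτ h0
  split_ifs <;> fun_prop

theorem coordSymbols_symm {y : Eu (n + 1)} (hΓ : ∀ i j k, Γ y i j k = Γ y j i k)
    (i j k : Fin (n + 1)) : coordSymbols Γ y i j k = coordSymbols Γ y j i k :=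
  scaleSymbols_symm hΓ _ i j k

theorem contDiffAt_coordSymbols {y : Eu (n + 1)}
    (hΓ : ∀ i j k, ContDiffAt ℝ ∞ (fun z => Γ z i j k) y) (i j k : Fin (n + 1)) :
    ContDiffAt ℝ ∞ (fun z => coordSymbols Γ z i j k) y :=
  contDiffAt_scaleSymbols hΓ contDiffAt_const one_ne_zero i j k

theorem sum_coordSymbols (y : Eu (n + 1)) (i : Fin (n + 1)) : ∑ l, coordSymbols Γ y i l l = 0 := by
  rw [coordSymbols, sum_scaleSymbols, scaleForm]
  have : ((n + 1 : ℕ) : ℝ) + 1 ≠ 0 := by positivity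
  simp only [pd_const]
  field_simp
  ring

@[fun_prop] theorem contDiffAt_curv {d : ℕ} {Γ : Symbols d} {y : Eu d}
    (hΓ : ∀ i j k, ContDiffAt ℝ ∞ (fun z => Γ z i j k) y) (i j k l : Fin d) :
    ContDiffAt ℝ ∞ (fun z => curv Γ z i j k l) y := by
  unfold curv; fun_prop

theorem contDiffAt_projSchouten {y : Eu (n + 1)}
    (hΓ : ∀ i j k, ContDiffAt ℝ ∞ (fun z => Γ z i j k) y) (i j : Fin (n + 1)) :
    ContDiffAt ℝ ∞ (fun z => projSchouten Γ z i j) y := by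
  unfold projSchouten ricci
  exact (ContDiffAt.sum fun k _ => contDiffAt_curv hΓ _ _ _ _).div_const _

/-- A unimodular torsion-free connection has symmetric Ricci tensor: two of the four terms contain
the trace of the symbols, and the remaining `∂_i Γ_jl^i - Γ_jm^i Γ_il^m` is symmetric in `j, l`. -/
theorem ricci_symm_of_trace {d : ℕ} {Γ : Symbols d} {y : Eu d} {V : Set (Eu d)} (hV : IsOpen V)
    (hy : y ∈ V) (hΓ : ∀ z ∈ V, ∀ i j k, Γ z i j k = Γ z j i k)
    (hΓs : ∀ i j k, ContDiffAt ℝ ∞ (fun z => Γ z i j k) y) (htr : ∀ z ∈ V, ∀ i, ∑ l, Γ z i l l = 0)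
    (j l : Fin d) : ricci Γ y j l = ricci Γ y l j := by
  have key : ∀ j l, ricci Γ y j l =
      ∑ i, pd i (fun z => Γ z j l i) y - ∑ i, ∑ m, Γ y j m i * Γ y i l m := by
    intro j l
    have e1 : ∑ i, pd j (fun z => Γ z i l i) y = 0 := by
      rw [← pd_sum fun i _ => (hΓs i l i).diff,
        pd_congr (g := fun _ => 0) hV hy fun z hz => ?_, pd_const]
      rw [← htr z hz l]
      exact Finset.sum_congr rfl fun i _ => hΓ z hz _ _ _
    have e2 : ∑ i, ∑ m, Γ y i m i * Γ y j l m = 0 := by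
      rw [Finset.sum_comm]
      simp only [← Finset.sum_mul]
      refine Finset.sum_eq_zero fun m _ => ?_
      have : ∑ i, Γ y i m i = 0 := by
        rw [← htr y hy m]
        exact Finset.sum_congr rfl fun i _ => hΓ y hy _ _ _
      rw [this, zero_mul]
    simp only [ricci, curv, Finset.sum_add_distrib, Finset.sum_sub_distrib, e1, e2]
    ring
  rw [key, key, Finset.sum_comm (f := fun i m => Γ y j m i * Γ y i l m)]
  congr 1
  · exact Finset.sum_congr rfl fun i _ => pd_congr hV hy fun z hz => hΓ z hz _ _ _
  · refine Finset.sum_congr rfl fun i _ => Finset.sum_congr rfl fun m _ => ?_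
    rw [hΓ y hy j, hΓ y hy m]; ring

end Coordinate

/-! ### The ambient connection on the bundle of densities of weight -1. -/

section Cone

variable {n : ℕ}

@[fun_prop] theorem contDiff_coneBase {_k : WithTop ℕ∞} : ContDiff ℝ _k (coneBase (n := n)) := by
  rw [contDiff_euclidean]
  intro a
  exact (EuclideanSpace.proj a.succ : Eu (n + 2) →L[ℝ] ℝ).contDiff

theorem coneBase_conePt (t : ℝ) (y : Eu (n + 1)) : coneBase (conePt t y) = y := by
  ext a; rfl

theorem conePt_zero (t : ℝ) (y : Eu (n + 1)) : conePt t y 0 = t := rfl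

theorem differentiableAt_coneBase (z : Eu (n + 2)) : DifferentiableAt ℝ (coneBase (n := n)) z :=
  (contDiff_coneBase (_k := 1)).differentiable_one.differentiableAt

variable {f : Eu (n + 1) → ℝ} {z : Eu (n + 2)}

theorem pd_zero_coneBase (hf : DifferentiableAt ℝ f (coneBase z)) :
    pd 0 (fun w => f (coneBase w)) z = 0 := by
  rw [pd_comp hf (differentiableAt_coneBase z)]
  refine Finset.sum_eq_zero fun k _ => ?_
  have : pd 0 (fun w : Eu (n + 2) => coneBase w k) z = 0 := by
    have := pd_coord (i := 0) (y := z) k.succ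
    rw [if_neg (Fin.succ_ne_zero k).symm] at this
    exact this
  rw [this, zero_mul]

theorem pd_succ_coneBase (hf : DifferentiableAt ℝ f (coneBase z)) (i : Fin (n + 1)) :
    pd i.succ (fun w => f (coneBase w)) z = pd i f (coneBase z) := by
  rw [pd_comp hf (differentiableAt_coneBase z)]
  have : ∀ k, pd i.succ (fun w : Eu (n + 2) => coneBase w k) z = if i = k then 1 else 0 := by
    intro k
    have := pd_coord (i := i.succ) (y := z) k.succ
    simp only [Fin.succ_inj] at this
    exact this
  simp [this]

variable {a : ℝ → ℝ} {a' : ℝ}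

theorem differentiableAt_apply (k : Fin (n + 2)) : DifferentiableAt ℝ (fun w : Eu (n + 2) => w k) z :=
  (EuclideanSpace.proj k : Eu (n + 2) →L[ℝ] ℝ).differentiableAt

theorem pd_zero_cone (ha : HasDerivAt a a' (z 0)) (hf : DifferentiableAt ℝ f (coneBase z)) :
    pd 0 (fun w => a (w 0) * f (coneBase w)) z = a' * f (coneBase z) := by
  have h1 : DifferentiableAt ℝ (fun w : Eu (n + 2) => a (w 0)) z :=
    DifferentiableAt.comp z (f := fun w : Eu (n + 2) => w 0) ha.differentiableAt
      (differentiableAt_apply 0)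
  have h2 : DifferentiableAt ℝ (fun w => f (coneBase w)) z :=
    DifferentiableAt.comp z hf (differentiableAt_coneBase z)
  rw [pd_mul h1 h2, pd_zero_coneBase hf, pd_real_comp ha (differentiableAt_apply 0), pd_coord]
  simp

theorem pd_succ_cone (ha : HasDerivAt a a' (z 0)) (hf : DifferentiableAt ℝ f (coneBase z))
    (i : Fin (n + 1)) :
    pd i.succ (fun w => a (w 0) * f (coneBase w)) z = a (z 0) * pd i f (coneBase z) := by
  have h1 : DifferentiableAt ℝ (fun w : Eu (n + 2) => a (w 0)) z :=
    DifferentiableAt.comp z (f := fun w : Eu (n + 2) => w 0) ha.differentiableAt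
      (differentiableAt_apply 0)
  have h2 : DifferentiableAt ℝ (fun w => f (coneBase w)) z :=
    DifferentiableAt.comp z hf (differentiableAt_coneBase z)
  rw [pd_mul h1 h2, pd_succ_coneBase hf, pd_real_comp ha (differentiableAt_apply 0), pd_coord,
    if_neg (Fin.succ_ne_zero i)]
  simp

/-- The symbols of the flat ambient connection in the coordinates `(t, y)` of the bundle of
weight `-1` densities; `c` are the symbols of the coordinate scale. -/
def ambSymbols (c : Symbols (n + 1)) : Symbols (n + 2) := fun z I J K =>
  Fin.cases (motive := fun _ => ℝ)
    (Fin.cases (motive := fun _ => ℝ) 0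
      (fun j => Fin.cases (motive := fun _ => ℝ) 0 (fun k => if j = k then (z 0)⁻¹ else 0) K) J)
    (fun i => Fin.cases (motive := fun _ => ℝ)
      (Fin.cases (motive := fun _ => ℝ) 0 (fun k => if i = k then (z 0)⁻¹ else 0) K)
      (fun j => Fin.cases (motive := fun _ => ℝ) (-z 0 * projSchouten c (coneBase z) i j)
        (fun k => c (coneBase z) i j k) K) J) I

variable (c : Symbols (n + 1)) (i j k l : Fin (n + 1)) (K : Fin (n + 2))

theorem amb_00 : ambSymbols c z 0 0 K = 0 := rfl
theorem amb_0s0 : ambSymbols c z 0 j.succ 0 = 0 := rfl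
theorem amb_0ss : ambSymbols c z 0 j.succ k.succ = if j = k then (z 0)⁻¹ else 0 := rfl
theorem amb_s00 : ambSymbols c z i.succ 0 0 = 0 := rfl
theorem amb_s0s : ambSymbols c z i.succ 0 k.succ = if i = k then (z 0)⁻¹ else 0 := rfl
theorem amb_ss0 :
    ambSymbols c z i.succ j.succ 0 = -z 0 * projSchouten c (coneBase z) i j := rfl
theorem amb_sss : ambSymbols c z i.succ j.succ k.succ = c (coneBase z) i j k := rfl

/-- Only the fibre direction contributes, through `n + 1` entries `t⁻¹`. This balances the factor `t
^ (2 (n + 1))` in the determinant of the ambient metric. -/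
theorem amb_trace (hc : ∀ y i, ∑ l, c y i l l = 0) (I : Fin (n + 2)) :
    ∑ J, ambSymbols c z I J J = if I = 0 then (n + 1) * (z 0)⁻¹ else 0 := by
  rw [Fin.sum_univ_succ]
  refine Fin.cases ?_ (fun i => ?_) I
  · simp [amb_00, amb_0ss]
  · simp [amb_s00, amb_sss, hc]

variable {c}

theorem amb_symm (hc : ∀ i j k, c (coneBase z) i j k = c (coneBase z) j i k)
    (hP : ∀ i j, projSchouten c (coneBase z) i j = projSchouten c (coneBase z) j i)
    (I J K : Fin (n + 2)) : ambSymbols c z I J K = ambSymbols c z J I K := by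
  refine Fin.cases ?_ (fun i => ?_) I <;> refine Fin.cases ?_ (fun j => ?_) J <;>
    refine Fin.cases ?_ (fun k => ?_) K <;>
    simp only [amb_00, amb_0s0, amb_0ss, amb_s00, amb_s0s, amb_ss0, amb_sss]
  · rw [hP]
  · rw [hc]

theorem contDiffAt_comp_coneBase (hf : ContDiffAt ℝ ∞ f (coneBase z)) :
    ContDiffAt ℝ ∞ (fun w => f (coneBase w)) z :=
  ContDiffAt.comp z hf contDiff_coneBase.contDiffAt

theorem contDiffAt_apply_zero : ContDiffAt ℝ ∞ (fun w : Eu (n + 2) => w 0) z :=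
  (EuclideanSpace.proj (0 : Fin (n + 2)) : Eu (n + 2) →L[ℝ] ℝ).contDiff.contDiffAt

theorem contDiffAt_amb (hz : z 0 ≠ 0) (hc : ∀ i j k, ContDiffAt ℝ ∞ (fun y => c y i j k) (coneBase z))
    (I J K : Fin (n + 2)) : ContDiffAt ℝ ∞ (fun w => ambSymbols c w I J K) z := by
  have h0 := contDiffAt_apply_zero (z := z)
  have h1 : ContDiffAt ℝ ∞ (fun w : Eu (n + 2) => (w 0)⁻¹) z := h0.inv hz
  have h2 := fun i j => contDiffAt_comp_coneBase (contDiffAt_projSchouten hc i j)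
  refine Fin.cases ?_ (fun i => ?_) I <;> refine Fin.cases ?_ (fun j => ?_) J <;>
    refine Fin.cases ?_ (fun k => ?_) K <;>
    simp only [amb_00, amb_0s0, amb_0ss, amb_s00, amb_s0s, amb_ss0, amb_sss]
  any_goals exact contDiffAt_const
  any_goals (split_ifs; exacts [h1, contDiffAt_const])
  · exact (h0.neg).mul (h2 i j)
  · exact contDiffAt_comp_coneBase (hc i j k)

/-- The ambient connection is flat up to the Cotton tensor. -/
theorem curv_amb (hz : z 0 ≠ 0) (hc : ∀ i j k, c (coneBase z) i j k = c (coneBase z) j i k)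
    (hcs : ∀ i j k, ContDiffAt ℝ ∞ (fun y => c y i j k) (coneBase z))
    (hW : ∀ i j k l, projWeyl c (coneBase z) i j k l = 0) (I J L : Fin (n + 2)) (k : Fin (n + 1)) :
    curv (ambSymbols c) z I J k.succ L = 0 := by
  have hinv : HasDerivAt (fun t : ℝ => t⁻¹) (-(z 0 ^ 2)⁻¹) (z 0) := hasDerivAt_inv hz
  have d1 : ∀ I : Fin (n + 2), ∀ i k : Fin (n + 1),
      pd I (fun w : Eu (n + 2) => if i = k then (w 0)⁻¹ else 0) z =
        if i = k then (if I = 0 then -(z 0 ^ 2)⁻¹ else 0) else 0 := by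
    intro I i k
    split_ifs with h1 h2
    · rw [pd_real_comp hinv (differentiableAt_apply 0), pd_coord, if_pos h2, mul_one]
    · rw [pd_real_comp hinv (differentiableAt_apply 0), pd_coord, if_neg h2, mul_zero]
    · rw [pd_const]
  have d2 : ∀ i j k, pd 0 (fun w => c (coneBase w) i j k) z = 0 := fun i j k =>
    pd_zero_coneBase (hcs i j k).diff
  have d3 : ∀ l i j k, pd (Fin.succ l) (fun w => c (coneBase w) i j k) z =
      pd l (fun y => c y i j k) (coneBase z) := fun l i j k =>
    pd_succ_coneBase (hcs i j k).diff l
  simp only [curv, Fin.sum_univ_succ (n := n + 1)]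
  refine Fin.cases ?_ (fun i => ?_) I <;> refine Fin.cases ?_ (fun j => ?_) J <;>
    refine Fin.cases ?_ (fun l => ?_) L <;>
    simp only [amb_00, amb_0s0, amb_0ss, amb_s00, amb_s0s, amb_ss0, amb_sss, d1, d2, d3, pd_const,
      Fin.succ_ne_zero, if_true, if_false, ite_self, ite_mul, mul_ite, zero_mul, mul_zero,
      Finset.sum_ite_eq, Finset.sum_ite_eq', Finset.mem_univ, Finset.sum_const_zero, sub_self,
      add_zero, zero_add, Finset.sum_sub_distrib]
  · split_ifs <;> field_simp <;> ring
  · ring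
  · split_ifs <;> field_simp <;> ring
  · ring
  · rw [hc i j]; ring
  -- The paths through index `0` contribute `t⁻¹ · (-t P)`, which is exactly the Schouten correction
  -- that turns the curvature of the coordinate scale into the Weyl tensor.
  · have := hW i j k l
    simp only [projWeyl, curv, Finset.sum_sub_distrib] at this
    have e1 : (z 0)⁻¹ * z 0 = 1 := inv_mul_cancel₀ hz
    split_ifs at this ⊢
    · linear_combination this - e1 * projSchouten c (coneBase z) j l +
        e1 * projSchouten c (coneBase z) i l
    · linear_combination this - e1 * projSchouten c (coneBase z) j l
    · linear_combination this + e1 * projSchouten c (coneBase z) i l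
    · linear_combination this

end Cone

/-! ### The ambient metric and its Laplacian along the boundary. -/

section Ambient

theorem sum_comm_pairs {α β γ δ : Type*} [Fintype α] [Fintype β] [Fintype γ] [Fintype δ]
    (f : α → β → γ → δ → ℝ) :
    ∑ a, ∑ b, ∑ c, ∑ d, f a b c d = ∑ c, ∑ d, ∑ a, ∑ b, f a b c d := by
  have h1 : ∑ a, ∑ b, ∑ c, ∑ d, f a b c d =
      ∑ p : α × β, ∑ q : γ × δ, f p.1 p.2 q.1 q.2 := by
    simp only [Fintype.sum_prod_type]
  have h2 : ∑ c, ∑ d, ∑ a, ∑ b, f a b c d =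
      ∑ q : γ × δ, ∑ p : α × β, f p.1 p.2 q.1 q.2 := by
    simp only [Fintype.sum_prod_type]
  rw [h1, h2, Finset.sum_comm]

variable {n : ℕ} {Γ c : Symbols (n + 1)} {r τ f : Eu (n + 1) → ℝ}

theorem tractorHess_00 (y : Eu (n + 1)) : tractorHess Γ r y 0 0 = 2 * r y := by
  simp [tractorHess, cotractorD, densityD]

theorem tractorHess_0s (y : Eu (n + 1)) (j : Fin (n + 1)) :
    tractorHess Γ r y 0 j.succ = pd j r y := by
  simp [tractorHess, cotractorD, densityD]

theorem tractorHess_s0 {y : Eu (n + 1)} (hr : DifferentiableAt ℝ r y) (i : Fin (n + 1)) :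
    tractorHess Γ r y i.succ 0 = pd i r y := by
  simp only [tractorHess, cotractorD, densityD, Matrix.of_apply, Fin.cases_succ, Fin.cases_zero,
    Fin.cons_zero, Fin.cons_succ]
  rw [pd_const_mul _ hr]; ring

theorem tractorHess_ss (y : Eu (n + 1)) (i j : Fin (n + 1)) :
    tractorHess Γ r y i.succ j.succ = hess (coordSymbols Γ) r y i j +
      2 * projSchouten (coordSymbols Γ) y i j * r y := by
  simp only [tractorHess, cotractorD, densityD, Matrix.of_apply, Fin.cases_succ, Fin.cons_zero,
    Fin.cons_succ, hess]
  ring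

/-- The ambient Hessian of the homogeneous function `a(t) f(y)`. -/
theorem hess_amb {V : Set (Eu (n + 1))} (hV : IsOpen V) {z : Eu (n + 2)} (hz : coneBase z ∈ V)
    (hf : ∀ y ∈ V, ContDiffAt ℝ ∞ f y) {a a' : ℝ → ℝ} {a'' : ℝ}
    (ha : ∀ t, HasDerivAt a (a' t) t) (ha' : HasDerivAt a' a'' (z 0)) :
    (hess (ambSymbols c) (fun w => a (w 0) * f (coneBase w)) z 0 0 = a'' * f (coneBase z)) ∧
    (∀ j : Fin (n + 1), hess (ambSymbols c) (fun w => a (w 0) * f (coneBase w)) z 0 j.succ =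
      (a' (z 0) - (z 0)⁻¹ * a (z 0)) * pd j f (coneBase z)) ∧
    (∀ i : Fin (n + 1), hess (ambSymbols c) (fun w => a (w 0) * f (coneBase w)) z i.succ 0 =
      (a' (z 0) - (z 0)⁻¹ * a (z 0)) * pd i f (coneBase z)) ∧
    (∀ i j : Fin (n + 1), hess (ambSymbols c) (fun w => a (w 0) * f (coneBase w)) z i.succ j.succ =
      a (z 0) * hess c f (coneBase z) i j +
        z 0 * a' (z 0) * projSchouten c (coneBase z) i j * f (coneBase z)) := by
  have hW : IsOpen {w : Eu (n + 2) | coneBase w ∈ V} :=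
    hV.preimage (contDiff_coneBase (_k := 0)).continuous
  have d0 : ∀ w : Eu (n + 2), coneBase w ∈ V →
      pd 0 (fun w => a (w 0) * f (coneBase w)) w = a' (w 0) * f (coneBase w) := fun w hw =>
    pd_zero_cone (ha _) (hf _ hw).diff
  have ds : ∀ j, ∀ w : Eu (n + 2), coneBase w ∈ V →
      pd (Fin.succ j) (fun w => a (w 0) * f (coneBase w)) w = a (w 0) * pd j f (coneBase w) :=
    fun j w hw => pd_succ_cone (ha _) (hf _ hw).diff j
  have hp : ∀ j, DifferentiableAt ℝ (pd j f) (coneBase z) := fun j =>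
    ContDiffAt.diff (contDiffAt_pd j (hf _ hz))
  refine ⟨?_, fun j => ?_, fun i => ?_, fun i j => ?_⟩
  · rw [hess, pd_congr hW hz d0, pd_zero_cone ha' (hf _ hz).diff]
    simp [amb_00]
  · rw [hess, pd_congr hW hz (ds j), pd_zero_cone (ha _) (hp j), Fin.sum_univ_succ]
    simp [amb_0s0, amb_0ss, ds _ _ hz]
    ring
  · rw [hess, pd_congr hW hz d0, pd_succ_cone ha' (hf _ hz).diff, Fin.sum_univ_succ]
    simp [amb_s00, amb_s0s, ds _ _ hz]
    ring
  · rw [hess, pd_congr hW hz (ds j), pd_succ_cone (ha _) (hp j), Fin.sum_univ_succ]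
    simp only [amb_ss0, amb_sss, ds _ _ hz, d0 _ hz, hess, mul_sub, Finset.mul_sum]
    have : ∀ k, c (coneBase z) i j k * (a (z 0) * pd k f (coneBase z)) =
        a (z 0) * (c (coneBase z) i j k * pd k f (coneBase z)) := fun k => by ring
    simp only [this]
    ring

/-- This makes the Ricci identity available for the ambient metric. The mixed components agree
because `2 t - t⁻¹ t² = t`. -/
theorem ambientMetric_eq_hess {V : Set (Eu (n + 1))} (hV : IsOpen V) {z : Eu (n + 2)}
    (hz : coneBase z ∈ V) (hz0 : z 0 ≠ 0) (hr : ∀ y ∈ V, ContDiffAt ℝ ∞ r y) :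
    ambientMetric Γ r z =
      Matrix.of (hess (ambSymbols (coordSymbols Γ)) (fun w => w 0 ^ 2 * r (coneBase w)) z) := by
  obtain ⟨h1, h2, h3, h4⟩ := hess_amb (c := coordSymbols Γ) hV hz hr (a := fun t => t ^ 2)
    (a' := fun t => 2 * t) (a'' := 2) (fun t => by simpa using hasDerivAt_pow 2 t)
    (by simpa using (hasDerivAt_id (z 0)).const_mul 2)
  ext I J
  refine Fin.cases ?_ (fun i => ?_) I <;> refine Fin.cases ?_ (fun j => ?_) J <;>
    simp only [ambientMetric, Matrix.of_apply, h1, h2, h3, h4, tractorHess_00, tractorHess_0s,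
      tractorHess_s0 (hr _ hz).diff, tractorHess_ss, if_true, Fin.succ_ne_zero, if_false]
  · ring
  · field_simp; ring
  · field_simp; ring
  · field_simp

/-- All rows and columns except those of index `0` carry one factor `t`. -/
theorem det_ambientMetric (z : Eu (n + 2)) :
    (ambientMetric Γ r z).det = (z 0 ^ (n + 1)) ^ 2 * mongeAmpere Γ r (coneBase z) := by
  have : ambientMetric Γ r z = Matrix.of fun I J => (if I = 0 then 1 else z 0) *
      (Matrix.of fun I J => (if J = 0 then 1 else z 0) * tractorHess Γ r (coneBase z) I J) I J := by
    ext I J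
    simp only [ambientMetric, Matrix.of_apply]; ring
  have hp : ∏ I : Fin (n + 2), (if I = 0 then 1 else z 0) = z 0 ^ (n + 1) := by
    rw [Fin.prod_univ_succ]; simp [Fin.succ_ne_zero]
  rw [this, Matrix.det_mul_column, Matrix.det_mul_row, hp, mongeAmpere]
  ring

/-- Differentiability of `r` near `y` is needed because the entry `D_i D_0 r` is `∂_i (2 r) - ∂_i
r`, which simplifies to `∂_i r` only where `r` is differentiable. -/
theorem contDiffAt_tractorHess {y : Eu (n + 1)}
    (hΓ : ∀ i j k, ContDiffAt ℝ ∞ (fun z => Γ z i j k) y) (hr : ContDiffAt ℝ ∞ r y)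
    (hr' : ∀ᶠ z in 𝓝 y, DifferentiableAt ℝ r z)
    (I J : Fin (n + 2)) : ContDiffAt ℝ ∞ (fun z => tractorHess Γ r z I J) y := by
  have h1 := contDiffAt_coordSymbols hΓ
  have h2 := contDiffAt_projSchouten h1
  refine Fin.cases ?_ (fun i => ?_) I <;> refine Fin.cases ?_ (fun j => ?_) J
  · simp only [tractorHess_00]; fun_prop
  · simp only [tractorHess_0s]; fun_prop
  · refine (contDiffAt_pd i hr).congr_of_eventuallyEq ?_
    filter_upwards [hr'] with z hz using tractorHess_s0 hz i
  · simp only [tractorHess_ss, hess]; fun_prop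

theorem contDiffAt_mongeAmpere {y : Eu (n + 1)}
    (hΓ : ∀ i j k, ContDiffAt ℝ ∞ (fun z => Γ z i j k) y) (hr : ContDiffAt ℝ ∞ r y)
    (hr' : ∀ᶠ z in 𝓝 y, DifferentiableAt ℝ r z) :
    ContDiffAt ℝ ∞ (fun z => mongeAmpere Γ r z) y :=
  contDiffAt_det (contDiffAt_tractorHess hΓ hr hr')

/-- On the zero set of a defining density `r` with `J[r] = const + O(r^2)` the ambient Laplacian
of a weight one density is the trace of its tractor Hessian. -/
theorem ambientLaplacian_eq {V : Set (Eu (n + 1))} (hV : IsOpen V) {y : Eu (n + 1)} (hy : y ∈ V)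
    (hΓ : ∀ z ∈ V, ∀ i j k, Γ z i j k = Γ z j i k)
    (hΓs : ∀ z ∈ V, ∀ i j k, ContDiffAt ℝ ∞ (fun z => Γ z i j k) z)
    (hW : ∀ i j k l, projWeyl (coordSymbols Γ) y i j k l = 0)
    (hr : ∀ z ∈ V, ContDiffAt ℝ ∞ r z) (hτ : ∀ z ∈ V, ContDiffAt ℝ ∞ τ z)
    (hr0 : r y = 0) (hJ0 : mongeAmpere Γ r y ≠ 0) (hJ : ∀ i, pd i (mongeAmpere Γ r) y = 0) :
    ambientLaplacian Γ r τ y = -∑ i, ∑ j, (tractorHess Γ r y)⁻¹ (Fin.succ i) (Fin.succ j) *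
      (hess (coordSymbols Γ) τ y i j + projSchouten (coordSymbols Γ) y i j * τ y) := by
  set c := coordSymbols Γ with hc
  set G := ambientMetric Γ r with hG
  set z := conePt 1 y with hzdef
  have hz : coneBase z = y := coneBase_conePt 1 y
  have hz0 : z 0 = 1 := rfl
  have hzV : coneBase z ∈ V := by rwa [hz]
  have hz0' : z 0 ≠ 0 := by rw [hz0]; exact one_ne_zero
  have hcs : ∀ w ∈ V, ∀ i j k, c w i j k = c w j i k := fun w hw => coordSymbols_symm (hΓ w hw)
  have hcc : ∀ w ∈ V, ∀ i j k, ContDiffAt ℝ ∞ (fun z => c z i j k) w := fun w hw =>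
    contDiffAt_coordSymbols (hΓs w hw)
  have hP : ∀ w ∈ V, ∀ i j, projSchouten c w i j = projSchouten c w j i := fun w hw i j => by
    rw [projSchouten, ricci_symm_of_trace hV hw hcs (hcc w hw) fun z _ => sum_coordSymbols z,
      projSchouten]
  set U : Set (Eu (n + 2)) := {w | coneBase w ∈ V ∧ w 0 ≠ 0} with hU
  have hUo : IsOpen U := by
    refine (hV.preimage (contDiff_coneBase (_k := 0)).continuous).inter ?_
    exact isOpen_ne_fun (EuclideanSpace.proj (0 : Fin (n + 2)) : Eu (n + 2) →L[ℝ] ℝ).continuous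
      continuous_const
  have hzU : z ∈ U := ⟨hzV, hz0'⟩
  set q : Eu (n + 2) → ℝ := fun w => w 0 ^ 2 * r (coneBase w) with hq
  have hqs : ∀ w ∈ U, ContDiffAt ℝ ∞ q w := fun w hw =>
    (contDiffAt_apply_zero.pow 2).mul (contDiffAt_comp_coneBase (hr _ hw.1))
  have hGq : ∀ w ∈ U, G w = Matrix.of (hess (ambSymbols c) q w) := fun w hw =>
    ambientMetric_eq_hess hV hw.1 hw.2 hr
  have hamb : ∀ w ∈ U, ∀ I J K, ambSymbols c w I J K = ambSymbols c w J I K := fun w hw =>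
    amb_symm (hcs _ hw.1) (hP _ hw.1)
  have hambs : ∀ w ∈ U, ∀ I J K, ContDiffAt ℝ ∞ (fun z => ambSymbols c z I J K) w := fun w hw =>
    contDiffAt_amb hw.2 (hcc _ hw.1)
  have hGsymm : ∀ w ∈ U, ∀ I J, G w I J = G w J I := fun w hw I J => by
    rw [hGq w hw]; exact hess_symm (hamb w hw) (hqs w hw) I J
  have hGs : ∀ I J, ContDiffAt ℝ ∞ (fun w => G w I J) z := by
    intro I J
    have h1 : ContDiffAt ℝ ∞ (fun w => hess (ambSymbols c) q w I J) z := by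
      have h2 := hqs z hzU
      have h3 := hambs z hzU
      unfold hess; fun_prop
    refine h1.congr_of_eventuallyEq (Filter.eventuallyEq_of_mem (hUo.mem_nhds hzU) fun w hw => ?_)
    simp only [hGq w hw, Matrix.of_apply]
  have hGz : G z = tractorHess Γ r y := by
    ext I J
    simp [hG, ambientMetric, hz, hz0]
  have hdet : (G z).det ≠ 0 := by rw [hGz]; exact hJ0
  -- By the Ricci identity the difference is the curvature contracted with `dq`. The contraction
  -- through index `0` dies since `∂_t (t² r) = 2 t r = 0` on the hypersurface, and the others die
  -- by `curv_amb`. The Cotton tensor therefore never has to be computed.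
  have hcov1 : ∀ K I J, covMetric (ambSymbols c) G z K I J = covMetric (ambSymbols c) G z I K J := by
    intro K I J
    rw [covMetric_congr hUo hzU hGq, covMetric_congr hUo hzU hGq, ← sub_eq_zero,
      covMetric_hess_sub (hamb z hzU) (hambs z hzU) (hqs z hzU), neg_eq_zero, Fin.sum_univ_succ]
    have h0 : pd 0 q z = 0 := by
      rw [hq, pd_zero_cone (a := fun t => t ^ 2) (a' := 2 * z 0)
        (by simpa using hasDerivAt_pow 2 (z 0)) (hr _ hzV).diff, hz, hr0, mul_zero]
    rw [h0, mul_zero, zero_add]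
    refine Finset.sum_eq_zero fun l _ => ?_
    rw [curv_amb hz0' (hcs _ hzV) (hcc _ hzV) (by rw [hz]; exact hW), zero_mul]
  have hcov2 := covMetric_comm (Γ := ambSymbols c) hUo hzU hGsymm
  have hLC := leviCivita_eq (hamb z hzU) (hGsymm z hzU) hdet hcov1 hcov2
  -- The trace is `d log det G` minus twice the trace of the connection. In the `t` direction the
  -- two terms cancel, and in the base directions what remains is the logarithmic derivative of
  -- `J[r]`, which vanishes here.
  have htr : ∀ L, ∑ I, ∑ J, (G z)⁻¹ I J * covMetric (ambSymbols c) G z L I J = 0 := by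
    intro L
    rw [sum_inv_mul_covMetric hGs (hGsymm z hzU) hdet, amb_trace c (fun y i => sum_coordSymbols y i)]
    have hJs : DifferentiableAt ℝ (mongeAmpere Γ r) (coneBase z) := by
      refine ContDiffAt.diff (contDiffAt_mongeAmpere (hΓs _ hzV) (hr _ hzV) ?_)
      filter_upwards [hV.mem_nhds hzV] with w hw using (hr w hw).diff
    have ha : HasDerivAt (fun t : ℝ => (t ^ (n + 1)) ^ 2) (2 * (n + 1)) (z 0) := by
      have := hasDerivAt_pow ((n + 1) * 2) (z 0)
      have h2 : (fun t : ℝ => (t ^ (n + 1)) ^ 2) = fun t => t ^ ((n + 1) * 2) := by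
        funext t; rw [pow_mul]
      rw [hz0] at this ⊢
      rw [h2]
      have h3 : (2 * (n + 1) : ℝ) = (((n + 1) * 2 : ℕ) : ℝ) * 1 ^ ((n + 1) * 2 - 1) := by
        push_cast
        rw [one_pow]; ring
      rw [h3]
      exact this
    have hdd : (fun w => (G w).det) = fun w => (w 0 ^ (n + 1)) ^ 2 * mongeAmpere Γ r (coneBase w) := by
      funext w; exact det_ambientMetric w
    rw [hdd, hGz]
    change _ / mongeAmpere Γ r y - _ = _
    refine Fin.cases ?_ (fun i => ?_) L
    · rw [pd_zero_cone (a := fun t => (t ^ (n + 1)) ^ 2) ha hJs, hz, if_pos rfl, hz0]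
      field_simp; ring
    · rw [pd_succ_cone (a := fun t => (t ^ (n + 1)) ^ 2) ha hJs, hz, hJ,
        if_neg (Fin.succ_ne_zero i)]
      simp
  obtain ⟨h1, h2, h3, h4⟩ := hess_amb (c := c) hV hzV hτ (a := fun t => t) (a' := fun _ => 1)
    (a'' := 0) (fun t => hasDerivAt_id t) (hasDerivAt_const _ _)
  set F : Eu (n + 2) → ℝ := fun w => w 0 * τ (coneBase w) with hF
  -- Passing to the Levi-Civita connection subtracts half of `∇G` contracted with `dF`. Tracing over
  -- `I, J` then kills this correction by `htr`.
  have hhess : ∀ I J, hess (leviCivita G) F z I J = hess (ambSymbols c) F z I J -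
      (1 / 2) * ∑ K, (∑ L, (G z)⁻¹ K L * covMetric (ambSymbols c) G z L I J) * pd K F z := by
    intro I J
    simp only [hess, hLC, add_mul, Finset.sum_add_distrib, mul_assoc, ← Finset.mul_sum]
    ring
  have hlap : laplacian G F z = -∑ I, ∑ J, (G z)⁻¹ I J * hess (ambSymbols c) F z I J := by
    rw [laplacian]
    simp only [hhess, mul_sub, Finset.sum_sub_distrib]
    have : ∑ I, ∑ J, (G z)⁻¹ I J * ((1 / 2) * ∑ K, (∑ L, (G z)⁻¹ K L *
        covMetric (ambSymbols c) G z L I J) * pd K F z) = 0 := by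
      have e : ∀ I J, (G z)⁻¹ I J * ((1 / 2) * ∑ K, (∑ L, (G z)⁻¹ K L *
          covMetric (ambSymbols c) G z L I J) * pd K F z) =
          ∑ K, ∑ L, (1 / 2) * (G z)⁻¹ K L * pd K F z *
            ((G z)⁻¹ I J * covMetric (ambSymbols c) G z L I J) := by
        intro I J
        simp only [Finset.mul_sum, Finset.sum_mul]
        exact Finset.sum_congr rfl fun K _ => Finset.sum_congr rfl fun L _ => by ring
      simp only [e]
      calc ∑ I, ∑ J, ∑ K, ∑ L, (1 / 2) * (G z)⁻¹ K L * pd K F z *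
            ((G z)⁻¹ I J * covMetric (ambSymbols c) G z L I J)
          = ∑ K, ∑ L, ∑ I, ∑ J, (1 / 2) * (G z)⁻¹ K L * pd K F z *
            ((G z)⁻¹ I J * covMetric (ambSymbols c) G z L I J) := by
            exact sum_comm_pairs _
        _ = 0 := by
            simp only [← Finset.mul_sum, htr, mul_zero, Finset.sum_const_zero]
    rw [this, sub_zero]
  rw [ambientLaplacian, hlap, hGz, Fin.sum_univ_succ]
  congr 1
  -- Since `t τ` is linear in `t`, both its second `t`-derivative and the mixed coefficient `a' -
  -- t⁻¹ a` vanish, so only base indices survive.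
  simp only [Fin.sum_univ_succ (n := n + 1), h1, h2, h3, h4, hz0, hz]
  simp
end Ambient

/-! ### The tractor Hessian of the defining function along the slice. -/

section Slice

variable {n : ℕ} {Γ : Symbols (n + 1)} {r τ : Eu (n + 1) → ℝ}

/-- The second fundamental form of the slice `{y 0 = 0}` with respect to `dy 0`; it depends only
on the projective class of `Γ`. -/
def sliceForm (Γ : Symbols (n + 1)) (u : Eu n) : Matrix (Fin n) (Fin n) ℝ :=
  Matrix.of fun a b => -Γ (slicePt u) a.succ b.succ 0

theorem sliceForm_scaleSymbols (τ : Eu (n + 1) → ℝ) (u : Eu n) :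
    sliceForm (scaleSymbols Γ τ) u = sliceForm Γ u := by
  ext a b
  simp [sliceForm, scaleSymbols, Fin.succ_ne_zero]

/-- The component `D_i D_j τ` of the tractor Hessian of a weight one density. -/
def scaleHess (Γ : Symbols (n + 1)) (τ : Eu (n + 1) → ℝ) (y : Eu (n + 1)) (i j : Fin (n + 1)) : ℝ :=
  hess (coordSymbols Γ) τ y i j + projSchouten (coordSymbols Γ) y i j * τ y

/-- The trace of the tractor Hessian of `τ` over the tangent space of the slice. -/
def sliceTrace (Γ : Symbols (n + 1)) (τ : Eu (n + 1) → ℝ) (u : Eu n) : ℝ :=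
  ∑ a, ∑ b, (sliceForm Γ u)⁻¹ a b * scaleHess Γ τ (slicePt u) a.succ b.succ

/-- On the slice the row and the column of index `0` have `∂_0 r` in position `1` as their only
nonzero entry, and the tangential block is `∂_0 r · B`. Hence in the inverse the row and column of
index `1` vanish away from index `0`, and the tangential block is `(∂_0 r)⁻¹ B⁻¹`. The transversal
components of `Q` drop out. -/
theorem sum_tractorHess_inv {u : Eu n} (hr : DifferentiableAt ℝ r (slicePt u))
    (hr0 : pd 0 r (slicePt u) ≠ 0) (hra : ∀ a : Fin n, pd a.succ r (slicePt u) = 0)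
    (hr1 : r (slicePt u) = 0)
    (hrab : ∀ a b : Fin n, pd a.succ (pd b.succ r) (slicePt u) = 0)
    (hdet : (tractorHess Γ r (slicePt u)).det ≠ 0)
    (Q : Fin (n + 1) → Fin (n + 1) → ℝ) :
    ∑ i, ∑ j, (tractorHess Γ r (slicePt u))⁻¹ (Fin.succ i) (Fin.succ j) * Q i j =
      (pd 0 r (slicePt u))⁻¹ * ∑ a, ∑ b, (sliceForm Γ u)⁻¹ a b * Q a.succ b.succ := by
  set M := tractorHess Γ r (slicePt u) with hM
  set B := sliceForm Γ u with hBdef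
  set r0 := pd 0 r (slicePt u)
  have m00 : M 0 0 = 0 := by rw [hM, tractorHess_00, hr1, mul_zero]
  have m01 : M 0 (Fin.succ 0) = r0 := tractorHess_0s _ _
  have m0a : ∀ a : Fin n, M 0 a.succ.succ = 0 := fun a => (tractorHess_0s _ _).trans (hra a)
  have m10 : M (Fin.succ 0) 0 = r0 := tractorHess_s0 hr _
  have ma0 : ∀ a : Fin n, M a.succ.succ 0 = 0 := fun a => (tractorHess_s0 hr _).trans (hra a)
  have mab : ∀ a b : Fin n, M a.succ.succ b.succ.succ = r0 * B a b := by
    intro a b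
    rw [hM, tractorHess_ss, hr1, hess, hrab, Fin.sum_univ_succ]
    have hc : coordSymbols Γ (slicePt u) a.succ b.succ 0 = Γ (slicePt u) a.succ b.succ 0 := by
      simp [coordSymbols, scaleSymbols, Fin.succ_ne_zero]
    simp only [hra, hc, hBdef, sliceForm, Matrix.of_apply]
    simp only [mul_zero, Finset.sum_const_zero]
    ring
  have row0 : ∀ J, M⁻¹ (Fin.succ 0) J = if J = 0 then r0⁻¹ else 0 := by
    intro J
    have := sum_mul_inv hdet 0 J
    rw [Fin.sum_univ_succ, Fin.sum_univ_succ, m00, m01] at this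
    simp only [m0a, zero_mul, Finset.sum_const_zero, add_zero, zero_add] at this
    -- The sign of `∂_0 r` is not assumed, so the cancellation uses its square.
    rw [← mul_left_cancel_iff_of_pos (a := r0 ^ 2) (by positivity)]
    by_cases h : J = 0
    · rw [if_pos h]; rw [if_pos h.symm] at this; field_simp; linear_combination this
    · rw [if_neg h]; rw [if_neg (Ne.symm h)] at this; linear_combination r0 * this
  have col0 : ∀ J, M⁻¹ J (Fin.succ 0) = if J = 0 then r0⁻¹ else 0 := by
    intro J
    have := sum_inv_mul hdet J 0
    rw [Fin.sum_univ_succ, Fin.sum_univ_succ, m00, m10] at this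
    simp only [ma0, mul_zero, Finset.sum_const_zero, add_zero, zero_add] at this
    rw [← mul_left_cancel_iff_of_pos (a := r0 ^ 2) (by positivity)]
    by_cases h : J = 0
    · rw [if_pos h]; rw [if_pos h] at this; field_simp; linear_combination this
    · rw [if_neg h]; rw [if_neg h] at this; linear_combination r0 * this
  have blk : ∀ a b : Fin n, M⁻¹ a.succ.succ b.succ.succ = r0⁻¹ * B⁻¹ a b := by
    have h1 : ∀ a b : Fin n, ∑ k, M⁻¹ a.succ.succ k.succ.succ * (r0 * B k b) =
        if a = b then 1 else 0 := by
      intro a b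
      have := sum_inv_mul hdet a.succ.succ b.succ.succ
      rw [Fin.sum_univ_succ, Fin.sum_univ_succ, m0a, col0, if_neg (Fin.succ_ne_zero _)] at this
      simp only [mab, mul_zero, zero_mul, zero_add, Fin.succ_inj] at this
      exact this
    have h2 : (Matrix.of fun a k : Fin n => r0 * M⁻¹ a.succ.succ k.succ.succ) * B = 1 := by
      ext a b
      rw [Matrix.mul_apply, Matrix.one_apply, ← h1 a b]
      exact Finset.sum_congr rfl fun k _ => by simp only [Matrix.of_apply]; ring
    have h3 := Matrix.inv_eq_left_inv h2
    intro a b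
    rw [h3, Matrix.of_apply]
    field_simp
  rw [Fin.sum_univ_succ]
  simp only [Fin.sum_univ_succ (n := n), row0, col0, blk, Fin.succ_ne_zero, if_false, zero_mul,
    Finset.sum_const_zero, zero_add, add_zero, Finset.mul_sum]
  exact Finset.sum_congr rfl fun a _ => Finset.sum_congr rfl fun b _ => by ring

end Slice

/-! ### Curvature of the connection of a scale. -/

section ScaleCurvature

variable {n : ℕ} {Γ : Symbols (n + 1)} {τ : Eu (n + 1) → ℝ}

theorem scaleSymbols_coordSymbols {y : Eu (n + 1)} (hτ : τ y ≠ 0) :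
    scaleSymbols (coordSymbols Γ) τ y = scaleSymbols Γ τ y :=
  scaleSymbols_congr Γ (coordSymbols Γ) τ (fun y i => scaleForm Γ (fun _ => 1) y i)
    (fun _ _ _ _ => rfl) y hτ

theorem scaleForm_coordSymbols (y : Eu (n + 1)) (i : Fin (n + 1)) :
    scaleForm (coordSymbols Γ) τ y i = -(pd i τ y / τ y) := by
  rw [scaleForm, sum_coordSymbols]; simp

/-- The connection of a scale of a flat projective structure has the curvature of the Schouten
tensor `τ⁻¹ D_i D_j τ`. -/
theorem curv_scaleSymbols {V : Set (Eu (n + 1))} (hV : IsOpen V) {y : Eu (n + 1)} (hy : y ∈ V)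
    (hΓ : ∀ i j k, Γ y i j k = Γ y j i k)
    (hΓs : ∀ i j k, ContDiffAt ℝ ∞ (fun z => Γ z i j k) y)
    (hW : ∀ i j k l, projWeyl (coordSymbols Γ) y i j k l = 0)
    (hτ : ∀ z ∈ V, ContDiffAt ℝ ∞ τ z) (h0 : ∀ z ∈ V, τ z ≠ 0) (i j k l : Fin (n + 1)) :
    curv (scaleSymbols Γ τ) y i j k l = (if i = k then scaleHess Γ τ y j l / τ y else 0) -
      (if j = k then scaleHess Γ τ y i l / τ y else 0) := by
  set c := coordSymbols Γ with hc
  set p : Eu (n + 1) → Fin (n + 1) → ℝ := fun z i => -(pd i τ z / τ z) with hp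
  have hτy := hτ y hy
  have h0y := h0 y hy
  have hps : ∀ i, ContDiffAt ℝ ∞ (fun z => p z i) y := fun i =>
    ((contDiffAt_pd i hτy).div hτy h0y).neg
  have hpd : ∀ i j, pd i (fun z => p z j) y =
      -(pd i (pd j τ) y / τ y - pd j τ y * pd i τ y / τ y ^ 2) := by
    intro i j
    simp only [hp]
    rw [pd_neg, pd_div (contDiffAt_pd j hτy).diff hτy.diff h0y]
  have key := curv_projectiveChange (Γ := c) (Γ' := scaleSymbols Γ τ) (p := p) hV hy
    (coordSymbols_symm hΓ) (contDiffAt_coordSymbols hΓs) hps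
    (fun i j => by rw [hpd, hpd, pd_comm hτy i j]; ring)
    (fun z hz i j k => by
      rw [← scaleSymbols_coordSymbols (h0 z hz)]
      simp only [scaleSymbols, scaleForm_coordSymbols, hp, hc]) i j k l
  -- For `p = -d log τ` the quadratic terms cancel, so `∇p - p ⊗ p` is linear in second derivatives:
  -- it equals `-τ⁻¹ ∇∇τ`.
  have hterm : ∀ j, pd j (fun z => p z l) y - ∑ m, c y j l m * p y m - p y j * p y l =
      -(hess c τ y j l / τ y) := by
    intro j
    have : ∑ m, c y j l m * p y m = -((∑ m, c y j l m * pd m τ y) / τ y) := by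
      rw [Finset.sum_div, ← Finset.sum_neg_distrib]
      exact Finset.sum_congr rfl fun m _ => by simp only [hp]; ring
    rw [hpd, this, hess]
    simp only [hp]
    field_simp
    ring
  have hw := hW i j k l
  rw [projWeyl] at hw
  rw [key, hterm, hterm]
  simp only [scaleHess, add_div, mul_div_assoc, div_self h0y, mul_one, ← hc]
  split_ifs at hw ⊢ <;> linear_combination hw

end ScaleCurvature

/-! ### Gauss and Codazzi equations for a transverse field with `η = 0`. -/

section Hypersurface

/-- The slice `{y 0 = 0}` with transverse field `ξ` satisfying `η = 0`, in a space whose curvature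
is determined by the tensor `Q`. -/
structure FlatHypersurface {n : ℕ} (V : Set (Eu (n + 1))) (Γ : Symbols (n + 1))
    (ξ : Eu n → Fin (n + 1) → ℝ) (Q : Eu n → Fin n → Fin n → ℝ) : Prop where
  isOpen : IsOpen V
  symm : ∀ z ∈ V, ∀ i j k, Γ z i j k = Γ z j i k
  smooth : ∀ z ∈ V, ∀ i j k, ContDiffAt ℝ ∞ (fun w => Γ w i j k) z
  smooth_xi : ∀ u, slicePt u ∈ V → ∀ k, ContDiffAt ℝ ∞ (fun v => ξ v k) u
  xi_ne : ∀ u, slicePt u ∈ V → ξ u 0 ≠ 0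
  eta : ∀ u, slicePt u ∈ V → ∀ a, etaForm Γ ξ u a = 0
  det_ne : ∀ u, slicePt u ∈ V → (affineMetric Γ ξ u).det ≠ 0
  curv_eq : ∀ u, slicePt u ∈ V → ∀ a b k d,
    curv Γ (slicePt u) (Fin.succ a) (Fin.succ b) k (Fin.succ d) =
      (if a.succ = k then Q u b d else 0) - (if b.succ = k then Q u a d else 0)

namespace FlatHypersurface

variable {n : ℕ} {V : Set (Eu (n + 1))} {Γ : Symbols (n + 1)}
    {ξ : Eu n → Fin (n + 1) → ℝ} {Q : Eu n → Fin n → Fin n → ℝ}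
    (H : FlatHypersurface V Γ ξ Q) {u : Eu n} (hu : slicePt u ∈ V)

theorem tang (Γ : Symbols (n + 1)) (ξ : Eu n → Fin (n + 1) → ℝ) (u : Eu n) (a b c : Fin n) : Γ (slicePt u) a.succ b.succ c.succ =
    inducedSymbols Γ ξ u a b c - affineMetric Γ ξ u a b * ξ u c.succ := by
  simp only [affineMetric, inducedSymbols, tangPart, Matrix.of_apply]
  ring

include H

theorem isOpen_slice : IsOpen {u : Eu n | slicePt u ∈ V} :=
  H.isOpen.preimage (contDiff_slicePt (_k := 0)).continuous

include hu

theorem smooth_slice (i j k : Fin (n + 1)) :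
    ContDiffAt ℝ ∞ (fun v => Γ (slicePt v) i j k) u :=
  ContDiffAt.comp u (H.smooth _ hu i j k) contDiff_slicePt.contDiffAt

theorem sff (a b : Fin n) : Γ (slicePt u) a.succ b.succ 0 = -(affineMetric Γ ξ u a b * ξ u 0) := by
  have := H.xi_ne u hu
  simp only [affineMetric, transPart, Matrix.of_apply]
  field_simp

theorem h_symm (a b : Fin n) : affineMetric Γ ξ u a b = affineMetric Γ ξ u b a := by
  simp only [affineMetric, transPart, Matrix.of_apply, H.symm _ hu a.succ]

theorem induced_symm (a b c : Fin n) : inducedSymbols Γ ξ u a b c = inducedSymbols Γ ξ u b a c := by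
  simp only [inducedSymbols, tangPart, transPart, H.symm _ hu a.succ]

theorem smooth_h (a b : Fin n) : ContDiffAt ℝ ∞ (fun v => affineMetric Γ ξ v a b) u := by
  simp only [affineMetric, transPart, Matrix.of_apply]
  exact ((H.smooth_slice hu _ _ _).div (H.smooth_xi u hu 0) (H.xi_ne u hu)).neg

theorem smooth_induced (a b c : Fin n) :
    ContDiffAt ℝ ∞ (fun v => inducedSymbols Γ ξ v a b c) u := by
  simp only [inducedSymbols, tangPart, transPart]
  exact (H.smooth_slice hu _ _ _).sub (((H.smooth_slice hu _ _ _).div (H.smooth_xi u hu 0)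
    (H.xi_ne u hu)).mul (H.smooth_xi u hu _))

theorem covXi_zero (a : Fin n) : covXi Γ ξ u a 0 = 0 := by
  have := H.eta u hu a
  rw [etaForm, transPart, div_eq_zero_iff] at this
  exact this.resolve_right (H.xi_ne u hu)

theorem tangPart_covXi (a b : Fin n) : tangPart (ξ u) (covXi Γ ξ u a) b = covXi Γ ξ u a b.succ := by
  rw [tangPart, transPart, H.covXi_zero hu]; simp

/-- The Codazzi equation for the affine metric, together with the Gauss equation. -/
theorem gauss_codazzi_aux (a b d : Fin n) :
    (pd a (fun v => affineMetric Γ ξ v b d) u +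
        ∑ c, affineMetric Γ ξ u a c * inducedSymbols Γ ξ u b d c =
      pd b (fun v => affineMetric Γ ξ v a d) u +
        ∑ c, affineMetric Γ ξ u b c * inducedSymbols Γ ξ u a d c) ∧
    ∀ e, curv (inducedSymbols Γ ξ) u a b e d =
      (if a = e then Q u b d else 0) - (if b = e then Q u a d else 0)
        + affineMetric Γ ξ u b d * covXi Γ ξ u a e.succ
        - affineMetric Γ ξ u a d * covXi Γ ξ u b e.succ := by
  have hsh := H.smooth_h hu
  have hsi := H.smooth_induced hu
  have hsx := H.smooth_xi u hu
  have hpd : ∀ a b d k, pd (Fin.succ a) (fun z => Γ z (Fin.succ b) (Fin.succ d) k) (slicePt u) =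
      pd a (fun v => Γ (slicePt v) b.succ d.succ k) u := fun a b d k =>
    (pd_slice (H.smooth _ hu _ _ _).diff a).symm
  -- The transversal half of the curvature. The derivative of `ξ^0` is eliminated by `η = 0`,
  -- leaving a multiple of the Codazzi expression.
  have T0 : ∀ a b d, pd (Fin.succ a) (fun z => Γ z (Fin.succ b) (Fin.succ d) 0) (slicePt u) +
      ∑ m, Γ (slicePt u) (Fin.succ a) m 0 * Γ (slicePt u) (Fin.succ b) (Fin.succ d) m =
      -ξ u 0 * (pd a (fun v => affineMetric Γ ξ v b d) u +
        ∑ c, affineMetric Γ ξ u a c * inducedSymbols Γ ξ u b d c) := by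
    intro a b d
    have hx := H.covXi_zero hu a
    rw [covXi, Fin.sum_univ_succ] at hx
    have h1 : pd a (fun v => Γ (slicePt v) b.succ d.succ 0) u =
        -(pd a (fun v => affineMetric Γ ξ v b d) u * ξ u 0 +
          affineMetric Γ ξ u b d * pd a (fun v => ξ v 0) u) := by
      rw [pd_congr (g := fun v => -(affineMetric Γ ξ v b d * ξ v 0)) H.isOpen_slice hu
        fun v hv => H.sff hv b d, pd_neg, pd_mul (hsh b d).diff (hsx 0).diff]
    have h2 : ∑ c : Fin n, Γ (slicePt u) a.succ c.succ 0 * Γ (slicePt u) b.succ d.succ c.succ =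
        -ξ u 0 * (∑ c, affineMetric Γ ξ u a c * inducedSymbols Γ ξ u b d c) -
          affineMetric Γ ξ u b d * ∑ c : Fin n, Γ (slicePt u) a.succ c.succ 0 * ξ u c.succ := by
      rw [Finset.mul_sum, Finset.mul_sum, ← Finset.sum_sub_distrib]
      refine Finset.sum_congr rfl fun c _ => ?_
      rw [tang Γ ξ u b d c, mul_sub, H.sff hu a c]; ring
    rw [hpd, h1, Fin.sum_univ_succ, h2, H.sff hu b d]
    linear_combination (-affineMetric Γ ξ u b d) * hx
  -- The tangential half. It contains `ξ^e` times the same Codazzi expression, so antisymmetrising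
  -- in `a, b` removes that part and leaves the Gauss equation.
  have Te : ∀ a b d e, pd (Fin.succ a) (fun z => Γ z (Fin.succ b) (Fin.succ d) (Fin.succ e))
        (slicePt u) + ∑ m, Γ (slicePt u) (Fin.succ a) m (Fin.succ e) *
          Γ (slicePt u) (Fin.succ b) (Fin.succ d) m =
      pd a (fun v => inducedSymbols Γ ξ v b d e) u +
        ∑ c, inducedSymbols Γ ξ u a c e * inducedSymbols Γ ξ u b d c
        - affineMetric Γ ξ u b d * covXi Γ ξ u a e.succ
        - ξ u e.succ * (pd a (fun v => affineMetric Γ ξ v b d) u +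
          ∑ c, affineMetric Γ ξ u a c * inducedSymbols Γ ξ u b d c) := by
    intro a b d e
    have h1 : pd a (fun v => Γ (slicePt v) b.succ d.succ e.succ) u =
        pd a (fun v => inducedSymbols Γ ξ v b d e) u -
        (pd a (fun v => affineMetric Γ ξ v b d) u * ξ u e.succ +
          affineMetric Γ ξ u b d * pd a (fun v => ξ v e.succ) u) := by
      rw [pd_congr (g := fun v => inducedSymbols Γ ξ v b d e - affineMetric Γ ξ v b d * ξ v e.succ)
        H.isOpen_slice hu fun v hv => tang Γ ξ v b d e,
        pd_sub (hsi b d e).diff ((hsh b d).mul (hsx _)).diff, pd_mul (hsh b d).diff (hsx _).diff]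
    have h2 : ∑ c : Fin n, Γ (slicePt u) a.succ c.succ e.succ * Γ (slicePt u) b.succ d.succ c.succ =
        (∑ c, inducedSymbols Γ ξ u a c e * inducedSymbols Γ ξ u b d c) -
        ξ u e.succ * (∑ c, affineMetric Γ ξ u a c * inducedSymbols Γ ξ u b d c) -
          affineMetric Γ ξ u b d * ∑ c : Fin n, Γ (slicePt u) a.succ c.succ e.succ * ξ u c.succ := by
      rw [Finset.mul_sum, Finset.mul_sum, ← Finset.sum_sub_distrib, ← Finset.sum_sub_distrib]
      refine Finset.sum_congr rfl fun c _ => ?_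
      rw [tang Γ ξ u b d c, mul_sub, tang Γ ξ u a c e]; ring
    rw [hpd, h1, Fin.sum_univ_succ, h2, H.sff hu b d, covXi, Fin.sum_univ_succ]
    ring
  have cod : pd a (fun v => affineMetric Γ ξ v b d) u +
        ∑ c, affineMetric Γ ξ u a c * inducedSymbols Γ ξ u b d c =
      pd b (fun v => affineMetric Γ ξ v a d) u +
        ∑ c, affineMetric Γ ξ u b c * inducedSymbols Γ ξ u a d c := by
    -- The prescribed curvature has no transversal output on tangential arguments, since both
    -- Kronecker deltas vanish at `k = 0`.
    have hc := H.curv_eq u hu a b 0 d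
    rw [curv, Finset.sum_sub_distrib, if_neg (Fin.succ_ne_zero _), if_neg (Fin.succ_ne_zero _)] at hc
    have := H.xi_ne u hu
    have h1 := T0 a b d
    have h2 := T0 b a d
    refine mul_left_cancel₀ this ?_
    linear_combination h1 - h2 - hc
  refine ⟨cod, fun e => ?_⟩
  have hc := H.curv_eq u hu a b e.succ d
  simp only [curv, Finset.sum_sub_distrib, Fin.succ_inj] at hc ⊢
  linear_combination hc - Te a b d e + Te b a d e + ξ u e.succ * cod

/-- Symmetry of the induced connection absorbs the remaining term of `∇h`. Together with the
symmetry of `h`, the tensor `∇h` is totally symmetric. -/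
theorem codazzi (a b d : Fin n) :
    covMetric (inducedSymbols Γ ξ) (affineMetric Γ ξ) u a b d =
      covMetric (inducedSymbols Γ ξ) (affineMetric Γ ξ) u b a d := by
  have h := (H.gauss_codazzi_aux hu a b d).1
  have e1 : ∀ a b, ∑ e, inducedSymbols Γ ξ u a d e * affineMetric Γ ξ u b e =
      ∑ c, affineMetric Γ ξ u b c * inducedSymbols Γ ξ u a d c := fun a b =>
    Finset.sum_congr rfl fun c _ => mul_comm _ _
  have e2 : ∑ e, inducedSymbols Γ ξ u a b e * affineMetric Γ ξ u e d =
      ∑ e, inducedSymbols Γ ξ u b a e * affineMetric Γ ξ u e d :=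
    Finset.sum_congr rfl fun c _ => by rw [H.induced_symm hu]
  simp only [covMetric, e1, e2]
  linear_combination h

theorem cov_comm (a b d : Fin n) :
    covMetric (inducedSymbols Γ ξ) (affineMetric Γ ξ) u a b d =
      covMetric (inducedSymbols Γ ξ) (affineMetric Γ ξ) u a d b :=
  covMetric_comm H.isOpen_slice hu (fun _ hv => H.h_symm hv) a b d

/-- Contracting the Gauss equation gives `Ric_bd = (n - 1) Q_bd + h_bd tr S - h_ad S_b^a`. Tracing
with `h⁻¹` turns the last two terms into `n tr S - tr S`. -/
theorem gauss_trace :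
    ∑ b, ∑ d, (affineMetric Γ ξ u)⁻¹ b d * ricci (inducedSymbols Γ ξ) u b d =
      (n - 1) * ((∑ b, ∑ d, (affineMetric Γ ξ u)⁻¹ b d * Q u b d) + traceShape Γ ξ u) := by
  have hric : ∀ b d, ricci (inducedSymbols Γ ξ) u b d = (n - 1) * Q u b d +
      affineMetric Γ ξ u b d * traceShape Γ ξ u -
        ∑ a, affineMetric Γ ξ u a d * covXi Γ ξ u b a.succ := by
    intro b d
    simp only [ricci, (H.gauss_codazzi_aux hu _ b d).2, traceShape, H.tangPart_covXi hu,
      Finset.sum_sub_distrib, Finset.sum_add_distrib, Finset.mul_sum, if_true]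
    simp
    ring
  have e1 : ∑ b, ∑ d, (affineMetric Γ ξ u)⁻¹ b d * (affineMetric Γ ξ u b d * traceShape Γ ξ u) =
      n * traceShape Γ ξ u := by
    have : ∀ b, ∑ d, (affineMetric Γ ξ u)⁻¹ b d * (affineMetric Γ ξ u b d * traceShape Γ ξ u) =
        traceShape Γ ξ u := by
      intro b
      have h1 := sum_inv_mul (H.det_ne u hu) b b
      rw [if_pos rfl] at h1
      conv_rhs => rw [← one_mul (traceShape Γ ξ u), ← h1, Finset.sum_mul]
      exact Finset.sum_congr rfl fun d _ => by rw [H.h_symm hu b d]; ring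
    simp [this]
  have e2 : ∑ b, ∑ d, (affineMetric Γ ξ u)⁻¹ b d *
      ∑ a, affineMetric Γ ξ u a d * covXi Γ ξ u b a.succ = traceShape Γ ξ u := by
    rw [traceShape]
    refine Finset.sum_congr rfl fun b _ => ?_
    rw [H.tangPart_covXi hu]
    simp only [Finset.mul_sum]
    rw [Finset.sum_comm]
    have : ∀ a, ∑ d, (affineMetric Γ ξ u)⁻¹ b d * (affineMetric Γ ξ u a d * covXi Γ ξ u b a.succ) =
        (if b = a then 1 else 0) * covXi Γ ξ u b a.succ := by
      intro a
      rw [← sum_inv_mul (H.det_ne u hu) b a, Finset.sum_mul]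
      exact Finset.sum_congr rfl fun d _ => by rw [H.h_symm hu a d]; ring
    simp [this]
  have e3 : ∑ b, ∑ d, (affineMetric Γ ξ u)⁻¹ b d * ((n - 1) * Q u b d) =
      (n - 1) * ∑ b, ∑ d, (affineMetric Γ ξ u)⁻¹ b d * Q u b d := by
    simp only [Finset.mul_sum]
    exact Finset.sum_congr rfl fun b _ => Finset.sum_congr rfl fun d _ => by ring
  simp only [hric, mul_sub, mul_add, Finset.sum_sub_distrib, Finset.sum_add_distrib, e1, e2, e3]
  ring

end FlatHypersurface

end Hypersurface

/-! ### Comparison of Ricci tensors of two connections. -/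

section RicciDifference

variable {n : ℕ}

theorem contDiffAt_leviCivita {d : ℕ} {g : Eu d → Matrix (Fin d) (Fin d) ℝ} {y : Eu d}
    (hg : ∀ i j, ContDiffAt ℝ ∞ (fun z => g z i j) y) (hdet : (g y).det ≠ 0) (i j k : Fin d) :
    ContDiffAt ℝ ∞ (fun z => leviCivita g z i j k) y := by
  unfold leviCivita
  refine contDiffAt_const.mul (ContDiffAt.sum fun l _ => (contDiffAt_inv_apply hg hdet k l).mul ?_)
  exact ((contDiffAt_pd i (hg j l)).add (contDiffAt_pd j (hg i l))).sub (contDiffAt_pd l (hg i j))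

theorem sum_rotate {α β γ : Type*} [Fintype α] [Fintype β] [Fintype γ] (f : α → β → γ → ℝ) :
    ∑ a, ∑ b, ∑ c, f a b c = ∑ c, ∑ a, ∑ b, f a b c := by
  calc ∑ a, ∑ b, ∑ c, f a b c = ∑ a, ∑ c, ∑ b, f a b c :=
        Finset.sum_congr rfl fun a _ => Finset.sum_comm
    _ = _ := Finset.sum_comm

/-- The contracted difference of the Ricci tensors of a metric connection `L` and of the connection
`L - A`, for a symmetric, trace free and apolar tensor `A`. -/
theorem sum_ricci_sub {D : Set (Eu n)} (hD : IsOpen D) {u : Eu n} (hu : u ∈ D)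
    {L w : Symbols n} {A : Symbols n} {k : Eu n → Matrix (Fin n) (Fin n) ℝ}
    (hA : ∀ v ∈ D, ∀ a b c, w v a b c = L v a b c - A v a b c)
    (hLs : ∀ a b c, ContDiffAt ℝ ∞ (fun v => L v a b c) u)
    (hAs : ∀ a b c, ContDiffAt ℝ ∞ (fun v => A v a b c) u)
    (hks : ∀ a b, ContDiffAt ℝ ∞ (fun v => k v a b) u)
    (hL : ∀ a b c, L u a b c = L u b a c)
    (hA1 : ∀ a b c, A u a b c = A u b a c) (hA2 : ∀ v ∈ D, ∀ d, ∑ a, A v a d a = 0)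
    (hA3 : ∀ v ∈ D, ∀ a, ∑ b, ∑ d, k v b d * A v b d a = 0)
    (hk : ∀ b d, k u b d = k u d b)
    (hpk : ∀ a b d, pd a (fun v => k v b d) u =
      -(∑ m, L u a m b * k u m d) - ∑ m, L u a m d * k u b m) :
    ∑ b, ∑ d, k u b d * ricci L u b d - ∑ b, ∑ d, k u b d * ricci w u b d =
      ∑ b, ∑ d, k u b d * ∑ a, ∑ m, A u b m a * A u a d m := by
  have hcurv : ∀ a b d, curv w u a b a d = curv L u a b a d - pd a (fun v => A v b d a) u +
      pd b (fun v => A v a d a) u - (∑ m, L u a m a * A u b d m) - (∑ m, A u a m a * w u b d m) +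
      (∑ m, L u b m a * A u a d m) + (∑ m, A u b m a * L u a d m) -
      ∑ m, A u b m a * A u a d m := by
    intro a b d
    have hp : ∀ a b d c, pd a (fun v => w v b d c) u =
        pd a (fun v => L v b d c) u - pd a (fun v => A v b d c) u := fun a b d c => by
      rw [pd_congr hD hu fun v hv => hA v hv b d c, pd_sub (hLs _ _ _).diff (hAs _ _ _).diff]
    simp only [curv, hp, Finset.sum_sub_distrib, hA u hu, mul_sub, sub_mul]
    ring
  -- Vanishing of the trace `A_ad^a` on an open set removes both its derivative and its products
  -- with the symbols.
  have z1 : ∀ b d, ∑ a, pd b (fun v => A v a d a) u = 0 := by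
    intro b d
    rw [← pd_sum fun a _ => (hAs a d a).diff, pd_congr hD hu fun v hv => hA2 v hv d, pd_const]
  have z2 : ∀ b d, ∑ a, ∑ m, A u a m a * w u b d m = 0 := by
    intro b d
    rw [Finset.sum_comm]
    simp only [← Finset.sum_mul, hA2 u hu, zero_mul, Finset.sum_const_zero]
  have hric : ∀ b d, ricci L u b d - ricci w u b d =
      (∑ a, pd a (fun v => A v b d a) u) + (∑ a, ∑ m, L u a m a * A u b d m)
      - (∑ a, ∑ m, L u b m a * A u a d m) - (∑ a, ∑ m, A u b m a * L u a d m)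
      + ∑ a, ∑ m, A u b m a * A u a d m := by
    intro b d
    have e : ricci w u b d = _ := Finset.sum_congr rfl fun a _ => hcurv a b d
    simp only [Finset.sum_sub_distrib, Finset.sum_add_distrib, z1, z2] at e
    rw [e, ricci]; ring
  -- In invariant terms `k^bd ∇_a A_bd^a = ∇_a (k^bd A_bd^a) = 0`, since `k` is parallel for `L`. In
  -- coordinates, `t1` is twice the common value of `t3` and `t4`, and `t2` is zero, so only the
  -- quadratic term in `A` remains.
  have t2 : ∑ b, ∑ d, k u b d * ∑ a, ∑ m, L u a m a * A u b d m = 0 := by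
    simp only [Finset.mul_sum]
    rw [sum_comm_pairs]
    refine Finset.sum_eq_zero fun a _ => Finset.sum_eq_zero fun m _ => ?_
    have : ∀ b d, k u b d * (L u a m a * A u b d m) = L u a m a * (k u b d * A u b d m) :=
      fun b d => by ring
    simp only [this, ← Finset.mul_sum, hA3 u hu, mul_zero]
  have hS1 : ∀ a, ∑ b, ∑ d, pd a (fun v => k v b d) u * A u b d a =
      -2 * ∑ b, ∑ d, ∑ m, L u a m b * k u m d * A u b d a := by
    intro a
    have e1 : ∑ b, ∑ d, ∑ m, L u a m d * k u b m * A u b d a =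
        ∑ b, ∑ d, ∑ m, L u a m b * k u m d * A u b d a := by
      rw [Finset.sum_comm]
      refine Finset.sum_congr rfl fun b _ => Finset.sum_congr rfl fun d _ =>
        Finset.sum_congr rfl fun m _ => ?_
      rw [hk d m, hA1 d b]
    simp only [hpk, sub_mul, neg_mul, Finset.sum_mul, Finset.sum_sub_distrib,
      Finset.sum_neg_distrib, e1]
    ring
  have t1 : ∑ b, ∑ d, k u b d * ∑ a, pd a (fun v => A v b d a) u =
      2 * ∑ a, ∑ b, ∑ d, ∑ m, L u a m b * k u m d * A u b d a := by
    have h0 : ∀ a, ∑ b, ∑ d, (pd a (fun v => k v b d) u * A u b d a +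
        k u b d * pd a (fun v => A v b d a) u) = 0 := by
      intro a
      have : pd a (fun v => ∑ b, ∑ d, k v b d * A v b d a) u = 0 := by
        rw [pd_congr hD hu fun v hv => hA3 v hv a, pd_const]
      rw [← this, pd_sum fun b _ => ContDiffAt.diff (ContDiffAt.sum fun d _ =>
        (hks b d).mul (hAs b d a))]
      refine Finset.sum_congr rfl fun b _ => ?_
      rw [pd_sum fun d _ => ContDiffAt.diff ((hks b d).mul (hAs b d a))]
      exact Finset.sum_congr rfl fun d _ => (pd_mul (hks b d).diff (hAs b d a).diff).symm
    simp only [Finset.mul_sum]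
    rw [sum_rotate]
    refine Finset.sum_congr rfl fun a _ => ?_
    simp only [← Finset.mul_sum]
    have := h0 a
    simp only [Finset.sum_add_distrib, hS1] at this
    linarith
  have t3 : ∑ b, ∑ d, k u b d * ∑ a, ∑ m, L u b m a * A u a d m =
      ∑ a, ∑ b, ∑ d, ∑ m, L u a m b * k u m d * A u b d a := by
    simp only [Finset.mul_sum]
    rw [sum_comm_pairs, Finset.sum_comm]
    refine Finset.sum_congr rfl fun m _ => Finset.sum_congr rfl fun a _ => ?_
    rw [Finset.sum_comm]
    refine Finset.sum_congr rfl fun d _ => Finset.sum_congr rfl fun b _ => ?_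
    rw [hL b m]; ring
  have t4 : ∑ b, ∑ d, k u b d * ∑ a, ∑ m, A u b m a * L u a d m =
      ∑ a, ∑ b, ∑ d, ∑ m, L u a m b * k u m d * A u b d a := by
    simp only [Finset.mul_sum]
    rw [sum_comm_pairs]
    refine Finset.sum_congr rfl fun a _ => Finset.sum_congr rfl fun m _ =>
      Finset.sum_congr rfl fun b _ => Finset.sum_congr rfl fun d _ => ?_
    rw [hA1 b m, hk b d]; ring
  simp only [← Finset.sum_sub_distrib, ← mul_sub, hric]
  simp only [mul_add, mul_sub, Finset.sum_add_distrib, Finset.sum_sub_distrib, t1, t2, t3, t4]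
  ring

end RicciDifference

/-! ### The affine normal field: apolarity and the Gauss equation for `Scal_h`. -/

section Blaschke

/-- A hypersurface with the affine normal field `ξ` of a scale `τ` whose connection is `Γ`. -/
structure BlaschkeHypersurface {n : ℕ} (V : Set (Eu (n + 1))) (Γ : Symbols (n + 1))
    (ξ : Eu n → Fin (n + 1) → ℝ) (Q : Eu n → Fin n → Fin n → ℝ) (τ : Eu (n + 1) → ℝ) : Prop
    extends FlatHypersurface V Γ ξ Q where
  xi_pos : ∀ u, slicePt u ∈ V → 0 < ξ u 0
  tau_pos : ∀ z ∈ V, 0 < τ z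
  tau_smooth : ∀ z ∈ V, ContDiffAt ℝ ∞ τ z
  parallel : ∀ u, slicePt u ∈ V → ∀ a : Fin n, pd a.succ τ (slicePt u) +
    (∑ l, Γ (slicePt u) a.succ l l) / (((n + 1 : ℕ) : ℝ) + 1) * τ (slicePt u) = 0
  volume_eq : ∀ u, slicePt u ∈ V → τ (slicePt u) ^ (-((n : ℝ) + 2)) * ξ u 0 =
    Real.sqrt (affineMetric Γ ξ u).det

namespace BlaschkeHypersurface

variable {n : ℕ} {V : Set (Eu (n + 1))} {Γ : Symbols (n + 1)}
    {ξ : Eu n → Fin (n + 1) → ℝ} {Q : Eu n → Fin n → Fin n → ℝ} {τ : Eu (n + 1) → ℝ}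
    (H : BlaschkeHypersurface V Γ ξ Q τ) {u : Eu n} (hu : slicePt u ∈ V)

include H hu

/-- The left side of the volume normalization is positive, whereas the square root of a nonpositive
number is zero by convention. -/
theorem det_pos : 0 < (affineMetric Γ ξ u).det := by
  have h := H.volume_eq u hu
  have h2 : 0 < τ (slicePt u) ^ (-((n : ℝ) + 2)) * ξ u 0 :=
    mul_pos (Real.rpow_pos_of_pos (H.tau_pos _ hu) _) (H.xi_pos u hu)
  rw [h] at h2
  exact Real.sqrt_pos.1 h2

/-- The induced connection preserves the volume of the affine metric. -/
theorem pd_det_affineMetric (a : Fin n) :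
    pd a (fun v => (affineMetric Γ ξ v).det) u / (affineMetric Γ ξ u).det =
      2 * ∑ i, inducedSymbols Γ ξ u a i i := by
  have hτ0 := H.tau_pos _ hu
  have hx0 := H.xi_pos u hu
  have hτs : ContDiffAt ℝ ∞ (fun v => τ (slicePt v)) u :=
    ContDiffAt.comp u (H.tau_smooth _ hu) contDiff_slicePt.contDiffAt
  have hxs := H.smooth_xi u hu 0
  -- The volume normalization squared: `det h = (τ^{-(n+2)} ξ^0)²`. The logarithmic derivatives of
  -- `τ` and `ξ^0` are then given by `∇τ = 0` and `η = 0`.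
  have hw : ∀ v ∈ {v : Eu n | slicePt v ∈ V}, (affineMetric Γ ξ v).det =
      (τ (slicePt v) ^ (-((n : ℝ) + 2)) * ξ v 0) * (τ (slicePt v) ^ (-((n : ℝ) + 2)) * ξ v 0) := by
    intro v hv
    rw [H.volume_eq v hv, Real.mul_self_sqrt (H.det_pos hv).le]
  have hF := Real.hasDerivAt_rpow_const (x := τ (slicePt u)) (p := -((n : ℝ) + 2)) (Or.inl hτ0.ne')
  have hws : DifferentiableAt ℝ (fun v => τ (slicePt v) ^ (-((n : ℝ) + 2))) u :=
    hτs.diff.rpow_const (Or.inl hτ0.ne')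
  have hpw : pd a (fun v => τ (slicePt v) ^ (-((n : ℝ) + 2))) u =
      -((n : ℝ) + 2) * τ (slicePt u) ^ (-((n : ℝ) + 2) - 1) * pd a.succ τ (slicePt u) := by
    rw [pd_real_comp (f := fun v => τ (slicePt v)) hF hτs.diff, pd_slice (H.tau_smooth _ hu).diff]
  rw [pd_congr H.isOpen_slice hu hw, pd_mul (hws.fun_mul hxs.diff) (hws.fun_mul hxs.diff),
    pd_mul hws hxs.diff, hpw, hw u hu, Real.rpow_sub_one hτ0.ne']
  have hT := Real.rpow_pos_of_pos hτ0 (-((n : ℝ) + 2))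
  set T := τ (slicePt u) ^ (-((n : ℝ) + 2))
  have h1 := H.parallel u hu a
  have h2 := H.covXi_zero hu a
  rw [Fin.sum_univ_succ] at h1
  rw [covXi, Fin.sum_univ_succ] at h2
  -- The sum `h_ac ξ^c` occurs both in `η` and in the trace of the symbols, as does `Γ_a0^0`. Both
  -- cancel, leaving the trace of the induced connection.
  have e1 : ∑ c : Fin n, Γ (slicePt u) a.succ c.succ 0 * ξ u c.succ =
      -(ξ u 0 * ∑ c : Fin n, affineMetric Γ ξ u a c * ξ u c.succ) := by
    rw [Finset.mul_sum, ← Finset.sum_neg_distrib]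
    exact Finset.sum_congr rfl fun c _ => by rw [H.sff hu]; ring
  have e2 : ∑ c : Fin n, Γ (slicePt u) a.succ c.succ c.succ = (∑ c, inducedSymbols Γ ξ u a c c) -
      ∑ c : Fin n, affineMetric Γ ξ u a c * ξ u c.succ := by
    rw [← Finset.sum_sub_distrib]
    exact Finset.sum_congr rfl fun c _ => FlatHypersurface.tang Γ ξ u a c c
  rw [e1] at h2
  rw [e2] at h1
  have hn : ((n + 1 : ℕ) : ℝ) + 1 = (n : ℝ) + 2 := by push_cast; ring
  have hn0 : (n : ℝ) + 2 ≠ 0 := by positivity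
  rw [hn] at h1
  field_simp at h1 ⊢
  linear_combination ξ u 0 * (-2 : ℝ) * h1 + 2 * τ (slicePt u) * h2

/-- The induced connection preserves the volume of `h`, so the trace of `∇h` vanishes. -/
theorem apolar (a : Fin n) : ∑ b, ∑ d, (affineMetric Γ ξ u)⁻¹ b d *
    covMetric (inducedSymbols Γ ξ) (affineMetric Γ ξ) u a b d = 0 := by
  rw [sum_inv_mul_covMetric (H.smooth_h hu) (H.h_symm hu) (H.det_pos hu).ne',
    H.pd_det_affineMetric hu, sub_self]

/-- By the Codazzi equation `∇h` is totally symmetric, so `leviCivita_eq` applies. All algebraic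
properties of `A` follow from this description as half the cubic form with an index raised. -/
theorem fubiniPick_eq (a b c : Fin n) : fubiniPick Γ ξ u a b c = (1 / 2) *
    ∑ l, (affineMetric Γ ξ u)⁻¹ c l *
      covMetric (inducedSymbols Γ ξ) (affineMetric Γ ξ) u l a b := by
  rw [fubiniPick, leviCivita_eq (H.induced_symm hu) (H.h_symm hu) (H.det_pos hu).ne'
    (H.codazzi hu) (H.cov_comm hu)]
  ring

theorem fubiniPick_symm (a b c : Fin n) : fubiniPick Γ ξ u a b c = fubiniPick Γ ξ u b a c := by
  simp only [H.fubiniPick_eq hu, H.cov_comm hu _ a b]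

theorem fubiniPick_trace (d : Fin n) : ∑ a, fubiniPick Γ ξ u a d a = 0 := by
  simp only [H.fubiniPick_eq hu]
  rw [← Finset.mul_sum, ← mul_zero (1 / 2 : ℝ), ← H.apolar hu d]
  congr 1
  refine Finset.sum_congr rfl fun a _ => Finset.sum_congr rfl fun l _ => ?_
  rw [H.cov_comm hu l a d, H.codazzi hu l d a, H.cov_comm hu d l a]

theorem fubiniPick_apolar (a : Fin n) :
    ∑ b, ∑ d, (affineMetric Γ ξ u)⁻¹ b d * fubiniPick Γ ξ u b d a = 0 := by
  simp only [H.fubiniPick_eq hu, Finset.mul_sum]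
  rw [sum_rotate]
  refine Finset.sum_eq_zero fun l _ => ?_
  have := H.apolar hu l
  rw [← mul_zero ((1 / 2) * (affineMetric Γ ξ u)⁻¹ a l), ← this]
  simp only [Finset.mul_sum]
  exact Finset.sum_congr rfl fun b _ => Finset.sum_congr rfl fun d _ => by ring

/-- With its upper index lowered, `A` is half the totally symmetric tensor `∇h`. The indices in
`|A|²` may therefore be rearranged into the pattern that the difference of the Ricci tensors
produces. -/
theorem fubiniPickSq_eq : fubiniPickSq Γ ξ u = ∑ b, ∑ d, (affineMetric Γ ξ u)⁻¹ b d *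
    ∑ a, ∑ m, fubiniPick Γ ξ u b m a * fubiniPick Γ ξ u a d m := by
  set k := (affineMetric Γ ξ u)⁻¹ with hk
  set C := covMetric (inducedSymbols Γ ξ) (affineMetric Γ ξ) u with hC
  have hlow : ∀ c a b, ∑ c', affineMetric Γ ξ u c c' * fubiniPick Γ ξ u a b c' =
      (1 / 2) * C c a b := by
    intro c a b
    simp only [H.fubiniPick_eq hu, Finset.mul_sum]
    rw [Finset.sum_comm]
    have : ∀ l, ∑ c', affineMetric Γ ξ u c c' * ((1 / 2) * (k c' l * C l a b)) =
        (if c = l then 1 else 0) * ((1 / 2) * C l a b) := by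
      intro l
      rw [← sum_mul_inv (H.det_pos hu).ne' c l, Finset.sum_mul]
      exact Finset.sum_congr rfl fun c' _ => by ring
    rw [Finset.sum_congr rfl fun l _ => this l]
    simp
  have hup : ∀ a b c, ∑ a', k a a' * ((1 / 2) * C c a' b) = fubiniPick Γ ξ u c b a := by
    intro a b c
    rw [H.fubiniPick_eq hu, Finset.mul_sum]
    refine Finset.sum_congr rfl fun l _ => ?_
    rw [hC, H.codazzi hu c l b]; ring
  have step : fubiniPickSq Γ ξ u = ∑ a, ∑ b, ∑ c, ∑ b', k b b' * fubiniPick Γ ξ u a b c *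
      fubiniPick Γ ξ u c b' a := by
    rw [fubiniPickSq]
    refine Finset.sum_congr rfl fun a _ => Finset.sum_congr rfl fun b _ =>
      Finset.sum_congr rfl fun c _ => ?_
    rw [Finset.sum_comm]
    refine Finset.sum_congr rfl fun b' _ => ?_
    rw [← hup a b' c, Finset.mul_sum]
    refine Finset.sum_congr rfl fun a' _ => ?_
    rw [← hlow c a' b', Finset.mul_sum, Finset.mul_sum]
    exact Finset.sum_congr rfl fun c' _ => by ring
  rw [step]
  simp only [Finset.mul_sum]
  conv_rhs => rw [sum_comm_pairs, Finset.sum_comm]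
  refine Finset.sum_congr rfl fun a _ => ?_
  rw [Finset.sum_comm]
  refine Finset.sum_congr rfl fun c _ => Finset.sum_congr rfl fun b _ =>
    Finset.sum_congr rfl fun d _ => ?_
  rw [H.fubiniPick_symm hu a b c]
  ring

theorem smooth_fubiniPick (a b c : Fin n) :
    ContDiffAt ℝ ∞ (fun v => fubiniPick Γ ξ v a b c) u := by
  unfold fubiniPick
  exact (contDiffAt_leviCivita (H.smooth_h hu) (H.det_pos hu).ne' a b c).sub
    (H.smooth_induced hu a b c)

theorem leviCivita_symm' (a b c : Fin n) : leviCivita (affineMetric Γ ξ) u a b c =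
    leviCivita (affineMetric Γ ξ) u b a c := by
  have h1 := H.fubiniPick_symm hu a b c
  have h2 := H.induced_symm hu a b c
  simp only [fubiniPick] at h1
  linarith

/-- This says that `h⁻¹` is parallel for its Levi-Civita connection. Compatibility is obtained from
`A = ½ h⁻¹ ∇h`: the contributions of `A` in the two slots of `h` add up to `∇h`. -/
theorem pd_inv_affineMetric (a b d : Fin n) :
    pd a (fun v => (affineMetric Γ ξ v)⁻¹ b d) u =
      -(∑ m, leviCivita (affineMetric Γ ξ) u a m b * (affineMetric Γ ξ u)⁻¹ m d) -
        ∑ m, leviCivita (affineMetric Γ ξ) u a m d * (affineMetric Γ ξ u)⁻¹ b m := by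
  set k := (affineMetric Γ ξ u)⁻¹ with hk
  set h := affineMetric Γ ξ u with hh
  set L := leviCivita (affineMetric Γ ξ) u with hL
  have hd := (H.det_pos hu).ne'
  have hs : ∀ a b, h a b = h b a := H.h_symm hu
  have hpg : ∀ p q, pd a (fun v => affineMetric Γ ξ v p q) u =
      (∑ e, L a p e * h e q) + ∑ e, L a q e * h p e := by
    intro p q
    have hLe : ∀ i j l, L i j l = inducedSymbols Γ ξ u i j l + fubiniPick Γ ξ u i j l :=
      fun i j l => by rw [fubiniPick]; ring
    have hlow : ∀ c a b, ∑ c', h c c' * fubiniPick Γ ξ u a b c' =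
        (1 / 2) * covMetric (inducedSymbols Γ ξ) (affineMetric Γ ξ) u c a b := by
      intro c a b
      simp only [H.fubiniPick_eq hu, Finset.mul_sum]
      rw [Finset.sum_comm]
      have : ∀ l, ∑ c', h c c' * ((1 / 2) * (k c' l *
          covMetric (inducedSymbols Γ ξ) (affineMetric Γ ξ) u l a b)) =
          (if c = l then 1 else 0) * ((1 / 2) *
            covMetric (inducedSymbols Γ ξ) (affineMetric Γ ξ) u l a b) := by
        intro l
        rw [← sum_mul_inv hd c l, Finset.sum_mul]
        exact Finset.sum_congr rfl fun c' _ => by ring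
      rw [Finset.sum_congr rfl fun l _ => this l]
      simp
    have e1 : ∑ e, fubiniPick Γ ξ u a p e * h e q =
        (1 / 2) * covMetric (inducedSymbols Γ ξ) (affineMetric Γ ξ) u a p q := by
      have : ∑ e, fubiniPick Γ ξ u a p e * h e q = ∑ e, h q e * fubiniPick Γ ξ u a p e :=
        Finset.sum_congr rfl fun e _ => by rw [hs e q]; ring
      rw [this, hlow, H.codazzi hu q a p, H.cov_comm hu a q p]
    have e2 : ∑ e, fubiniPick Γ ξ u a q e * h p e =
        (1 / 2) * covMetric (inducedSymbols Γ ξ) (affineMetric Γ ξ) u a p q := by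
      have : ∑ e, fubiniPick Γ ξ u a q e * h p e = ∑ e, h p e * fubiniPick Γ ξ u a q e :=
        Finset.sum_congr rfl fun e _ => by ring
      rw [this, hlow, H.codazzi hu p a q]
    simp only [hLe, add_mul, Finset.sum_add_distrib, e1, e2]
    simp only [covMetric]
    ring
  rw [sum_inv_mul_pd_inv (H.smooth_h hu) hd]
  have f1 : ∑ p, ∑ q, k b p * (∑ e, L a p e * h e q) * k q d = ∑ m, L a m d * k b m := by
    refine Finset.sum_congr rfl fun p _ => ?_
    have : ∀ q, k b p * (∑ e, L a p e * h e q) * k q d =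
        ∑ e, k b p * L a p e * (h e q * k q d) := by
      intro q
      rw [Finset.mul_sum, Finset.sum_mul]
      exact Finset.sum_congr rfl fun e _ => by ring
    simp only [this]
    rw [Finset.sum_comm]
    simp only [← Finset.mul_sum, hk, hh, sum_mul_inv hd]
    simp [mul_comm]
  have f2 : ∑ p, ∑ q, k b p * (∑ e, L a q e * h p e) * k q d = ∑ m, L a m b * k m d := by
    rw [Finset.sum_comm]
    refine Finset.sum_congr rfl fun q _ => ?_
    have : ∀ p, k b p * (∑ e, L a q e * h p e) * k q d =
        ∑ e, L a q e * k q d * (k b p * h p e) := by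
      intro p
      rw [Finset.mul_sum, Finset.sum_mul]
      exact Finset.sum_congr rfl fun e _ => by ring
    simp only [this]
    rw [Finset.sum_comm]
    simp only [← Finset.mul_sum, hk, hh, sum_inv_mul hd]
    simp
  have hk' : (affineMetric Γ ξ u)⁻¹ = k := rfl
  simp only [hk', hpg, mul_add, add_mul, Finset.sum_add_distrib, f1, f2]
  ring

/-- The Gauss equation for the scalar curvature of the affine metric. -/
theorem scal_eq : scal (affineMetric Γ ξ) u - fubiniPickSq Γ ξ u =
    (n - 1) * ((∑ b, ∑ d, (affineMetric Γ ξ u)⁻¹ b d * Q u b d) + traceShape Γ ξ u) := by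
  have hd := (H.det_pos hu).ne'
  rw [← H.gauss_trace hu, H.fubiniPickSq_eq hu,
    ← sum_ricci_sub (L := leviCivita (affineMetric Γ ξ)) (w := inducedSymbols Γ ξ)
      (A := fubiniPick Γ ξ) (k := fun v => (affineMetric Γ ξ v)⁻¹)
      H.isOpen_slice hu (fun v _ a b c => by rw [fubiniPick]; ring)
      (contDiffAt_leviCivita (H.smooth_h hu) hd) (H.smooth_fubiniPick hu)
      (contDiffAt_inv_apply (H.smooth_h hu) hd) (H.leviCivita_symm' hu) (H.fubiniPick_symm hu)
      (fun _ hv => H.fubiniPick_trace hv) (fun _ hv => H.fubiniPick_apolar hv)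
      (inv_symm (H.h_symm hu)) (H.pd_inv_affineMetric hu)]
  rw [scal]
  ring

/-- In the Gauss equation for `Scal_h` the factor `n - 1` is invertible, so the shape operator
formula is equivalent to the vanishing of `tr_h Q`. -/
theorem traceShape_iff (hn : 2 ≤ n) :
    traceShape Γ ξ u = (1 / ((n : ℝ) - 1)) * (scal (affineMetric Γ ξ) u - fubiniPickSq Γ ξ u) ↔
      ∑ b, ∑ d, (affineMetric Γ ξ u)⁻¹ b d * Q u b d = 0 := by
  have h2 : (2 : ℝ) ≤ n := by exact_mod_cast hn
  have h1 : (n : ℝ) - 1 ≠ 0 := by linarith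
  rw [H.scal_eq hu, ← mul_assoc, one_div, inv_mul_cancel₀ h1, one_mul]
  constructor <;> intro h <;> linarith

end BlaschkeHypersurface

end Blaschke

/-! ### Smooth division by the first coordinate. -/

section Division

/-- Induction on the order of differentiability. The target space is quantified inside, because the
integrand of the derivative has values in linear maps; compactness of balls supplies the dominating
bound. -/
theorem contDiff_nat_integral {E : Type} [NormedAddCommGroup E] [NormedSpace ℝ E]
    [FiniteDimensional ℝ E] (k : ℕ) :
    ∀ (F : Type) [NormedAddCommGroup F] [NormedSpace ℝ F] (H : E × ℝ → F), ContDiff ℝ ∞ H →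
      ContDiff ℝ k (fun y => ∫ t in (0 : ℝ)..1, H (y, t)) := by
  have : ProperSpace E := FiniteDimensional.proper ℝ E
  induction k with
  | zero =>
    intro F _ _ H hH
    rw [Nat.cast_zero, contDiff_zero]
    exact intervalIntegral.continuous_parametric_intervalIntegral_of_continuous'
      (f := fun y t => H (y, t)) hH.continuous 0 1
  | succ k ih =>
    intro F _ _ H hH
    have hf : ContDiff ℝ ∞ (fderiv ℝ H) := hH.fderiv_right (by simp)
    set H' : E × ℝ → E →L[ℝ] F := fun p => (fderiv ℝ H p).comp (ContinuousLinearMap.inl ℝ E ℝ)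
    have hH' : ContDiff ℝ ∞ H' := hf.clm_comp contDiff_const
    refine contDiff_succ_iff_hasFDerivAt.2 ⟨fun y => ∫ t in (0 : ℝ)..1, H' (y, t),
      ih _ H' hH', fun y => ?_⟩
    obtain ⟨C, hC⟩ := ((isCompact_closedBall y 1).prod
      (isCompact_Icc (a := (0 : ℝ)) (b := 1))).exists_bound_of_continuousOn hH'.continuous.continuousOn
    have hHc : ∀ x, Continuous fun t => H (x, t) := fun x => hH.continuous.comp (by fun_prop)
    have hHc' : ∀ x, Continuous fun t => H' (x, t) := fun x => hH'.continuous.comp (by fun_prop)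
    refine intervalIntegral.hasFDerivAt_integral_of_dominated_of_fderiv_le (bound := fun _ => C)
      (F := fun x t => H (x, t)) (F' := fun x t => H' (x, t))
      (Metric.closedBall_mem_nhds y one_pos)
      (Filter.Eventually.of_forall fun x => (hHc x).aestronglyMeasurable)
      ((hHc y).intervalIntegrable _ _) (hHc' y).aestronglyMeasurable ?_ (by simp) ?_
    · refine Filter.Eventually.of_forall fun t ht x hx => hC (x, t) ⟨hx, ?_⟩
      rw [Set.uIoc_of_le zero_le_one] at ht
      exact Set.Ioc_subset_Icc_self ht
    · refine Filter.Eventually.of_forall fun t _ x _ => ?_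
      have h1 : HasFDerivAt H (fderiv ℝ H (x, t)) (x, t) :=
        (hH.differentiable (by simp) _).hasFDerivAt
      have h2 : HasFDerivAt (fun x : E => (x, t)) (ContinuousLinearMap.inl ℝ E ℝ) x :=
        hasFDerivAt_prodMk_left x t
      exact h1.comp x h2

theorem contDiff_integral {E F : Type} [NormedAddCommGroup E] [NormedSpace ℝ E]
    [FiniteDimensional ℝ E] [NormedAddCommGroup F] [NormedSpace ℝ F] {H : E × ℝ → F}
    (hH : ContDiff ℝ ∞ H) : ContDiff ℝ ∞ (fun y => ∫ t in (0 : ℝ)..1, H (y, t)) :=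
  contDiff_infty.2 fun k => contDiff_nat_integral k F H hH

variable {n : ℕ}

/-- Hadamard's lemma: a smooth function vanishing on the slice is divisible by `y 0`. -/
theorem exists_eq_mul_of_slice_eq_zero {V : Set (Eu (n + 1))} (hV : IsOpen V)
    {F : Eu (n + 1) → ℝ} (hF : ContDiffOn ℝ ∞ F V) (h0 : ∀ v, slicePt v ∈ V → F (slicePt v) = 0)
    {u : Eu n} (hu : slicePt u ∈ V) :
    ∃ (U : Set (Eu (n + 1))) (φ : Eu (n + 1) → ℝ), IsOpen U ∧ slicePt u ∈ U ∧ U ⊆ V ∧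
      ContDiffOn ℝ ∞ φ U ∧ ∀ y ∈ U, F y = y 0 * φ y := by
  obtain ⟨ε, hε, hball⟩ := Metric.isOpen_iff.1 hV _ hu
  -- The cutoff equals `1` on the ball of radius `ε / 4` and is supported in `V`. It replaces `F` by
  -- a globally smooth function, so that the integral below is smooth on the whole space.
  let χ : ContDiffBump (slicePt u) := ⟨ε / 4, ε / 2, by positivity, by linarith⟩
  have hsupp : tsupport χ ⊆ V := by
    rw [χ.tsupport_eq]
    exact (Metric.closedBall_subset_ball (show χ.rOut < ε by change ε / 2 < ε; linarith)).trans hball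
  set G : Eu (n + 1) → ℝ := fun y => χ y * F y with hG
  have hGs : ContDiff ℝ ∞ G := by
    rw [contDiff_iff_contDiffAt]
    intro y
    by_cases hy : y ∈ V
    · exact χ.contDiff.contDiffAt.mul (hF.contDiffAt (hV.mem_nhds hy))
    · have : y ∉ tsupport χ := fun h => hy (hsupp h)
      have hz : G =ᶠ[𝓝 y] fun _ => 0 := by
        filter_upwards [notMem_tsupport_iff_eventuallyEq.1 this] with z hz
        simp [hG, hz]
      exact contDiffAt_const.congr_of_eventuallyEq hz
  have hG0 : ∀ v, G (slicePt v) = 0 := by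
    intro v
    by_cases hv : slicePt v ∈ V
    · simp [hG, h0 v hv]
    · have : χ (slicePt v) = 0 := by
        by_contra h
        exact hv (hsupp (subset_tsupport _ h))
      simp [hG, this]
  set e : Eu (n + 1) := EuclideanSpace.single 0 1 with he
  -- The segment from the projection of `y` to the slice up to `y`. Integrating the derivative of
  -- `G` along it gives `G y = y 0 · ∫ ∂_0 G`.
  set σ : Eu (n + 1) × ℝ → Eu (n + 1) := fun p => slicePt (sliceProj p.1) + (p.2 * p.1 0) • e with hσ
  have hcoord : ContDiff ℝ ∞ (fun y : Eu (n + 1) => y 0) :=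
    (EuclideanSpace.proj (0 : Fin (n + 1)) : Eu (n + 1) →L[ℝ] ℝ).contDiff
  have hσs : ContDiff ℝ ∞ σ := by
    refine ((contDiff_slicePt.comp contDiff_sliceProj).comp contDiff_fst).add ?_
    exact (contDiff_snd.mul (hcoord.comp contDiff_fst)).smul contDiff_const
  have hGd : ContDiff ℝ ∞ fun z => fderiv ℝ G z e :=
    (hGs.fderiv_right (m := ∞) (by simp)).clm_apply contDiff_const
  refine ⟨Metric.ball (slicePt u) (ε / 4), fun y => ∫ t in (0 : ℝ)..1, fderiv ℝ G (σ (y, t)) e,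
    Metric.isOpen_ball, Metric.mem_ball_self (by positivity),
    (Metric.ball_subset_ball (by linarith)).trans hball,
    (contDiff_integral (H := fun p => fderiv ℝ G (σ p) e) (hGd.comp hσs)).contDiffOn, ?_⟩
  intro y hy
  have hFG : F y = G y := by
    have : χ y = 1 := χ.one_of_mem_closedBall (Metric.ball_subset_closedBall hy)
    simp [hG, this]
  have hσ1 : σ (y, 1) = y := by
    ext i
    refine Fin.cases ?_ (fun a => ?_) i
    · simp [hσ, he, slicePt_zero]
    · simp [hσ, he, slicePt_succ, sliceProj, Fin.succ_ne_zero]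
  have hσ0 : σ (y, 0) = slicePt (sliceProj y) := by simp [hσ]
  have hder : ∀ t : ℝ, HasDerivAt (fun t => G (σ (y, t))) (y 0 * fderiv ℝ G (σ (y, t)) e) t := by
    intro t
    have h1 : HasDerivAt (fun t : ℝ => σ (y, t)) (y 0 • e) t := by
      have := (((hasDerivAt_id t).mul_const (y 0)).smul_const e).const_add
        (slicePt (sliceProj y))
      simpa [hσ] using this
    have h2 := (hGs.differentiable (by simp) (σ (y, t))).hasFDerivAt.comp_hasDerivAt t h1
    rw [map_smul, smul_eq_mul] at h2
    exact h2
  have hint := intervalIntegral.integral_eq_sub_of_hasDerivAt (a := 0) (b := 1)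
    (fun t _ => hder t) (Continuous.intervalIntegrable
      (continuous_const.mul (hGd.continuous.comp (hσs.continuous.comp (by fun_prop)))) _ _)
  rw [hσ1, hσ0, hG0, sub_zero, intervalIntegral.integral_const_mul] at hint
  rw [hFG, ← hint]

end Division

/-! ### Behaviour of the trace under rescaling of the density. -/

section Rescaling

variable {n : ℕ} {Γ : Symbols (n + 1)} {τ υ : Eu (n + 1) → ℝ}

/-- The usual change of the projective Schouten tensor, with the Hessian taken in the connection of
`τ`. The cross terms between `dτ` and `dυ` are exactly what distinguishes this Hessian from the one
in the coordinate scale. -/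
theorem scaleHess_rescale {V : Set (Eu (n + 1))} (hV : IsOpen V) {y : Eu (n + 1)} (hy : y ∈ V)
    (hτ : ∀ z ∈ V, ContDiffAt ℝ ∞ τ z) (h0 : τ y ≠ 0) (hυ : ∀ z ∈ V, ContDiffAt ℝ ∞ υ z)
    (i j : Fin (n + 1)) :
    scaleHess Γ (fun z => Real.exp (-υ z) * τ z) y i j / (Real.exp (-υ y) * τ y) =
      scaleHess Γ τ y i j / τ y - hess (scaleSymbols Γ τ) υ y i j + pd i υ y * pd j υ y := by
  have hE : ∀ z ∈ V, ContDiffAt ℝ ∞ (fun z => Real.exp (-υ z)) z := fun z hz => (hυ z hz).neg.exp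
  have pE : ∀ j, ∀ z ∈ V, pd j (fun z => Real.exp (-υ z)) z = -(Real.exp (-υ z) * pd j υ z) := by
    intro j z hz
    rw [pd_real_comp (f := fun z => -υ z) (Real.hasDerivAt_exp _) (hυ z hz).neg.diff, pd_neg]
    ring
  have p1 : ∀ j, ∀ z ∈ V, pd j (fun z => Real.exp (-υ z) * τ z) z =
      Real.exp (-υ z) * (pd j τ z - pd j υ z * τ z) := by
    intro j z hz
    rw [pd_mul (hE z hz).diff (hτ z hz).diff, pE j z hz]; ring
  have hτy := hτ y hy
  have hυy := hυ y hy
  have p2 : pd i (pd j (fun z => Real.exp (-υ z) * τ z)) y =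
      Real.exp (-υ y) * (pd i (pd j τ) y - pd i (pd j υ) y * τ y - pd j υ y * pd i τ y
        - pd i υ y * (pd j τ y - pd j υ y * τ y)) := by
    rw [pd_congr hV hy (p1 j), pd_mul (hE y hy).diff (ContDiffAt.diff (by fun_prop)),
      pE i y hy, pd_sub (ContDiffAt.diff (by fun_prop)) (ContDiffAt.diff (by fun_prop)),
      pd_mul (ContDiffAt.diff (by fun_prop)) hτy.diff]
    ring
  have hs : hess (scaleSymbols Γ τ) υ y i j = hess (coordSymbols Γ) υ y i j +
      (pd i τ y * pd j υ y + pd j τ y * pd i υ y) / τ y := by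
    simp only [hess]
    rw [← scaleSymbols_coordSymbols h0]
    simp only [scaleSymbols, scaleForm_coordSymbols, add_mul, Finset.sum_add_distrib,
      ite_mul, zero_mul, Finset.sum_ite_eq, Finset.mem_univ, if_true]
    ring
  have hc : ∑ k, coordSymbols Γ y i j k * pd k (fun z => Real.exp (-υ z) * τ z) y =
      Real.exp (-υ y) * ((∑ k, coordSymbols Γ y i j k * pd k τ y) -
        (∑ k, coordSymbols Γ y i j k * pd k υ y) * τ y) := by
    rw [Finset.sum_mul, ← Finset.sum_sub_distrib, Finset.mul_sum]
    exact Finset.sum_congr rfl fun k _ => by rw [p1 k y hy]; ring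
  have he := (Real.exp_pos (-υ y)).ne'
  rw [hs]
  simp only [scaleHess, hess, p2, hc]
  field_simp
  ring

/-- A projective change does not affect `Γ_ab^0`, so affine metrics of all scales and all transverse
fields lie in the conformal class of `B`. -/
theorem affineMetric_eq_smul {Γ' : Symbols (n + 1)} (h : ∀ u, sliceForm Γ' u = sliceForm Γ u)
    {ξ : Eu n → Fin (n + 1) → ℝ} {u : Eu n} :
    affineMetric Γ' ξ u = (ξ u 0)⁻¹ • sliceForm Γ u := by
  rw [← h]
  ext a b
  simp only [affineMetric, transPart, sliceForm, Matrix.of_apply, Matrix.smul_apply, smul_eq_mul]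
  ring

theorem inv_affineMetric {ξ : Eu n → Fin (n + 1) → ℝ} {u : Eu n} (hξ : ξ u 0 ≠ 0) :
    (affineMetric (scaleSymbols Γ τ) ξ u)⁻¹ = ξ u 0 • (sliceForm Γ u)⁻¹ := by
  rw [affineMetric_eq_smul (fun u => sliceForm_scaleSymbols τ u)]
  -- For a singular matrix both inverses are zero by convention, so nondegeneracy need not be
  -- assumed.
  by_cases hd : (sliceForm Γ u).det = 0
  · have h1 : ¬ IsUnit (sliceForm Γ u).det := by simp [hd]
    have h2 : ¬ IsUnit ((ξ u 0)⁻¹ • sliceForm Γ u).det := by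
      rw [Matrix.det_smul, hd, mul_zero]; simp
    rw [Matrix.nonsing_inv_apply_not_isUnit _ h1, Matrix.nonsing_inv_apply_not_isUnit _ h2, smul_zero]
  · refine Matrix.inv_eq_left_inv ?_
    rw [Matrix.smul_mul, Matrix.mul_smul, smul_smul, mul_inv_cancel₀ hξ,
      Matrix.nonsing_inv_mul _ (isUnit_iff_ne_zero.2 hd), one_smul]

theorem sum_inv_affineMetric {ξ : Eu n → Fin (n + 1) → ℝ} {u : Eu n} (hξ : ξ u 0 ≠ 0)
    (σ : Eu (n + 1) → ℝ) :
    ∑ b, ∑ d, (affineMetric (scaleSymbols Γ τ) ξ u)⁻¹ b d *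
      (scaleHess Γ σ (slicePt u) b.succ d.succ / σ (slicePt u)) =
      ξ u 0 / σ (slicePt u) * sliceTrace Γ σ u := by
  rw [inv_affineMetric hξ, sliceTrace]
  simp only [Finset.mul_sum, Matrix.smul_apply, smul_eq_mul]
  exact Finset.sum_congr rfl fun _ _ => Finset.sum_congr rfl fun _ _ => by ring

/-- By the Gauss formula the ambient Hessian restricted to the slice is the `h`-Hessian plus `A`
contracted with `dυ` plus `h · ξυ`. The middle term is trace free by apolarity, and the trace of `h`
is `n`. -/
theorem BlaschkeHypersurface.sum_hess {V : Set (Eu (n + 1))} {ξ : Eu n → Fin (n + 1) → ℝ}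
    {Q : Eu n → Fin n → Fin n → ℝ} (H : BlaschkeHypersurface V Γ ξ Q τ) {u : Eu n}
    (hu : slicePt u ∈ V) (hυ : ∀ z ∈ V, ContDiffAt ℝ ∞ υ z) :
    ∑ b, ∑ d, (affineMetric Γ ξ u)⁻¹ b d * hess Γ υ (slicePt u) (Fin.succ b) (Fin.succ d) =
      -laplacian (affineMetric Γ ξ) (fun v => υ (slicePt v)) u +
        n * ∑ k, ξ u k * pd k υ (slicePt u) := by
  have hd : ∀ a : Fin n, ∀ v ∈ {v : Eu n | slicePt v ∈ V},
      pd a (fun v => υ (slicePt v)) v = pd a.succ υ (slicePt v) :=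
    fun a v hv => pd_slice (hυ _ hv).diff a
  have hdd : ∀ a b : Fin n, pd a (pd b (fun v => υ (slicePt v))) u =
      pd a.succ (pd b.succ υ) (slicePt u) := by
    intro a b
    rw [pd_congr H.isOpen_slice hu (hd b), pd_slice (contDiffAt_pd _ (hυ _ hu)).diff]
  have key : ∀ b d : Fin n, hess Γ υ (slicePt u) b.succ d.succ =
      hess (leviCivita (affineMetric Γ ξ)) (fun v => υ (slicePt v)) u b d +
        (∑ c, fubiniPick Γ ξ u b d c * pd c.succ υ (slicePt u)) +
        affineMetric Γ ξ u b d * ∑ k, ξ u k * pd k υ (slicePt u) := by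
    intro b d
    rw [hess, hess, hdd, Fin.sum_univ_succ, Fin.sum_univ_succ, H.sff hu b d, mul_add, Finset.mul_sum]
    have e : ∀ c : Fin n, Γ (slicePt u) b.succ d.succ c.succ * pd c.succ υ (slicePt u) =
        leviCivita (affineMetric Γ ξ) u b d c * pd c (fun v => υ (slicePt v)) u
        - fubiniPick Γ ξ u b d c * pd c.succ υ (slicePt u)
        - affineMetric Γ ξ u b d * (ξ u c.succ * pd c.succ υ (slicePt u)) := by
      intro c
      rw [hd c u hu, FlatHypersurface.tang Γ ξ u b d c, fubiniPick]; ring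
    rw [Finset.sum_congr rfl fun c _ => e c]
    simp only [Finset.sum_sub_distrib]
    ring
  have t1 : ∑ b, ∑ d, (affineMetric Γ ξ u)⁻¹ b d *
      ∑ c, fubiniPick Γ ξ u b d c * pd c.succ υ (slicePt u) = 0 := by
    simp only [Finset.mul_sum]
    rw [sum_rotate]
    refine Finset.sum_eq_zero fun c _ => ?_
    simp only [← mul_assoc, ← Finset.sum_mul, H.fubiniPick_apolar hu, zero_mul]
  have t2 : ∑ b, ∑ d, (affineMetric Γ ξ u)⁻¹ b d * affineMetric Γ ξ u b d = n := by
    have : ∀ b, ∑ d, (affineMetric Γ ξ u)⁻¹ b d * affineMetric Γ ξ u b d = 1 := by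
      intro b
      have h1 := sum_inv_mul (H.det_pos hu).ne' b b
      rw [if_pos rfl] at h1
      rw [← h1]
      exact Finset.sum_congr rfl fun d _ => by rw [H.h_symm hu b d]
    simp [this]
  simp only [key, mul_add, Finset.sum_add_distrib, t1]
  rw [laplacian]
  simp only [← mul_assoc, ← Finset.sum_mul, t2]
  ring

/-- The change of the trace of the tractor Hessian under a rescaling. -/
theorem BlaschkeHypersurface.sliceTrace_rescale {V : Set (Eu (n + 1))}
    {ξ : Eu n → Fin (n + 1) → ℝ} {Q : Eu n → Fin n → Fin n → ℝ}
    (H : BlaschkeHypersurface V (scaleSymbols Γ τ) ξ Q τ) {u : Eu n}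
    (hu : slicePt u ∈ V) (hυ : ∀ z ∈ V, ContDiffAt ℝ ∞ υ z) :
    ξ u 0 / (Real.exp (-υ (slicePt u)) * τ (slicePt u)) *
        sliceTrace Γ (fun z => Real.exp (-υ z) * τ z) u =
      ξ u 0 / τ (slicePt u) * sliceTrace Γ τ u
        + laplacian (affineMetric (scaleSymbols Γ τ) ξ) (fun v => υ (slicePt v)) u
        + gradSq (affineMetric (scaleSymbols Γ τ) ξ) (fun v => υ (slicePt v)) u
        - n * ∑ k, ξ u k * pd k υ (slicePt u) := by
  have hξ := (H.xi_pos u hu).ne'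
  rw [← sum_inv_affineMetric (τ := τ) hξ τ,
    ← sum_inv_affineMetric (τ := τ) hξ (fun z => Real.exp (-υ z) * τ z)]
  simp only [scaleHess_rescale H.isOpen hu H.tau_smooth (H.tau_pos _ hu).ne' hυ, mul_add, mul_sub,
    Finset.sum_add_distrib, Finset.sum_sub_distrib, H.sum_hess hu hυ]
  have hg : gradSq (affineMetric (scaleSymbols Γ τ) ξ) (fun v => υ (slicePt v)) u =
      ∑ b, ∑ d, (affineMetric (scaleSymbols Γ τ) ξ u)⁻¹ b d *
        (pd (Fin.succ b) υ (slicePt u) * pd (Fin.succ d) υ (slicePt u)) := by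
    rw [gradSq]
    refine Finset.sum_congr rfl fun b _ => Finset.sum_congr rfl fun d _ => ?_
    rw [pd_slice (hυ _ hu).diff, pd_slice (hυ _ hu).diff, mul_assoc]
  rw [hg]
  ring

end Rescaling

/-! ### Constant vector fields on a normed space. -/

section ConstField

variable {E : Type*} [NormedAddCommGroup E] [NormedSpace ℝ E]

/-- A constant vector field on a normed space. -/
def constField (v x : E) : TangentSpace 𝓘(ℝ, E) x := v

theorem contMDiffAt_constField (v y : E) :
    ContMDiffAt 𝓘(ℝ, E) (𝓘(ℝ, E)).tangent ∞
      (fun z => (⟨z, constField v z⟩ : TangentBundle 𝓘(ℝ, E) E)) y := by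
  rw [contMDiffAt_vectorSpace_iff_contDiffAt]
  exact contDiffAt_const

theorem mlieBracket_constField (v w : E) (x : E) :
    VectorField.mlieBracket 𝓘(ℝ, E) (constField v) (constField w) x = 0 := by
  rw [← VectorField.mlieBracketWithin_univ, VectorField.mlieBracketWithin_eq_lieBracketWithin]
  change fderivWithin ℝ (constField w) Set.univ x (constField v x) -
    fderivWithin ℝ (constField v) Set.univ x (constField w x) = (0 : E)
  have h : ∀ u : E, fderivWithin ℝ (fun y : E => u) Set.univ x = 0 := fun u => by simp
  have h2 : ∀ u a : E, fderivWithin ℝ (constField u) Set.univ x a = 0 := fun u a =>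
    congrArg (fun L : E →L[ℝ] E => L a) (h u)
  erw [h2, h2]
  simp

end ConstField

/-! ### Coordinate vector fields of charts of the manifold. -/

section Charts

set_option linter.unusedSectionVars false

variable {n : ℕ} {N : Type*} [TopologicalSpace N] [ChartedSpace (Eu (n + 1)) N]
  [IsManifold 𝓘(ℝ, Eu (n + 1)) ∞ N]

local notation "II" => 𝓘(ℝ, Eu (n + 1))

variable {e e' : OpenPartialHomeomorph N (Eu (n + 1))}

theorem charts.contMDiffAt (he : e ∈ charts n N) {x : N} (hx : x ∈ e.source) :
    ContMDiffAt 𝓘(ℝ, Eu (n + 1)) 𝓘(ℝ, Eu (n + 1)) ∞ e x :=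
  contMDiffAt_of_mem_maximalAtlas he hx

theorem charts.contMDiffAt_symm (he : e ∈ charts n N) {y : Eu (n + 1)} (hy : y ∈ e.target) :
    ContMDiffAt 𝓘(ℝ, Eu (n + 1)) 𝓘(ℝ, Eu (n + 1)) ∞ e.symm y :=
  contMDiffAt_symm_of_mem_maximalAtlas he hy

theorem charts.mdifferentiable (he : e ∈ charts n N) :
    e.MDifferentiable 𝓘(ℝ, Eu (n + 1)) 𝓘(ℝ, Eu (n + 1)) :=
  ⟨fun _ hx => ((charts.contMDiffAt he hx).mdifferentiableAt (by simp)).mdifferentiableWithinAt,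
   fun _ hx =>
    ((charts.contMDiffAt_symm he hx).mdifferentiableAt (by simp)).mdifferentiableWithinAt⟩

theorem charts.symm_comp (he : e ∈ charts n N) {x : N} (hx : x ∈ e.source) :
    (mfderiv II II e.symm (e x)).comp (mfderiv II II e x) =
      ContinuousLinearMap.id ℝ (TangentSpace II x) :=
  (charts.mdifferentiable he).symm_comp_deriv hx

theorem charts.comp_symm (he : e ∈ charts n N) {x : N} (hx : x ∈ e.source) :
    (mfderiv II II e x).comp (mfderiv II II e.symm (e x)) =
      ContinuousLinearMap.id ℝ (TangentSpace II (e x)) := by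
  have := (charts.mdifferentiable he).comp_symm_deriv (e.map_source hx)
  rw [e.left_inv hx] at this
  exact this

theorem charts.isInvertible (he : e ∈ charts n N) {x : N} (hx : x ∈ e.source) :
    (mfderiv II II e x).IsInvertible :=
  ContinuousLinearMap.IsInvertible.of_inverse (charts.comp_symm he hx) (charts.symm_comp he hx)

/-- Coordinate fields are pullbacks of constant fields, so smoothness and vanishing of brackets
follow from naturality. -/
theorem coordField_eq_mpullback (he : e ∈ charts n N) (j : Fin (n + 1)) {x : N}
    (hx : x ∈ e.source) :
    coordField e j x =
      VectorField.mpullback II II e (constField (EuclideanSpace.single j (1 : ℝ))) x := by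
  have h : (mfderiv II II e x).inverse = mfderiv II II e.symm (e x) :=
    ContinuousLinearMap.inverse_eq (charts.comp_symm he hx) (charts.symm_comp he hx)
  rw [VectorField.mpullback_apply, h]
  rfl

theorem contMDiffAt_coordField (he : e ∈ charts n N) (j : Fin (n + 1)) {x : N}
    (hx : x ∈ e.source) :
    ContMDiffAt II (II).tangent ∞
      (fun z => (⟨z, coordField e j z⟩ : TangentBundle II N)) x := by
  have h := ContMDiffAt.mpullback_vectorField_preimage (I := II) (I' := II) (m := ∞) (n := ∞)
    (V := constField (EuclideanSpace.single j (1 : ℝ)))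
    (contMDiffAt_constField _ (e x)) (charts.contMDiffAt he hx) (charts.isInvertible he hx)
    (by simp)
  refine h.congr_of_eventuallyEq ?_
  filter_upwards [e.open_source.mem_nhds hx] with z hz
  rw [coordField_eq_mpullback he j hz]

theorem mlieBracket_coordField (he : e ∈ charts n N) (i j : Fin (n + 1)) {x : N}
    (hx : x ∈ e.source) :
    VectorField.mlieBracket II (coordField e i) (coordField e j) x = 0 := by
  have hle : ∀ k : ℕ, ((k : ℕ∞) : WithTop ℕ∞) ≤ (∞ : WithTop ℕ∞) := fun k =>
    WithTop.coe_le_coe.2 le_top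
  have hms : minSmoothness ℝ 2 ≤ (∞ : WithTop ℕ∞) := by simpa using hle 2
  have : IsManifold 𝓘(ℝ, Eu (n + 1)) (minSmoothness ℝ 2) N := IsManifold.of_le hms
  have : IsManifold 𝓘(ℝ, Eu (n + 1)) (minSmoothness ℝ 3) N :=
    IsManifold.of_le (n := ∞) (by simpa using hle 3)
  have h := VectorField.mpullback_mlieBracket (I := II) (I' := II) (n := ∞) (x₀ := x) (f := e)
    (V := constField (EuclideanSpace.single i (1 : ℝ)))
    (W := constField (EuclideanSpace.single j (1 : ℝ)))
    ((contMDiffAt_constField _ (e x)).mdifferentiableAt (by simp))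
    ((contMDiffAt_constField _ (e x)).mdifferentiableAt (by simp)) (charts.contMDiffAt he hx) hms
  have hc : ∀ k, coordField e k =ᶠ[𝓝 x] VectorField.mpullback II II e
      (constField (EuclideanSpace.single k (1 : ℝ))) := fun k => by
    filter_upwards [e.open_source.mem_nhds hx] with z hz using coordField_eq_mpullback he k hz
  rw [(hc i).mlieBracket_vectorField_eq (hc j), ← h, VectorField.mpullback_apply]
  erw [mlieBracket_constField]
  simp

/-- The coordinate change from `e'` to `e`. -/
abbrev chg (e e' : OpenPartialHomeomorph N (Eu (n + 1))) (z : Eu (n + 1)) : Eu (n + 1) :=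
  e (e'.symm z)

theorem contDiffAt_chg (he : e ∈ charts n N) (he' : e' ∈ charts n N) {y : Eu (n + 1)}
    (hy : y ∈ e'.target) (hy' : e'.symm y ∈ e.source) : ContDiffAt ℝ ∞ (chg e e') y := by
  rw [← contMDiffAt_iff_contDiffAt]
  exact (charts.contMDiffAt he hy').comp y (charts.contMDiffAt_symm he' hy)

theorem fderiv_chg (he : e ∈ charts n N) (he' : e' ∈ charts n N) {y : Eu (n + 1)}
    (hy : y ∈ e'.target) (hy' : e'.symm y ∈ e.source) :
    fderiv ℝ (chg e e') y =
      (mfderiv II II e (e'.symm y)).comp (mfderiv II II e'.symm y) := by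
  rw [← mfderiv_eq_fderiv]
  exact mfderiv_comp y ((charts.contMDiffAt he hy').mdifferentiableAt (by simp))
    ((charts.contMDiffAt_symm he' hy).mdifferentiableAt (by simp))

theorem eu_eq_sum_single {d : ℕ} (v : Eu d) :
    v = ∑ k, v k • (EuclideanSpace.single k (1 : ℝ) : Eu d) := by
  ext i
  simp [Pi.single_apply]

theorem pd_chg_apply (he : e ∈ charts n N) (he' : e' ∈ charts n N) {y : Eu (n + 1)}
    (hy : y ∈ e'.target) (hy' : e'.symm y ∈ e.source) (j k : Fin (n + 1)) :
    pd j (fun z => chg e e' z k) y = fderiv ℝ (chg e e') y (EuclideanSpace.single j 1) k := by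
  have h := (contDiffAt_chg he he' hy hy').diff.hasFDerivAt
  have h2 := ((EuclideanSpace.proj (𝕜 := ℝ) k).hasFDerivAt.comp y h).fderiv
  rw [pd]
  erw [h2]
  rfl

/-- Vectors are determined by their components. -/
theorem eq_sum_coordComp (he : e ∈ charts n N) {x : N} (hx : x ∈ e.source)
    (v : TangentSpace II x) : v = ∑ k, coordComp e x v k • coordField e k x := by
  have h := congrArg (fun L => L v) (charts.symm_comp he hx)
  have h2 := eu_eq_sum_single (show Eu (n + 1) from mfderiv II II e x v)
  have h3 : mfderiv II II e.symm (e x) (mfderiv II II e x v) = v := h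
  rw [← h3]
  conv_lhs => rw [show mfderiv II II e x v = _ from h2]
  rw [h3]
  erw [map_sum]
  refine Finset.sum_congr rfl fun k _ => ?_
  erw [map_smul]
  rfl

theorem coordComp_coordField (he : e ∈ charts n N) (he' : e' ∈ charts n N) {x : N}
    (hx : x ∈ e.source) (hx' : x ∈ e'.source) (j k : Fin (n + 1)) :
    coordComp e x (coordField e' j x) k = pd j (fun z => chg e e' z k) (e' x) := by
  have hx0 : e'.symm (e' x) = x := e'.left_inv hx'
  have h2 : e'.symm (e' x) ∈ e.source := by rw [hx0]; exact hx
  rw [pd_chg_apply he he' (e'.map_source hx') h2, fderiv_chg he he' (e'.map_source hx') h2, hx0]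
  rfl

theorem coordField_change (he : e ∈ charts n N) (he' : e' ∈ charts n N) {x : N}
    (hx : x ∈ e.source) (hx' : x ∈ e'.source) (j : Fin (n + 1)) :
    coordField e' j x = ∑ k, pd j (fun z => chg e e' z k) (e' x) • coordField e k x := by
  rw [eq_sum_coordComp he hx (coordField e' j x)]
  simp only [coordComp_coordField he he' hx hx']

end Charts

/-! ### Christoffel symbols: symmetry, smoothness, transformation law. -/

section Christoffel

set_option linter.unusedSectionVars false

variable {n : ℕ} {N : Type*} [TopologicalSpace N] [ChartedSpace (Eu (n + 1)) N]
  [IsManifold 𝓘(ℝ, Eu (n + 1)) ∞ N]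

local notation "II" => 𝓘(ℝ, Eu (n + 1))

variable {e e' : OpenPartialHomeomorph N (Eu (n + 1))}

/-- The components of a smooth vector field in a chart are smooth. -/
theorem contDiffAt_coordComp (he : e ∈ charts n N) {V : ∀ x : N, TangentSpace II x}
    {y : Eu (n + 1)} (hy : y ∈ e.target)
    (hV : ContMDiffAt II (II).tangent ∞ (fun z => (⟨z, V z⟩ : TangentBundle II N)) (e.symm y))
    (k : Fin (n + 1)) :
    ContDiffAt ℝ ∞ (fun z => coordComp e (e.symm z) (V (e.symm z)) k) y := by
  have hinv : ∀ z ∈ e.target, (mfderiv II II e.symm z).inverse = mfderiv II II e (e.symm z) := by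
    intro z hz
    have h1 := charts.comp_symm he (e.map_target hz)
    have h2 := charts.symm_comp he (e.map_target hz)
    rw [e.right_inv hz] at h1 h2
    exact ContinuousLinearMap.inverse_eq h2 h1
  have hinvt : (mfderiv II II e.symm y).IsInvertible := by
    have h1 := charts.comp_symm he (e.map_target hy)
    have h2 := charts.symm_comp he (e.map_target hy)
    rw [e.right_inv hy] at h1 h2
    exact ContinuousLinearMap.IsInvertible.of_inverse h2 h1
  have h := ContMDiffAt.mpullback_vectorField_preimage (I := II) (I' := II) (m := ∞) (n := ∞)
    (V := V) (f := e.symm) hV (charts.contMDiffAt_symm he hy) hinvt (by simp)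
  have h3 := contMDiffAt_vectorSpace_iff_contDiffAt.1 h
  have h4 : ContDiffAt ℝ ∞ (fun z => (show Eu (n + 1) from
      VectorField.mpullback II II e.symm V z) k) y :=
    (EuclideanSpace.proj (𝕜 := ℝ) k).contDiff.contDiffAt.comp y h3
  refine h4.congr_of_eventuallyEq ?_
  filter_upwards [e.open_target.mem_nhds hy] with z hz
  rw [VectorField.mpullback_apply, hinv z hz]
  rfl

variable (nabla : CovariantDerivative 𝓘(ℝ, Eu (n + 1)) (Eu (n + 1))
      (TangentSpace 𝓘(ℝ, Eu (n + 1)) : N → Type _))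

theorem mdifferentiableAt_coordField (he : e ∈ charts n N) (j : Fin (n + 1)) {x : N}
    (hx : x ∈ e.source) :
    MDifferentiableAt II (II).tangent
      (fun z => (⟨z, coordField e j z⟩ : TangentBundle II N)) x :=
  (contMDiffAt_coordField he j hx).mdifferentiableAt (by simp)

theorem christoffel_symm (htorsion : nabla.torsion = 0) (he : e ∈ charts n N)
    {y : Eu (n + 1)} (hy : y ∈ e.target) (i j k : Fin (n + 1)) :
    christoffel nabla e y i j k = christoffel nabla e y j i k := by
  have hx := e.map_target hy
  have h := (nabla.torsion_eq_zero_iff.1 htorsion)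
    (mdifferentiableAt_coordField he i hx) (mdifferentiableAt_coordField he j hx)
  rw [mlieBracket_coordField he i j hx, sub_eq_zero] at h
  simp only [christoffel, h]

theorem contDiffAt_christoffel [T2Space N]
    [CovariantDerivative.ContMDiffCovariantDerivative nabla ∞] (he : e ∈ charts n N)
    {y : Eu (n + 1)} (hy : y ∈ e.target) (i j k : Fin (n + 1)) :
    ContDiffAt ℝ ∞ (fun z => christoffel nabla e z i j k) y := by
  have hx := e.map_target hy
  set x := e.symm y with hxdef
  -- Smoothness of the covariant derivative concerns global sections, so the coordinate field is
  -- first cut off.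
  obtain ⟨f, -, hf⟩ := (SmoothBumpFunction.nhds_basis_tsupport (I := II) x).mem_iff.1
    (e.open_source.mem_nhds hx)
  have hX : ContMDiff II (II).tangent ∞
      (fun z => (⟨z, ((f : N → ℝ) • coordField e j) z⟩ : TangentBundle II N)) :=
    ContMDiffOn.smul_section_of_tsupport (u := e.source) f.contMDiff.contMDiffOn e.open_source hf
      (fun z hz => (contMDiffAt_coordField he j hz).contMDiffWithinAt)
  have hcov := (CovariantDerivative.ContMDiffCovariantDerivative.contMDiff
    (cov := nabla) (k := ∞)).contMDiff (σ := (f : N → ℝ) • coordField e j)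
    (by simpa using hX.contMDiffOn)
  have h1 := ((hcov x (Set.mem_univ x)).contMDiffAt Filter.univ_mem).clm_bundle_apply
    (contMDiffAt_coordField he i hx)
  refine (contDiffAt_coordComp he hy h1 k).congr_of_eventuallyEq ?_
  -- For every point near `x` the cutoff equals `1` on a whole neighbourhood of that point, as
  -- locality of `∇` requires.
  have hone : ∀ᶠ z in 𝓝 x, ∀ᶠ w in 𝓝 z, f w = 1 := f.eventuallyEq_one.eventually_nhds
  have hcont : Filter.Tendsto e.symm (𝓝 y) (𝓝 x) := e.symm.continuousAt hy
  filter_upwards [hcont.eventually hone, e.open_target.mem_nhds hy] with z hz hzt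
  have hxs := e.map_target hzt
  have : nabla.toFun ((f : N → ℝ) • coordField e j) (e.symm z) =
      nabla (coordField e j) (e.symm z) := by
    refine nabla.isCovariantDerivativeOnUniv.congr_of_eventuallyEq
      ((hX (e.symm z)).mdifferentiableAt (by simp)) (mdifferentiableAt_coordField he j hxs)
      Filter.univ_mem ?_
    filter_upwards [hz] with w hw
    simp [hw]
  rw [this]
  rfl

theorem coordComp_sum_smul (e : OpenPartialHomeomorph N (Eu (n + 1))) (x : N) {ι : Type*}
    (s : Finset ι) (c : ι → ℝ) (v : ι → TangentSpace II x) (k : Fin (n + 1)) :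
    coordComp e x (∑ a ∈ s, c a • v a) k = ∑ a ∈ s, c a * coordComp e x (v a) k := by
  have h : ∀ w, coordComp e x w k =
    ((EuclideanSpace.proj (𝕜 := ℝ) k).comp (mfderiv II II e x) : _ →L[ℝ] ℝ) w := fun _ => rfl
  simp only [h, map_sum, map_smul, smul_eq_mul]

theorem coordComp_add (e : OpenPartialHomeomorph N (Eu (n + 1))) (x : N)
    (v w : TangentSpace II x) (k : Fin (n + 1)) :
    coordComp e x (v + w) k = coordComp e x v k + coordComp e x w k := by
  have h : ∀ w, coordComp e x w k =
    ((EuclideanSpace.proj (𝕜 := ℝ) k).comp (mfderiv II II e x) : _ →L[ℝ] ℝ) w := fun _ => rfl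
  simp only [h, map_add]

theorem coordComp_coordField_self (he : e ∈ charts n N) {x : N} (hx : x ∈ e.source)
    (j k : Fin (n + 1)) : coordComp e x (coordField e j x) k = if k = j then 1 else 0 := by
  have h := congrArg (fun L => L (EuclideanSpace.single j (1 : ℝ))) (charts.comp_symm he hx)
  have h2 : (mfderiv II II e x (coordField e j x) : Eu (n + 1)) = EuclideanSpace.single j (1 : ℝ) :=
    h
  unfold coordComp
  erw [h2]
  simp

/-- The derivative of a function given in a chart. -/
theorem mfderiv_comp_chart (he : e ∈ charts n N) {x : N} (hx : x ∈ e.source)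
    {F : Eu (n + 1) → ℝ} (hF : DifferentiableAt ℝ F (e x)) (i : Fin (n + 1)) :
    mvfderiv II (fun z => F (e z)) x (coordField e i x) = pd i F (e x) := by
  have h := mfderiv_comp x hF.mdifferentiableAt
    ((charts.contMDiffAt he hx).mdifferentiableAt (by simp))
  have h2 := congrArg (fun L => L (EuclideanSpace.single i (1 : ℝ))) (charts.comp_symm he hx)
  have h3 : (mfderiv II II e x (coordField e i x) : Eu (n + 1)) = EuclideanSpace.single i (1 : ℝ) :=
    h2
  have h4 : mfderiv II 𝓘(ℝ, ℝ) (fun z => F (e z)) x (coordField e i x) =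
      (mfderiv II 𝓘(ℝ, ℝ) F (e x)) (mfderiv II II e x (coordField e i x)) :=
    congrArg (fun L => L (coordField e i x)) h
  change (mfderiv II 𝓘(ℝ, ℝ) (fun z => F (e z)) x (coordField e i x) : ℝ) = _
  rw [h4]
  erw [h3, mfderiv_eq_fderiv]
  rfl

/-- Differentiability of the sum is carried along with the formula, since additivity of `∇` needs it
in the induction step. -/
theorem covariantDerivative_sum_smul {ι : Type*} (s : Finset ι) (g : ι → N → ℝ)
    (σ : ι → ∀ x : N, TangentSpace II x) {x : N}
    (hg : ∀ m ∈ s, MDifferentiableAt II 𝓘(ℝ, ℝ) (g m) x)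
    (hσ : ∀ m ∈ s, MDifferentiableAt II (II).tangent
      (fun z => (⟨z, σ m z⟩ : TangentBundle II N)) x) (v : TangentSpace II x) :
    MDifferentiableAt II (II).tangent
      (fun z => (⟨z, (∑ m ∈ s, g m • σ m) z⟩ : TangentBundle II N)) x ∧
    nabla (∑ m ∈ s, g m • σ m) x v =
      ∑ m ∈ s, (g m x • nabla (σ m) x v + mvfderiv II (g m) x v • σ m x) := by
  classical
  induction s using Finset.induction_on with
  | empty =>
    refine ⟨?_, by simp⟩
    exact Bundle.mdifferentiableAt_zeroSection ℝ _
  | insert a s ha ih =>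
    have ih' := ih (fun m hm => hg m (Finset.mem_insert_of_mem hm))
      (fun m hm => hσ m (Finset.mem_insert_of_mem hm))
    have h1 := hg a (Finset.mem_insert_self a s)
    have h2 := hσ a (Finset.mem_insert_self a s)
    have h3 := h1.smul_section h2
    rw [Finset.sum_insert ha, Finset.sum_insert ha]
    refine ⟨mdifferentiableAt_add_section h3 ih'.1, ?_⟩
    have h4 : nabla (g a • σ a + ∑ m ∈ s, g m • σ m) x =
        nabla (g a • σ a) x + nabla (∑ m ∈ s, g m • σ m) x :=
      nabla.isCovariantDerivativeOnUniv.add h3 ih'.1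
    have h5 : nabla (g a • σ a) x = g a x • nabla (σ a) x +
        (mvfderiv II (g a) x).smulRight (σ a x) :=
      nabla.isCovariantDerivativeOnUniv.leibniz h2 h1
    rw [h4, add_apply, ih'.2, h5]
    simp

theorem christoffel_apply_chart {x : N} (hx : x ∈ e.source) (i j k : Fin (n + 1)) :
    christoffel nabla e (e x) i j k =
      coordComp e x (nabla (coordField e j) x (coordField e i x)) k := by
  have h : ∀ z, z = x → coordComp e z (nabla (coordField e j) z (coordField e i z)) k =
      coordComp e x (nabla (coordField e j) x (coordField e i x)) k := fun z hz => by rw [hz]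
  exact h _ (e.left_inv hx)

/-- The transformation law of the Christoffel symbols. -/
theorem christoffel_chg (he : e ∈ charts n N) (he' : e' ∈ charts n N) {y : Eu (n + 1)}
    (hy : y ∈ e'.target) (hy' : e'.symm y ∈ e.source) (i j k : Fin (n + 1)) :
    ∑ p, christoffel nabla e' y i j p * pd p (fun z => chg e e' z k) y =
      pd i (pd j (fun z => chg e e' z k)) y + ∑ l, ∑ m, christoffel nabla e (chg e e' y) l m k *
        pd i (fun z => chg e e' z l) y * pd j (fun z => chg e e' z m) y := by
  set x := e'.symm y with hxdef
  have hx' : x ∈ e'.source := e'.map_target hy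
  have hyx : e' x = y := e'.right_inv hy
  have hφ : ∀ m, ContDiffAt ℝ ∞ (fun z => chg e e' z m) y := fun m =>
    (EuclideanSpace.proj (𝕜 := ℝ) m).contDiff.contDiffAt.comp y (contDiffAt_chg he he' hy hy')
  have hφ' : ∀ j m, ContDiffAt ℝ ∞ (pd j (fun z => chg e e' z m)) (e' x) := fun j m => by
    rw [hyx]; have := hφ m; fun_prop
  set g : Fin (n + 1) → N → ℝ := fun m z => pd j (fun z => chg e e' z m) (e' z) with hg
  have hgd : ∀ m, MDifferentiableAt II 𝓘(ℝ, ℝ) (g m) x := fun m =>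
    MDifferentiableAt.comp x (hφ' j m).diff.mdifferentiableAt
      ((charts.contMDiffAt he' hx').mdifferentiableAt (by simp))
  have hsum := covariantDerivative_sum_smul nabla Finset.univ g (coordField e) (x := x)
    (fun m _ => hgd m) (fun m _ => mdifferentiableAt_coordField he m hy') (coordField e' i x)
  -- Near `x` the field `∂'_j` is the combination of the fields `∂_m` with coefficients from the
  -- Jacobian; the Leibniz rule then yields the second derivative term of the transformation law.
  have hcongr : nabla (coordField e' j) x = nabla (∑ m, g m • coordField e m) x := by
    refine nabla.isCovariantDerivativeOnUniv.congr_of_eventuallyEq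
      (mdifferentiableAt_coordField he' j hx') hsum.1 Filter.univ_mem ?_
    filter_upwards [e.open_source.mem_nhds hy', e'.open_source.mem_nhds hx'] with w hw hw'
    rw [coordField_change he he' hw hw' j]
    simp [hg]
  have hL : nabla (coordField e' j) x (coordField e' i x) =
      ∑ p, christoffel nabla e' y i j p • coordField e' p x :=
    eq_sum_coordComp he' hx' _
  have hR := hsum.2
  rw [← hcongr, hL] at hR
  have key := congrArg (fun v => coordComp e x v k) hR
  simp only [Finset.sum_add_distrib] at key
  rw [coordComp_add, coordComp_sum_smul, coordComp_sum_smul, coordComp_sum_smul] at key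
  simp only [coordComp_coordField he he' hy' hx', hyx, coordComp_coordField_self he hy'] at key
  rw [key, add_comm]
  congr 1
  · simp only [hg, mfderiv_comp_chart he' hx' (hφ' j _).diff, hyx]
    simp
  · rw [Finset.sum_comm]
    refine Finset.sum_congr rfl fun m _ => ?_
    have h1 : nabla (coordField e m) x (coordField e' i x) =
        ∑ l, pd i (fun z => chg e e' z l) y • nabla (coordField e m) x (coordField e l x) := by
      rw [coordField_change he he' hy' hx' i, map_sum, hyx]
      simp only [map_smul]
    rw [h1, coordComp_sum_smul, Finset.mul_sum]
    refine Finset.sum_congr rfl fun l _ => ?_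
    have h2 : chg e e' y = e x := rfl
    rw [h2, christoffel_apply_chart nabla hy']
    simp only [hg, hyx]
    ring

end Christoffel

/-! ### Local analysis along a strictly convex boundary. -/

section LocalBoundary

/-- A flat projective structure near the strictly convex hypersurface `{y 0 = 0}`, with a defining
function `r` solving the Monge-Ampere equation to second order. -/
structure LocalBoundary {n : ℕ} (V : Set (Eu (n + 1))) (Γ : Symbols (n + 1)) (r : Eu (n + 1) → ℝ) :
    Prop where
  isOpen : IsOpen V
  symm : ∀ z ∈ V, ∀ i j k, Γ z i j k = Γ z j i k
  smooth : ∀ z ∈ V, ∀ i j k, ContDiffAt ℝ ∞ (fun w => Γ w i j k) z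
  weyl : ∀ z ∈ V, ∀ i j k l, projWeyl (coordSymbols Γ) z i j k l = 0
  smooth_r : ∀ z ∈ V, ContDiffAt ℝ ∞ r z
  neg_iff : ∀ z ∈ V, r z < 0 ↔ z 0 < 0
  fderiv_ne : ∀ u, slicePt u ∈ V → fderiv ℝ r (slicePt u) ≠ 0
  convex : ∀ u, slicePt u ∈ V → ∀ X : Fin (n + 1) → ℝ, X ≠ 0 →
    ∑ i, X i * pd i r (slicePt u) = 0 → 0 < ∑ i, ∑ j, hess Γ r (slicePt u) i j * X i * X j
  mongeAmpere_eq : ∀ u, slicePt u ∈ V → mongeAmpere Γ r (slicePt u) = -1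
  pd_mongeAmpere : ∀ u, slicePt u ∈ V → ∀ i, pd i (mongeAmpere Γ r) (slicePt u) = 0

variable {n : ℕ}

/-- The derivative along the line through `y` in the direction of the first coordinate. -/
theorem hasDerivAt_firstLine {f : Eu (n + 1) → ℝ} {y : Eu (n + 1)} (hf : DifferentiableAt ℝ f y) :
    HasDerivAt (fun t : ℝ => f (y + t • EuclideanSpace.single 0 1)) (pd 0 f y) 0 := by
  have h1 : HasDerivAt (fun t : ℝ => y + t • (EuclideanSpace.single 0 1 : Eu (n + 1)))
      (EuclideanSpace.single 0 1) 0 := by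
    simpa using ((hasDerivAt_id (0 : ℝ)).smul_const
      (EuclideanSpace.single 0 1 : Eu (n + 1))).const_add y
  have h2 : HasFDerivAt f (fderiv ℝ f y) (y + (0 : ℝ) • EuclideanSpace.single 0 1) := by
    simpa using hf.hasFDerivAt
  exact h2.comp_hasDerivAt 0 h1

theorem tendsto_firstLine (y : Eu (n + 1)) :
    Filter.Tendsto (fun t : ℝ => y + t • (EuclideanSpace.single 0 1 : Eu (n + 1)))
      (𝓝[<] 0) (𝓝 y) := by
  have : Continuous (fun t : ℝ => y + t • (EuclideanSpace.single 0 1 : Eu (n + 1))) := by fun_prop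
  have h := (this.tendsto 0).mono_left (nhdsWithin_le_nhds (s := Set.Iio 0))
  simpa using h

theorem firstLine_zero (y : Eu (n + 1)) (t : ℝ) :
    (y + t • (EuclideanSpace.single 0 1 : Eu (n + 1))) 0 = y 0 + t := by simp

theorem pd_zero_mul_slice {a : Eu (n + 1) → ℝ} {u : Eu n}
    (ha : DifferentiableAt ℝ a (slicePt u)) :
    pd 0 (fun z => z 0 * a z) (slicePt u) = a (slicePt u) := by
  have h : DifferentiableAt ℝ (fun z : Eu (n + 1) => z 0) (slicePt u) :=
    (EuclideanSpace.proj (0 : Fin (n + 1)) : Eu (n + 1) →L[ℝ] ℝ).differentiableAt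
  rw [pd_mul h ha, pd_coord, slicePt_zero]
  simp

namespace LocalBoundary

variable {V : Set (Eu (n + 1))} {Γ : Symbols (n + 1)} {r : Eu (n + 1) → ℝ}
  (L : LocalBoundary V Γ r) {u : Eu n} (hu : slicePt u ∈ V)

include L

theorem isOpen_slice : IsOpen {v : Eu n | slicePt v ∈ V} :=
  L.isOpen.preimage (contDiff_slicePt (_k := 0)).continuous

theorem contDiffAt_mongeAmpere {z : Eu (n + 1)} (hz : z ∈ V) :
    ContDiffAt ℝ ∞ (fun w => mongeAmpere Γ r w) z := by
  refine HarmonicScale.contDiffAt_mongeAmpere (L.smooth z hz) (L.smooth_r z hz) ?_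
  filter_upwards [L.isOpen.mem_nhds hz] with w hw using (L.smooth_r w hw).diff

theorem contDiffAt_ambientLaplacian {τ : Eu (n + 1) → ℝ} {z : Eu (n + 1)} (hz : z ∈ V)
    (hτ : ContDiffAt ℝ ∞ τ z) (hJ : mongeAmpere Γ r z ≠ 0) :
    ContDiffAt ℝ ∞ (fun w => ambientLaplacian Γ r τ w) z := by
  have hb : coneBase (conePt 1 z) = z := coneBase_conePt 1 z
  have hg : ∀ I J, ContDiffAt ℝ ∞ (fun w => ambientMetric Γ r w I J) (conePt 1 z) := by
    intro I J
    have h1 : ContDiffAt ℝ ∞ (fun w => tractorHess Γ r w I J) (coneBase (conePt 1 z)) := by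
      rw [hb]
      refine contDiffAt_tractorHess (L.smooth z hz) (L.smooth_r z hz) ?_ I J
      filter_upwards [L.isOpen.mem_nhds hz] with w hw using (L.smooth_r w hw).diff
    have h2 := contDiffAt_comp_coneBase h1
    have h3 : ContDiffAt ℝ ∞ (fun w : Eu (n + 2) => w 0) (conePt 1 z) := contDiffAt_apply_zero
    simp only [ambientMetric, Matrix.of_apply]
    split_ifs <;> fun_prop
  have hdet : (ambientMetric Γ r (conePt 1 z)).det ≠ 0 := by
    rw [det_ambientMetric, hb, conePt_zero]
    simpa using hJ
  have hf : ContDiffAt ℝ ∞ (fun w : Eu (n + 2) => w 0 * τ (coneBase w)) (conePt 1 z) :=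
    contDiffAt_apply_zero.mul (contDiffAt_comp_coneBase (by rwa [hb]))
  have hL : ContDiffAt ℝ ∞ (laplacian (ambientMetric Γ r) fun w => w 0 * τ (coneBase w))
      (conePt 1 z) := by
    have h1 := contDiffAt_leviCivita hg hdet
    have h2 := contDiffAt_inv_apply hg hdet
    unfold laplacian hess
    refine (ContDiffAt.sum fun I _ => ContDiffAt.sum fun J _ => (h2 I J).mul ?_).neg
    fun_prop
  have hc : ContDiff ℝ ∞ (conePt 1 : Eu (n + 1) → Eu (n + 2)) := by
    rw [contDiff_euclidean]
    intro I
    refine Fin.cases ?_ (fun i => ?_) I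
    · exact contDiff_const
    · exact (EuclideanSpace.proj i : Eu (n + 1) →L[ℝ] ℝ).contDiff
  exact hL.comp z hc.contDiffAt

include hu

theorem eventually_neg : ∀ᶠ t in 𝓝[<] (0 : ℝ),
    r (slicePt u + t • (EuclideanSpace.single 0 1 : Eu (n + 1))) < 0 := by
  filter_upwards [(tendsto_firstLine (slicePt u)).eventually (L.isOpen.mem_nhds hu),
    self_mem_nhdsWithin] with t ht ht0
  rw [L.neg_iff _ ht, firstLine_zero, slicePt_zero]
  simpa using ht0

/-- Continuity from the side `y 0 < 0` gives `r ≤ 0`, and `r < 0` is excluded because the point is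
not in the half space. -/
theorem r_slice : r (slicePt u) = 0 := by
  refine le_antisymm ?_ ?_
  · exact le_of_tendsto (((L.smooth_r _ hu).continuousAt.tendsto).comp
      (tendsto_firstLine (slicePt u))) ((L.eventually_neg hu).mono fun t ht => ht.le)
  · by_contra h
    have := (L.neg_iff _ hu).1 (not_le.1 h)
    rw [slicePt_zero] at this
    exact lt_irrefl _ this

theorem pd_succ_r (a : Fin n) : pd a.succ r (slicePt u) = 0 := by
  rw [← pd_slice (L.smooth_r _ hu).diff,
    pd_congr L.isOpen_slice (g := fun _ => 0) hu fun v hv => L.r_slice hv, pd_const]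

theorem pd_succ_pd_succ_r (a b : Fin n) : pd a.succ (pd b.succ r) (slicePt u) = 0 := by
  have h := contDiffAt_pd b.succ (L.smooth_r _ hu)
  rw [← pd_slice (f := pd b.succ r) h.diff,
    pd_congr L.isOpen_slice (g := fun _ => 0) hu fun v hv => L.pd_succ_r hv b, pd_const]

/-- The tangential derivatives vanish, so a nonzero differential has nonzero `∂_0 r`. Its sign comes
from difference quotients taken from the inside. -/
theorem pd_zero_r_pos : 0 < pd 0 r (slicePt u) := by
  have hne : pd 0 r (slicePt u) ≠ 0 := by
    intro h
    refine L.fderiv_ne u hu ?_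
    ext v
    rw [fderiv_eq_sum_pd, Fin.sum_univ_succ, h]
    simp [L.pd_succ_r hu]
  refine lt_of_le_of_ne ?_ hne.symm
  have h := (hasDerivAt_firstLine (L.smooth_r _ hu).diff).hasDerivWithinAt (s := Set.Iio 0)
  have h2 := (hasDerivWithinAt_iff_tendsto_slope' (by simp)).1 h
  refine ge_of_tendsto h2 ?_
  filter_upwards [L.eventually_neg hu, self_mem_nhdsWithin] with t ht ht0
  simp only [slope, sub_zero, zero_smul, add_zero, L.r_slice hu, vsub_eq_sub, smul_eq_mul]
  exact (mul_pos_of_neg_of_neg (inv_lt_zero.2 ht0) ht).le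

theorem hess_r (a b : Fin n) :
    hess Γ r (slicePt u) a.succ b.succ = pd 0 r (slicePt u) * sliceForm Γ u a b := by
  rw [hess, Fin.sum_univ_succ, L.pd_succ_pd_succ_r hu]
  simp only [L.pd_succ_r hu, sliceForm, Matrix.of_apply]
  simp; ring

/-- Vectors tangent to the slice are annihilated by `dr`, and on them the Hessian of `r` is `∂_0 r ·
B` with `∂_0 r > 0`. Strict convexity is thus positivity of `B`. -/
theorem posDef : (sliceForm Γ u).PosDef := by
  refine Matrix.PosDef.of_dotProduct_mulVec_pos ?_ fun X hX => ?_
  · ext a b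
    simp [sliceForm, L.symm _ hu]
  · have h := L.convex u hu (Fin.cons 0 X) (fun h => hX (by
      funext a; simpa using congrFun h a.succ)) (by
      rw [Fin.sum_univ_succ]; simp [L.pd_succ_r hu])
    rw [Fin.sum_univ_succ] at h
    simp only [Fin.sum_univ_succ (n := n), Fin.cons_zero, Fin.cons_succ, mul_zero, zero_mul,
      Finset.sum_const_zero, add_zero, zero_add, L.hess_r hu] at h
    have h0 := L.pd_zero_r_pos hu
    refine pos_of_mul_pos_right (a := pd 0 r (slicePt u)) ?_ h0.le
    refine lt_of_lt_of_eq h ?_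
    simp only [dotProduct, Matrix.mulVec, Finset.mul_sum, star_trivial]
    exact Finset.sum_congr rfl fun _ _ => Finset.sum_congr rfl fun _ _ => by ring

theorem det_sliceForm_pos : 0 < (sliceForm Γ u).det := (L.posDef hu).det_pos

theorem ambientLaplacian_slice {τ : Eu (n + 1) → ℝ} (hτ : ∀ z ∈ V, ContDiffAt ℝ ∞ τ z) :
    ambientLaplacian Γ r τ (slicePt u) = -((pd 0 r (slicePt u))⁻¹ * sliceTrace Γ τ u) := by
  have hJ := L.mongeAmpere_eq u hu
  have hdet : mongeAmpere Γ r (slicePt u) ≠ 0 := by rw [hJ]; norm_num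
  rw [ambientLaplacian_eq L.isOpen hu L.symm L.smooth (L.weyl _ hu) L.smooth_r hτ (L.r_slice hu)
    hdet (L.pd_mongeAmpere u hu),
    sum_tractorHess_inv (L.smooth_r _ hu).diff (L.pd_zero_r_pos hu).ne' (L.pd_succ_r hu)
      (L.r_slice hu) (L.pd_succ_pd_succ_r hu) hdet]
  rfl

/-- Division by the defining function. -/
theorem exists_eq_r_mul {W : Set (Eu (n + 1))} (hW : IsOpen W) (hWV : W ⊆ V)
    {F : Eu (n + 1) → ℝ} (hF : ContDiffOn ℝ ∞ F W) (huW : slicePt u ∈ W)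
    (h0 : ∀ v, slicePt v ∈ W → F (slicePt v) = 0) :
    ∃ (U : Set (Eu (n + 1))) (φ : Eu (n + 1) → ℝ), IsOpen U ∧ slicePt u ∈ U ∧ U ⊆ W ∧
      ContDiffOn ℝ ∞ φ U ∧ ∀ y ∈ U, F y = r y * φ y := by
  obtain ⟨U, φ, hU, huU, hUW, hφ, hFφ⟩ := exists_eq_mul_of_slice_eq_zero hW hF h0 huW
  have hr : ContDiffOn ℝ ∞ r W := fun z hz => (L.smooth_r z (hWV hz)).contDiffWithinAt
  obtain ⟨U', a, hU', huU', hUW', ha, hra⟩ := exists_eq_mul_of_slice_eq_zero hW hr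
    (fun v hv => L.r_slice (hWV hv)) huW
  have ha0 : a (slicePt u) ≠ 0 := by
    have h1 : pd 0 r (slicePt u) = a (slicePt u) := by
      rw [pd_congr hU' huU' hra, pd_zero_mul_slice (contDiffAt_of_mem hU' ha huU').diff]
    rw [← h1]
    exact (L.pd_zero_r_pos hu).ne'
  have hopen : IsOpen {z ∈ U ∩ U' | a z ≠ 0} :=
    (ha.continuousOn.mono Set.inter_subset_right).isOpen_inter_preimage (hU.inter hU')
      isOpen_compl_singleton
  refine ⟨{z ∈ U ∩ U' | a z ≠ 0}, fun z => φ z / a z, hopen, ⟨⟨huU, huU'⟩, ha0⟩,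
    fun z hz => hUW hz.1.1, ?_, ?_⟩
  · exact (hφ.mono fun z hz => hz.1.1).div (ha.mono fun z hz => hz.1.2) fun z hz => hz.2
  · rintro z ⟨⟨h1, h2⟩, h3⟩
    rw [hFφ z h1, hra z h2]
    field_simp

/-- After one division `F = r φ`, and on the slice `∂_0 F = ∂_0 r · φ`. Hence `φ` vanishes there too
and can be divided again. -/
theorem exists_eq_r_sq_mul {W : Set (Eu (n + 1))} (hW : IsOpen W) (hWV : W ⊆ V)
    {F : Eu (n + 1) → ℝ} (hF : ContDiffOn ℝ ∞ F W) (huW : slicePt u ∈ W)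
    (h0 : ∀ v, slicePt v ∈ W → F (slicePt v) = 0)
    (h1 : ∀ v, slicePt v ∈ W → pd 0 F (slicePt v) = 0) :
    ∃ (U : Set (Eu (n + 1))) (φ : Eu (n + 1) → ℝ), IsOpen U ∧ slicePt u ∈ U ∧ U ⊆ W ∧
      ContDiffOn ℝ ∞ φ U ∧ ∀ y ∈ U, F y = r y ^ 2 * φ y := by
  obtain ⟨U, φ, hU, huU, hUW, hφ, hFφ⟩ := L.exists_eq_r_mul hu hW hWV hF huW h0
  obtain ⟨U', ψ, hU', huU', hUU', hψ, hφψ⟩ := L.exists_eq_r_mul hu hU (hUW.trans hWV) hφ huU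
    (fun v hv => by
      have hvV := hWV (hUW hv)
      have h := h1 v (hUW hv)
      rw [pd_congr hU hv hFφ, pd_mul (L.smooth_r _ hvV).diff (contDiffAt_of_mem hU hφ hv).diff,
        L.r_slice hvV] at h
      simpa [(L.pd_zero_r_pos hvV).ne'] using h)
  refine ⟨U', ψ, hU', huU', hUU'.trans hUW, hψ, fun y hy => ?_⟩
  rw [hFφ y (hUU' hy), hφψ y hy]
  ring

theorem sliceTrace_eq_zero_of_bigO {τ : Eu (n + 1) → ℝ} (hτ : ∀ z ∈ V, ContDiffAt ℝ ∞ τ z)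
    {φ : Eu (n + 1) → ℝ}
    (h : ambientLaplacian Γ r τ (slicePt u) = r (slicePt u) ^ 1 * φ (slicePt u)) :
    sliceTrace Γ τ u = 0 := by
  rw [L.ambientLaplacian_slice hu hτ, L.r_slice hu] at h
  simpa [(L.pd_zero_r_pos hu).ne'] using h

theorem bigO_of_sliceTrace_eq_zero {τ : Eu (n + 1) → ℝ} (hτ : ∀ z ∈ V, ContDiffAt ℝ ∞ τ z)
    (h : ∀ v, slicePt v ∈ V → sliceTrace Γ τ v = 0) :
    ∃ (U : Set (Eu (n + 1))) (φ : Eu (n + 1) → ℝ), IsOpen U ∧ slicePt u ∈ U ∧ U ⊆ V ∧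
      ContDiffOn ℝ ∞ φ U ∧ ∀ y ∈ U, ambientLaplacian Γ r τ y = r y ^ 1 * φ y := by
  have hJ : ContinuousOn (fun z => mongeAmpere Γ r z) V := fun z hz =>
    (L.contDiffAt_mongeAmpere hz).continuousAt.continuousWithinAt
  -- The ambient Laplacian is smooth only where the ambient metric is nondegenerate, so the division
  -- takes place where `J[r] ≠ 0`.
  have hW : IsOpen (V ∩ (fun z => mongeAmpere Γ r z) ⁻¹' {0}ᶜ) :=
    hJ.isOpen_inter_preimage L.isOpen isOpen_compl_singleton
  have huW : slicePt u ∈ V ∩ (fun z => mongeAmpere Γ r z) ⁻¹' {0}ᶜ := by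
    refine ⟨hu, ?_⟩
    simp [L.mongeAmpere_eq u hu]
  obtain ⟨U, φ, hU, huU, hUW, hφ, hF⟩ := L.exists_eq_r_mul hu hW Set.inter_subset_left
    (F := ambientLaplacian Γ r τ)
    (fun z hz => (L.contDiffAt_ambientLaplacian hz.1 (hτ z hz.1) hz.2).contDiffWithinAt) huW
    (fun v hv => by rw [L.ambientLaplacian_slice hv.1 hτ, h v hv.1]; simp)
  exact ⟨U, φ, hU, huU, fun z hz => (hUW hz).1, hφ, fun y hy => by rw [hF y hy, pow_one]⟩

end LocalBoundary

end LocalBoundary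

/-! ### From local to global: parts (iii) and (ii). -/

section GlobalBoundary

variable {n : ℕ} {N : Type*} [TopologicalSpace N] [ChartedSpace (Eu (n + 1)) N]
  {e : OpenPartialHomeomorph N (Eu (n + 1))} {Ω : Set N}

theorem mem_iff_of_boundaryChart (he : e ∈ boundaryCharts (n := n) Ω) {y : Eu (n + 1)}
    (hy : y ∈ e.target) : e.symm y ∈ Ω ↔ y 0 < 0 := by
  rw [he.2 _ (e.map_target hy), e.right_inv hy]

theorem symm_slicePt_mem_frontier (hΩ : IsOpen Ω) (he : e ∈ boundaryCharts (n := n) Ω) {u : Eu n}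
    (hu : slicePt u ∈ e.target) : e.symm (slicePt u) ∈ frontier Ω := by
  rw [hΩ.frontier_eq]
  constructor
  · have h1 : Filter.Tendsto (fun t : ℝ => e.symm
        (slicePt u + t • (EuclideanSpace.single 0 1 : Eu (n + 1)))) (𝓝[<] 0)
        (𝓝 (e.symm (slicePt u))) := (e.symm.continuousAt hu).tendsto.comp (tendsto_firstLine _)
    refine mem_closure_of_tendsto h1 ?_
    filter_upwards [(tendsto_firstLine (slicePt u)).eventually (e.open_target.mem_nhds hu),
      self_mem_nhdsWithin] with t ht ht0
    rw [mem_iff_of_boundaryChart he ht, firstLine_zero, slicePt_zero]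
    simpa using ht0
  · rw [mem_iff_of_boundaryChart he hu, slicePt_zero]
    exact lt_irrefl _

theorem ProjDensity.contDiffAt {w : ℝ} (τ : ProjDensity n N w) (he : e ∈ charts n N)
    {y : Eu (n + 1)} (hy : y ∈ e.target) : ContDiffAt ℝ ∞ (τ.comp e) y :=
  contDiffAt_of_mem e.open_target (τ.smooth e he) hy

variable [IsManifold 𝓘(ℝ, Eu (n + 1)) ∞ N]
  {nabla : CovariantDerivative 𝓘(ℝ, Eu (n + 1)) (Eu (n + 1))
    (TangentSpace 𝓘(ℝ, Eu (n + 1)) : N → Type _)} {ρ : ProjDensity n N 2}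

/-- For even `n ≥ 2` the order `n / 2 + 1` is at least two, and for odd `n` every order is
available. Second order is all that the argument uses. -/
theorem IsFefferman.exists_order (hn : 2 ≤ n) (hρ : IsFefferman nabla Ω ρ) :
    ∃ k, 2 ≤ k ∧ IsBigORho Ω ρ k
      (fun e y => mongeAmpere (christoffel nabla e) (ρ.comp e) y + 1) := by
  rcases Nat.even_or_odd n with h | h
  · exact ⟨n / 2 + 1, by omega, hρ.2.2 h⟩
  · exact ⟨2, le_rfl, hρ.2.1 h 2⟩

/-- The assumptions on `Ω` and its Fefferman defining density, in a boundary chart. -/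
theorem localBoundary [T2Space N] (hn : 2 ≤ n)
    [CovariantDerivative.ContMDiffCovariantDerivative nabla ∞] (htorsion : nabla.torsion = 0)
    (hflat : IsLocallyFlat nabla) (hΩ : IsOpen Ω) (hρ : IsFefferman nabla Ω ρ)
    (hconv : IsStrictlyConvex nabla Ω ρ) (he : e ∈ boundaryCharts (n := n) Ω) :
    LocalBoundary e.target (christoffel nabla e) (ρ.comp e) := by
  have hr := fun z (hz : z ∈ e.target) => ρ.contDiffAt he.1 hz
  have hneg : ∀ z ∈ e.target, ρ.comp e z < 0 ↔ z 0 < 0 := fun z hz => by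
    rw [← mem_iff_of_boundaryChart he hz, hρ.1.1 e he.1 _ (e.map_target hz), e.right_inv hz]
  have hsl : ∀ v, slicePt v ∈ e.target → ρ.comp e (slicePt v) = 0 := by
    intro v hv
    refine le_antisymm ?_ ?_
    · refine le_of_tendsto (((hr _ hv).continuousAt.tendsto).comp
        (tendsto_firstLine (slicePt v))) ?_
      filter_upwards [(tendsto_firstLine (slicePt v)).eventually (e.open_target.mem_nhds hv),
        self_mem_nhdsWithin] with t ht ht0
      refine ((hneg _ ht).2 ?_).le
      rw [firstLine_zero, slicePt_zero]
      simpa using ht0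
    · by_contra h
      have := (hneg _ hv).1 (not_le.1 h)
      rw [slicePt_zero] at this
      exact lt_irrefl _ this
  obtain ⟨k, hk, hJ⟩ := hρ.exists_order hn
  have hJ' : ∀ v, slicePt v ∈ e.target →
      mongeAmpere (christoffel nabla e) (ρ.comp e) (slicePt v) = -1 ∧
      ∀ i, pd i (mongeAmpere (christoffel nabla e) (ρ.comp e)) (slicePt v) = 0 := by
    intro v hv
    obtain ⟨U, φ, hU, hvU, hUe, hφ, h⟩ := hJ e he v hv
    -- One factor `ρ` is split off. Since `k - 1 ≥ 1`, the cofactor also vanishes on the slice, and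
    -- so does the derivative of the product.
    have h' : ∀ z ∈ U, mongeAmpere (christoffel nabla e) (ρ.comp e) z =
        ρ.comp e z * (ρ.comp e z ^ (k - 1) * φ z) + -1 := by
      intro z hz
      have h1 := h z hz
      rw [show k = (k - 1) + 1 by omega, pow_succ] at h1
      linarith
    have hk1 : k - 1 ≠ 0 := by omega
    refine ⟨by rw [h' _ hvU, hsl v hv]; simp, fun i => ?_⟩
    have h1 := hr _ hv
    have h2 := contDiffAt_of_mem hU hφ hvU
    have h3 : ContDiffAt ℝ ∞ (fun z => ρ.comp e z ^ (k - 1) * φ z) (slicePt v) :=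
      (h1.pow _).mul h2
    rw [pd_congr hU hvU h', pd_add (h1.mul h3).diff (by fun_prop), pd_const,
      pd_mul h1.diff h3.diff, hsl v hv]
    simp [hk1]
  have hfr : ∀ v, slicePt v ∈ e.target → e.symm (slicePt v) ∈ frontier Ω := fun v hv =>
    symm_slicePt_mem_frontier hΩ he hv
  refine ⟨e.open_target, fun z hz => christoffel_symm nabla htorsion he.1 hz,
    fun z hz => contDiffAt_christoffel nabla he.1 hz, fun z hz => hflat e he.1 z hz, hr, hneg,
    fun v hv => ?_, fun v hv => ?_, fun v hv => (hJ' v hv).1, fun v hv => (hJ' v hv).2⟩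
  · have := hρ.1.2 e he.1 _ (e.map_target hv) (hfr v hv)
    rwa [e.right_inv hv] at this
  · have := hconv e he.1 _ (e.map_target hv) (hfr v hv)
    rwa [e.right_inv hv] at this

theorem mfderiv_eq_sum_pd (he : e ∈ charts n N) {Υ : N → ℝ}
    (hΥ : ContMDiff 𝓘(ℝ, Eu (n + 1)) 𝓘(ℝ, ℝ) ∞ Υ) {y : Eu (n + 1)} (hy : y ∈ e.target)
    (v : TangentSpace 𝓘(ℝ, Eu (n + 1)) (e.symm y)) :
    (mfderiv 𝓘(ℝ, Eu (n + 1)) 𝓘(ℝ, ℝ) Υ (e.symm y) v : ℝ) =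
      ∑ k, coordComp e (e.symm y) v k * pd k (fun z => Υ (e.symm z)) y := by
  have hx := e.map_target hy
  have h1 : mfderiv 𝓘(ℝ, Eu (n + 1)) 𝓘(ℝ, ℝ) (fun z => Υ (e.symm z)) y =
      (mfderiv 𝓘(ℝ, Eu (n + 1)) 𝓘(ℝ, ℝ) Υ (e.symm y)).comp
        (mfderiv 𝓘(ℝ, Eu (n + 1)) 𝓘(ℝ, Eu (n + 1)) e.symm y) :=
    mfderiv_comp y ((hΥ _).mdifferentiableAt (by simp))
      ((charts.contMDiffAt_symm he hy).mdifferentiableAt (by simp))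
  have h2 : ∀ k, (mfderiv 𝓘(ℝ, Eu (n + 1)) 𝓘(ℝ, ℝ) Υ (e.symm y) (coordField e k (e.symm y)) : ℝ) =
      pd k (fun z => Υ (e.symm z)) y := by
    intro k
    rw [pd, ← mfderiv_eq_fderiv]
    erw [h1]
    unfold coordField
    rw [e.right_inv hy]
    rfl
  have h3 : ∀ L : TangentSpace 𝓘(ℝ, Eu (n + 1)) (e.symm y) →L[ℝ] ℝ,
      L v = ∑ k, coordComp e (e.symm y) v k * L (coordField e k (e.symm y)) := by
    intro L
    conv_lhs => rw [eq_sum_coordComp he hx v]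
    simp only [map_sum, map_smul, smul_eq_mul]
  simp only [← h2]
  exact h3 _

variable (hL : ∀ e ∈ boundaryCharts (n := n) Ω,
  LocalBoundary e.target (christoffel nabla e) (ρ.comp e))

include hL

/-- On the slice the ambient Laplacian is a nonzero multiple of `sliceTrace`. Being `O(ρ)` forces it
to vanish there, and conversely a smooth function vanishing on the slice is divisible by `ρ`. -/
theorem isHarmonic_iff {τ : ProjDensity n N 1} :
    IsHarmonic nabla Ω ρ τ ↔ IsProjScale τ ∧ ∀ e ∈ boundaryCharts (n := n) Ω, ∀ u,
      slicePt u ∈ e.target → sliceTrace (christoffel nabla e) (τ.comp e) u = 0 := by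
  refine and_congr_right fun _ => ⟨fun h e he u hu => ?_, fun h e he u hu => ?_⟩
  · obtain ⟨U, φ, -, huU, -, -, hφ⟩ := h e he u hu
    exact (hL e he).sliceTrace_eq_zero_of_bigO hu (fun z hz => τ.contDiffAt he.1 hz)
      (hφ _ huU)
  · exact (hL e he).bigO_of_sliceTrace_eq_zero hu (fun z hz => τ.contDiffAt he.1 hz)
      (h e he)

/-- Flatness supplies the curvature with `Q = τ⁻¹ D D τ`, convexity makes the affine metric
nondegenerate, and the remaining conditions express the normalization of `ξ` and `∇τ = 0`. -/
theorem IsAffineNormal.blaschke {τ : ProjDensity n N 1} (hτ : IsProjScale τ)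
    {ξ : ∀ x : N, TangentSpace 𝓘(ℝ, Eu (n + 1)) x} (hξ : IsAffineNormal nabla Ω τ ξ)
    (he : e ∈ boundaryCharts (n := n) Ω) :
    BlaschkeHypersurface e.target (scaleSymbols (christoffel nabla e) (τ.comp e)) (alongM ξ e)
      (fun u b d => scaleHess (christoffel nabla e) (τ.comp e) (slicePt u) b.succ d.succ /
        τ.comp e (slicePt u)) (τ.comp e) := by
  have L := hL e he
  obtain ⟨h1, h2⟩ := hξ e he
  have hpos := hτ e he.1
  have hsm := fun z (hz : z ∈ e.target) => τ.contDiffAt he.1 hz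
  refine ⟨⟨L.isOpen, fun z hz => scaleSymbols_symm (L.symm z hz) _,
    fun z hz => contDiffAt_scaleSymbols (L.smooth z hz) (hsm z hz) (hpos z hz).ne',
    fun u hu k => contDiffAt_of_mem L.isOpen_slice (h1 k) hu, fun u hu => (h2 u hu).1.ne',
    fun u hu => (h2 u hu).2.2, fun u hu => ?_, fun u hu a b k d => ?_⟩,
    fun u hu => (h2 u hu).1, hpos, hsm, fun u hu a => ?_, fun u hu => (h2 u hu).2.1⟩
  · rw [affineMetric_eq_smul (fun u => sliceForm_scaleSymbols _ u), Matrix.det_smul]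
    exact mul_ne_zero (pow_ne_zero _ (inv_ne_zero (h2 u hu).1.ne')) (L.det_sliceForm_pos hu).ne'
  · exact curv_scaleSymbols L.isOpen hu (L.symm _ hu) (L.smooth _ hu) (L.weyl _ hu) hsm
      (fun z hz => (hpos z hz).ne') _ _ _ _
  · exact scaleSymbols_parallel _ _ _ (hpos _ hu).ne' _

theorem isHarmonic_iff_traceShape (hn : 2 ≤ n) {τ : ProjDensity n N 1} (hτ : IsProjScale τ)
    {ξ : ∀ x : N, TangentSpace 𝓘(ℝ, Eu (n + 1)) x} (hξ : IsAffineNormal nabla Ω τ ξ) :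
    IsHarmonic nabla Ω ρ τ ↔
      ∀ e ∈ boundaryCharts (n := n) Ω, ∀ u, slicePt u ∈ e.target →
        traceShape (tauSymbols nabla τ e) (alongM ξ e) u =
          (1 / ((n : ℝ) - 1)) * (scal (hMetric nabla τ ξ e) u -
            fubiniPickSq (tauSymbols nabla τ e) (alongM ξ e) u) := by
  rw [isHarmonic_iff hL, and_iff_right hτ]
  refine forall₂_congr fun e he => forall₂_congr fun u hu => ?_
  have H := hξ.blaschke hL hτ he
  have h0 := H.xi_pos u hu
  have ht := H.tau_pos _ hu
  have h := H.traceShape_iff hu hn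
  rw [sum_inv_affineMetric h0.ne'] at h
  refine Iff.trans ?_ h.symm
  simp [h0.ne', ht.ne']

theorem isHarmonic_rescale_iff (hn : 2 ≤ n) {τ : ProjDensity n N 1}
    (hτ : IsHarmonic nabla Ω ρ τ)
    {ξ : ∀ x : N, TangentSpace 𝓘(ℝ, Eu (n + 1)) x} (hξ : IsAffineNormal nabla Ω τ ξ)
    (Υ : N → ℝ) (hΥ : ContMDiff 𝓘(ℝ, Eu (n + 1)) 𝓘(ℝ, ℝ) ∞ Υ) :
    IsHarmonic nabla Ω ρ (rescale τ Υ hΥ) ↔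
      ∀ e ∈ boundaryCharts (n := n) Ω, ∀ u, slicePt u ∈ e.target →
        (mfderiv 𝓘(ℝ, Eu (n + 1)) 𝓘(ℝ, ℝ) Υ (e.symm (slicePt u)) (ξ (e.symm (slicePt u))) : ℝ) =
          (1 / (n : ℝ)) *
            (laplacian (hMetric nabla τ ξ e) (fun v => Υ (e.symm (slicePt v))) u +
              gradSq (hMetric nabla τ ξ e) (fun v => Υ (e.symm (slicePt v))) u) := by
  have h' := (isHarmonic_iff hL).1 hτ
  have hpos : IsProjScale (rescale τ Υ hΥ) := fun e he y hy =>
    mul_pos (Real.exp_pos _) (h'.1 e he y hy)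
  rw [isHarmonic_iff hL, and_iff_right hpos]
  refine forall₂_congr fun e he => forall₂_congr fun u hu => ?_
  have H := hξ.blaschke hL h'.1 he
  have h0 := H.xi_pos u hu
  have ht := H.tau_pos _ hu
  have hυ : ∀ z ∈ e.target, ContDiffAt ℝ ∞ (fun z => Υ (e.symm z)) z := fun z hz => by
    rw [← contMDiffAt_iff_contDiffAt]
    exact (hΥ _).comp z (charts.contMDiffAt_symm he.1 hz)
  have h := H.sliceTrace_rescale hu hυ
  -- Harmonicity of `τ` removes the zeroth order term, so the condition on the rescaled density
  -- involves only derivatives of `Υ`.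
  rw [h'.2 e he u hu, mul_zero, zero_add] at h
  rw [mfderiv_eq_sum_pd he.1 hΥ hu]
  have hn0 : (n : ℝ) ≠ 0 := by positivity
  have hc : alongM ξ e u 0 / (Real.exp (-Υ (e.symm (slicePt u))) * τ.comp e (slicePt u)) ≠ 0 :=
    (div_pos h0 (mul_pos (Real.exp_pos _) ht)).ne'
  change sliceTrace (christoffel nabla e)
    (fun z => Real.exp (-Υ (e.symm z)) * τ.comp e z) u = 0 ↔
    ∑ k, alongM ξ e u k * pd k (fun z => Υ (e.symm z)) (slicePt u) = _
  rw [← mul_eq_zero_iff_left hc, h, one_div, eq_inv_mul_iff_mul_eq₀ hn0, sub_eq_zero, eq_comm]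
  rfl

end GlobalBoundary

/-! ### Powers in the normalization of the affine normal field. -/

section ScaleAlgebra

/-- The normalization of the affine normal field, solved for its transversal component. -/
theorem normalization_iff {n : ℕ} {t x D : ℝ} (ht : 0 < t) (hx : 0 < x) (hD : 0 < D) :
    t ^ (-((n : ℝ) + 2)) * x = Real.sqrt ((x⁻¹) ^ n * D) ↔
      x = D ^ (1 / ((n : ℝ) + 2)) * t ^ 2 := by
  have hn : (n : ℝ) + 2 ≠ 0 := by positivity
  have h1 : 0 < t ^ (-((n : ℝ) + 2)) := Real.rpow_pos_of_pos ht _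
  have h2 : 0 < (x⁻¹) ^ n * D := by positivity
  have h3 : 0 < D ^ (1 / ((n : ℝ) + 2)) := Real.rpow_pos_of_pos hD _
  rw [← Real.log_injOn_pos.eq_iff (Set.mem_Ioi.2 (mul_pos h1 hx))
    (Set.mem_Ioi.2 (Real.sqrt_pos.2 h2)),
    ← Real.log_injOn_pos.eq_iff (Set.mem_Ioi.2 hx) (Set.mem_Ioi.2 (mul_pos h3 (by positivity))),
    Real.log_mul h1.ne' hx.ne', Real.log_sqrt h2.le, Real.log_mul (by positivity) hD.ne',
    Real.log_mul h3.ne' (by positivity), Real.log_rpow ht, Real.log_rpow hD, Real.log_pow,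
    Real.log_pow, Real.log_inv]
  constructor <;> intro h
  · field_simp; push_cast; linarith
  · rw [h]; field_simp; push_cast; ring

/-- The conformal scale `(vol_h)^{-1/n}` is `τ|_M` times a power of `det B` alone. This is the
origin of the exponent `1 / (n (n + 2))` in `boundaryValue`. -/
theorem rpow_sqrt_normalization {n : ℕ} (hn : 0 < n) {t x D : ℝ} (ht : 0 < t) (hx : 0 < x)
    (hD : 0 < D) (h : x = D ^ (1 / ((n : ℝ) + 2)) * t ^ 2) :
    Real.sqrt ((x⁻¹) ^ n * D) ^ (-1 / (n : ℝ)) = t * (D ^ (1 / ((n : ℝ) * (n + 2))))⁻¹ := by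
  rw [← (normalization_iff ht hx hD).2 h]
  have hn' : (n : ℝ) + 2 ≠ 0 := by positivity
  have hn0 : (n : ℝ) ≠ 0 := by positivity
  have h1 : 0 < t ^ (-((n : ℝ) + 2)) := Real.rpow_pos_of_pos ht _
  have h3 : 0 < D ^ (1 / ((n : ℝ) + 2)) := Real.rpow_pos_of_pos hD _
  have h4 : 0 < D ^ (1 / ((n : ℝ) * (n + 2))) := Real.rpow_pos_of_pos hD _
  have h5 : 0 < t ^ (-((n : ℝ) + 2)) * x := mul_pos h1 hx
  refine Real.log_injOn_pos (Set.mem_Ioi.2 (Real.rpow_pos_of_pos h5 _))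
    (Set.mem_Ioi.2 (by positivity)) ?_
  rw [Real.log_rpow h5, Real.log_mul h1.ne' hx.ne', Real.log_mul ht.ne' (by positivity),
    Real.log_inv, Real.log_rpow hD, Real.log_rpow ht, h, Real.log_mul h3.ne' (by positivity),
    Real.log_rpow hD, Real.log_pow]
  field_simp
  push_cast
  ring

end ScaleAlgebra

/-! ### Splitting off the normal derivative. -/

section SliceOp

variable {n : ℕ} {Γ : Symbols (n + 1)}

/-- The tangential part of the operator `sliceTrace`. -/
def sliceOp (Γ : Symbols (n + 1)) (s : Eu n → ℝ) (u : Eu n) : ℝ :=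
  ∑ a, ∑ b, (sliceForm Γ u)⁻¹ a b * (pd a (pd b s) u
    - ∑ c, coordSymbols Γ (slicePt u) a.succ b.succ c.succ * pd c s u
    + projSchouten (coordSymbols Γ) (slicePt u) a.succ b.succ * s u)

/-- The transversal derivative enters the tangential Hessian only through `-Γ_ab^0 ∂_0 τ = B_ab ∂_0
τ`, whose `B`-trace is `n ∂_0 τ`. Everything else depends on the boundary value `s`. -/
theorem sliceTrace_eq {V : Set (Eu (n + 1))} (hV : IsOpen V) {τ : Eu (n + 1) → ℝ}
    (hτ : ∀ z ∈ V, ContDiffAt ℝ ∞ τ z) {u : Eu n} (hu : slicePt u ∈ V)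
    (hsymm : ∀ i j k, Γ (slicePt u) i j k = Γ (slicePt u) j i k)
    (hdet : (sliceForm Γ u).det ≠ 0) {s : Eu n → ℝ} (hs : ∀ v, slicePt v ∈ V → τ (slicePt v) = s v) :
    sliceTrace Γ τ u = n * pd 0 τ (slicePt u) + sliceOp Γ s u := by
  have hVs : IsOpen {v : Eu n | slicePt v ∈ V} :=
    hV.preimage (contDiff_slicePt (_k := 0)).continuous
  have h1 : ∀ a : Fin n, ∀ v ∈ {v : Eu n | slicePt v ∈ V}, pd a s v = pd a.succ τ (slicePt v) :=
    fun a v hv => by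
      rw [← pd_slice (hτ _ hv).diff, pd_congr hVs hv fun w hw => hs w hw]
  have h2 : ∀ a b : Fin n, pd a (pd b s) u = pd a.succ (pd b.succ τ) (slicePt u) := fun a b => by
    rw [← pd_slice (f := pd b.succ τ) (contDiffAt_pd b.succ (hτ _ hu)).diff,
      pd_congr hVs hu fun w hw => h1 b w hw]
  have hB : ∀ a b : Fin n, coordSymbols Γ (slicePt u) a.succ b.succ 0 = -sliceForm Γ u b a :=
    fun a b => by
      have h := congrFun (congrFun (sliceForm_scaleSymbols (Γ := Γ) (fun _ => 1) u) b) a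
      rw [← h]
      simp only [sliceForm, Matrix.of_apply, neg_neg]
      exact coordSymbols_symm hsymm _ _ _
  have h3 : ∀ a b : Fin n, scaleHess Γ τ (slicePt u) a.succ b.succ =
      sliceForm Γ u b a * pd 0 τ (slicePt u) + (pd a (pd b s) u
        - ∑ c, coordSymbols Γ (slicePt u) a.succ b.succ c.succ * pd c s u
        + projSchouten (coordSymbols Γ) (slicePt u) a.succ b.succ * s u) := by
    intro a b
    rw [scaleHess, hess, Fin.sum_univ_succ, hB, hs u hu, h2]
    simp only [h1 _ u hu]
    ring
  simp only [sliceTrace, sliceOp, h3, mul_add, Finset.sum_add_distrib]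
  congr 1
  have h4 : ∑ a, ∑ b, (sliceForm Γ u)⁻¹ a b * sliceForm Γ u b a = n := by
    have h := congrArg Matrix.trace (Matrix.nonsing_inv_mul (sliceForm Γ u) hdet.isUnit)
    rw [Matrix.trace_one, Fintype.card_fin] at h
    rw [← h]
    rfl
  rw [← h4]
  simp only [Finset.sum_mul]
  exact Finset.sum_congr rfl fun _ _ => Finset.sum_congr rfl fun _ _ => by ring

end SliceOp

/-! ### Boundary values and uniqueness in part (i). -/

section Uniqueness

variable {n : ℕ} {N : Type*} [TopologicalSpace N] [ChartedSpace (Eu (n + 1)) N]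
  {e : OpenPartialHomeomorph N (Eu (n + 1))} {Ω : Set N}
  [IsManifold 𝓘(ℝ, Eu (n + 1)) ∞ N]
  {nabla : CovariantDerivative 𝓘(ℝ, Eu (n + 1)) (Eu (n + 1))
    (TangentSpace 𝓘(ℝ, Eu (n + 1)) : N → Type _)} {ρ : ProjDensity n N 2}

/-- The restriction to the slice of the component of a scale with boundary value `κ`. -/
def boundaryValue (nabla : CovariantDerivative 𝓘(ℝ, Eu (n + 1)) (Eu (n + 1))
    (TangentSpace 𝓘(ℝ, Eu (n + 1)) : N → Type _)) (κ : ConfDensity (n := n) Ω 1)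
    (e : OpenPartialHomeomorph N (Eu (n + 1))) (u : Eu n) : ℝ :=
  κ.comp e u * (sliceForm (christoffel nabla e) u).det ^ (1 / ((n : ℝ) * (n + 2)))

theorem det_affineMetric_tauSymbols (τ : ProjDensity n N 1) (e : OpenPartialHomeomorph N (Eu (n + 1)))
    (ξ : Eu n → Fin (n + 1) → ℝ) (u : Eu n) :
    (affineMetric (tauSymbols nabla τ e) ξ u).det =
      ((ξ u 0)⁻¹) ^ n * (sliceForm (christoffel nabla e) u).det := by
  rw [tauSymbols, affineMetric_eq_smul (fun u => sliceForm_scaleSymbols _ u), Matrix.det_smul,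
    Fintype.card_fin]

variable (hL : ∀ e ∈ boundaryCharts (n := n) Ω,
  LocalBoundary e.target (christoffel nabla e) (ρ.comp e))

include hL

theorem IsAffineNormal.xi_zero {τ : ProjDensity n N 1} (hτ : IsProjScale τ)
    {ξ : ∀ x : N, TangentSpace 𝓘(ℝ, Eu (n + 1)) x} (hξ : IsAffineNormal nabla Ω τ ξ)
    (he : e ∈ boundaryCharts (n := n) Ω) {u : Eu n} (hu : slicePt u ∈ e.target) :
    alongM ξ e u 0 = (sliceForm (christoffel nabla e) u).det ^ (1 / ((n : ℝ) + 2)) *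
      τ.comp e (slicePt u) ^ 2 := by
  obtain ⟨h1, h2, -⟩ := (hξ e he).2 u hu
  rw [det_affineMetric_tauSymbols] at h2
  exact (normalization_iff (hτ e he.1 _ hu) h1 ((hL e he).det_sliceForm_pos hu)).1 h2

theorem RestrictsTo.comp_slicePt (hn : 2 ≤ n) {τ : ProjDensity n N 1} (hτ : IsProjScale τ)
    {κ : ConfDensity (n := n) Ω 1} (h : RestrictsTo nabla Ω τ κ)
    (he : e ∈ boundaryCharts (n := n) Ω) {u : Eu n} (hu : slicePt u ∈ e.target) :
    τ.comp e (slicePt u) = boundaryValue nabla κ e u := by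
  obtain ⟨ξ, hξ, hκ⟩ := h
  have hD := (hL e he).det_sliceForm_pos hu
  rw [boundaryValue, hκ e he u hu, hMetric, det_affineMetric_tauSymbols,
    rpow_sqrt_normalization (by omega) (hτ e he.1 _ hu) ((hξ e he).2 u hu).1 hD
      (hξ.xi_zero hL hτ he hu), inv_mul_cancel_right₀ (Real.rpow_pos_of_pos hD _).ne']

/-- Both scales have the same boundary value, so the same tangential part of `sliceTrace`. As both
traces vanish and `n ≠ 0`, the normal derivatives agree as well. -/
theorem harmonic_unique (hn : 2 ≤ n) {κ : ConfDensity (n := n) Ω 1} {τ τ' : ProjDensity n N 1}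
    (hτ : IsHarmonic nabla Ω ρ τ) (hτκ : RestrictsTo nabla Ω τ κ)
    (hτ' : IsHarmonic nabla Ω ρ τ') (hτκ' : RestrictsTo nabla Ω τ' κ) :
    IsBigORho Ω ρ 2 (fun e y => τ.comp e y - τ'.comp e y) := by
  intro e he u hu
  have L := hL e he
  have h1 := (isHarmonic_iff hL).1 hτ
  have h2 := (isHarmonic_iff hL).1 hτ'
  have hs := fun z (hz : z ∈ e.target) => τ.contDiffAt he.1 hz
  have hs' := fun z (hz : z ∈ e.target) => τ'.contDiffAt he.1 hz
  refine L.exists_eq_r_sq_mul hu L.isOpen le_rfl ((τ.smooth e he.1).sub (τ'.smooth e he.1)) hu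
    (fun v hv => ?_) fun v hv => ?_
  · beta_reduce
    rw [hτκ.comp_slicePt hL hn h1.1 he hv, hτκ'.comp_slicePt hL hn h2.1 he hv, sub_self]
  · have hdet := (L.det_sliceForm_pos hv).ne'
    have e1 := sliceTrace_eq L.isOpen hs hv (L.symm _ hv) hdet
      fun w hw => hτκ.comp_slicePt hL hn h1.1 he hw
    have e2 := sliceTrace_eq L.isOpen hs' hv (L.symm _ hv) hdet
      fun w hw => hτκ'.comp_slicePt hL hn h2.1 he hw
    rw [h1.2 e he v hv] at e1
    rw [h2.2 e he v hv] at e2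
    have hn0 : (n : ℝ) ≠ 0 := by positivity
    rw [pd_sub (hs _ hv).diff (hs' _ hv).diff]
    have : (n : ℝ) * (pd 0 (τ.comp e) (slicePt v) - pd 0 (τ'.comp e) (slicePt v)) = 0 := by linarith
    simpa [hn0] using this

end Uniqueness

/-! ### Existence of boundary charts. -/

section Straighten

variable {n : ℕ}

/-- The function `r` together with all coordinates but the `i`-th. -/
def straighten (r : Eu (n + 1) → ℝ) (i : Fin (n + 1)) (y : Eu (n + 1)) : Eu (n + 1) :=
  WithLp.toLp 2 (Fin.cons (r y) fun a => y (i.succAbove a))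

theorem contDiffAt_straighten {r : Eu (n + 1) → ℝ} {i : Fin (n + 1)} {y : Eu (n + 1)}
    (hr : ContDiffAt ℝ ∞ r y) : ContDiffAt ℝ ∞ (straighten r i) y := by
  rw [contDiffAt_euclidean]
  intro k
  refine Fin.cases ?_ (fun a => ?_) k
  · exact hr
  · exact (EuclideanSpace.proj (i.succAbove a) : Eu (n + 1) →L[ℝ] ℝ).contDiff.contDiffAt

theorem exists_equiv_straighten {r : Eu (n + 1) → ℝ} {i : Fin (n + 1)} {y : Eu (n + 1)}
    (hr : ContDiffAt ℝ ∞ r y) (hi : pd i r y ≠ 0) :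
    ∃ A : Eu (n + 1) ≃L[ℝ] Eu (n + 1),
      HasFDerivAt (straighten r i) (A : Eu (n + 1) →L[ℝ] Eu (n + 1)) y := by
  have hd := (contDiffAt_straighten (i := i) hr).diff.hasFDerivAt
  set T := fderiv ℝ (straighten r i) y with hT
  have hcomp : ∀ k v, T v k = fderiv ℝ (fun z => straighten r i z k) y v := by
    intro k v
    have h2 := ((EuclideanSpace.proj (𝕜 := ℝ) k).hasFDerivAt.comp y hd).fderiv
    erw [h2]
    rfl
  have h0 : ∀ v, T v 0 = fderiv ℝ r y v := fun v => hcomp 0 v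
  have ha : ∀ a v, T v (Fin.succ a) = v (i.succAbove a) := by
    intro a v
    rw [hcomp]
    have : (fun z => straighten r i z (Fin.succ a)) =
      (EuclideanSpace.proj (i.succAbove a) : Eu (n + 1) →L[ℝ] ℝ) := by
      funext z; rfl
    rw [this, ContinuousLinearMap.fderiv]
    rfl
  -- A kernel vector has all coordinates zero except the `i`-th, and that one is multiplied by `∂_i
  -- r ≠ 0`.
  have hinj : Function.Injective T := by
    rw [injective_iff_map_eq_zero]
    intro v hv
    have hv1 : ∀ a, v (i.succAbove a) = 0 := fun a => by rw [← ha, hv]; rfl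
    have hv0 : fderiv ℝ r y v = 0 := by rw [← h0, hv]; rfl
    rw [fderiv_eq_sum_pd, Fin.sum_univ_succAbove _ i] at hv0
    simp only [hv1, zero_mul, Finset.sum_const_zero, add_zero, mul_eq_zero, hi, or_false] at hv0
    ext k
    rcases Fin.eq_self_or_eq_succAbove i k with rfl | ⟨a, rfl⟩
    · exact hv0
    · exact hv1 a
  let A : Eu (n + 1) ≃L[ℝ] Eu (n + 1) := (LinearEquiv.ofInjectiveEndo
    (T : Eu (n + 1) →ₗ[ℝ] Eu (n + 1)) hinj).toContinuousLinearEquiv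
  have hA : (A : Eu (n + 1) →L[ℝ] Eu (n + 1)) = T := by ext v; rfl
  exact ⟨A, hA ▸ hd⟩

/-- Near a point where `∂_i r ≠ 0`, the function `r` is the first coordinate of a chart. -/
theorem exists_straightening {V : Set (Eu (n + 1))} (hV : IsOpen V) {r : Eu (n + 1) → ℝ}
    (hr : ContDiffOn ℝ ∞ r V) {y : Eu (n + 1)} (hy : y ∈ V) (hd : fderiv ℝ r y ≠ 0) :
    ∃ Φ : OpenPartialHomeomorph (Eu (n + 1)) (Eu (n + 1)), y ∈ Φ.source ∧ Φ.source ⊆ V ∧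
      (∀ z, Φ z 0 = r z) ∧ Φ ∈ contDiffGroupoid ∞ 𝓘(ℝ, Eu (n + 1)) := by
  obtain ⟨i, hi⟩ : ∃ i, pd i r y ≠ 0 := by
    by_contra! h
    refine hd ?_
    ext v
    simp [fderiv_eq_sum_pd, h]
  have hrs : ∀ z ∈ V, ContDiffAt ℝ ∞ r z := fun z hz => contDiffAt_of_mem hV hr hz
  -- Restricting to `∂_i r ≠ 0` makes the differential invertible at every point of the domain, so
  -- the inverse is smooth on the whole target.
  have hW : IsOpen (V ∩ pd i r ⁻¹' {0}ᶜ) := ContinuousOn.isOpen_inter_preimage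
    (fun z hz => (contDiffAt_pd i (hrs z hz)).continuousAt.continuousWithinAt) hV
    isOpen_compl_singleton
  obtain ⟨A, hA⟩ := exists_equiv_straighten (hrs y hy) hi
  set Φ₀ := (contDiffAt_straighten (i := i) (hrs y hy)).toOpenPartialHomeomorph _ hA (by simp)
    with hΦ₀
  have hcoe : ∀ z, Φ₀ z = straighten r i z := fun z => rfl
  refine ⟨Φ₀.restrOpen _ hW, ?_, ?_, fun z => rfl, ?_⟩
  · exact ⟨ContDiffAt.mem_toOpenPartialHomeomorph_source _ hA _, hy, hi⟩
  · exact fun z hz => hz.2.1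
  · have h1 : ContDiffOn ℝ ∞ (Φ₀.restrOpen _ hW) (Φ₀.restrOpen _ hW).source := fun z hz =>
      (contDiffAt_straighten (hrs z hz.2.1)).contDiffWithinAt
    have h2 : ContDiffOn ℝ ∞ (Φ₀.restrOpen _ hW).symm (Φ₀.restrOpen _ hW).target := by
      intro z hz
      have hz' := (Φ₀.restrOpen _ hW).map_target hz
      obtain ⟨A', hA'⟩ := exists_equiv_straighten (hrs _ hz'.2.1) hz'.2.2
      exact ((Φ₀.restrOpen _ hW).contDiffAt_symm hz hA'
        (contDiffAt_straighten (hrs _ hz'.2.1))).contDiffWithinAt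
    rw [contDiffGroupoid, mem_groupoid_of_pregroupoid]
    constructor
    · simpa [contDiffPregroupoid] using h1
    · simpa [contDiffPregroupoid] using h2

variable {N : Type*} [TopologicalSpace N] [ChartedSpace (Eu (n + 1)) N]
  [IsManifold 𝓘(ℝ, Eu (n + 1)) ∞ N] {Ω : Set N}

theorem trans_mem_charts {e : OpenPartialHomeomorph N (Eu (n + 1))}
    (he : e ∈ charts n N) {Φ : OpenPartialHomeomorph (Eu (n + 1)) (Eu (n + 1))}
    (hΦ : Φ ∈ contDiffGroupoid ∞ 𝓘(ℝ, Eu (n + 1))) : e.trans Φ ∈ charts n N := by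
  rw [charts, IsManifold.maximalAtlas, mem_maximalAtlas_iff]
  intro e' he'
  have he'' := (contDiffGroupoid ∞ 𝓘(ℝ, Eu (n + 1))).subset_maximalAtlas he'
  constructor
  · rw [OpenPartialHomeomorph.trans_symm_eq_symm_trans_symm, OpenPartialHomeomorph.trans_assoc]
    exact StructureGroupoid.trans _ (StructureGroupoid.symm _ hΦ)
      (StructureGroupoid.compatible_of_mem_maximalAtlas he he'')
  · rw [← OpenPartialHomeomorph.trans_assoc]
    exact StructureGroupoid.trans _ (StructureGroupoid.compatible_of_mem_maximalAtlas he'' he) hΦ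

theorem comp_eq_zero_of_mem_frontier (hΩ : IsOpen Ω) {ρ : ProjDensity n N 2}
    (hρ : IsDefiningDensity Ω ρ) {e : OpenPartialHomeomorph N (Eu (n + 1))} (he : e ∈ charts n N)
    {x : N} (hx : x ∈ e.source) (hxΩ : x ∈ frontier Ω) : ρ.comp e (e x) = 0 := by
  rw [hΩ.frontier_eq] at hxΩ
  refine le_antisymm ?_ (not_lt.1 fun h => hxΩ.2 ((hρ.1 e he x hx).2 h))
  have hc : ContinuousAt (fun z => ρ.comp e (e z)) x :=
    ContinuousAt.comp (ρ.contDiffAt he (e.map_source hx)).continuousAt (e.continuousAt hx)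
  have hf := (mem_closure_iff_frequently.1 hxΩ.1).and_eventually (e.open_source.mem_nhds hx)
  exact le_of_tendsto_of_frequently hc (hf.mono fun z hz => ((hρ.1 e he z hz.2).1 hz.1).le)

/-- Every boundary point lies in a boundary chart. -/
theorem exists_boundaryChart (hΩ : IsOpen Ω) {ρ : ProjDensity n N 2}
    (hρ : IsDefiningDensity Ω ρ) {x : N} (hxΩ : x ∈ frontier Ω) :
    ∃ e ∈ boundaryCharts (n := n) Ω, ∃ u, x ∈ e.source ∧ e x = slicePt u := by
  set e₀ := chartAt (Eu (n + 1)) x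
  have he₀ : e₀ ∈ charts n N := IsManifold.chart_mem_maximalAtlas x
  have hx : x ∈ e₀.source := mem_chart_source _ x
  obtain ⟨Φ, hΦx, hΦV, hΦr, hΦ⟩ := exists_straightening e₀.open_target (ρ.smooth e₀ he₀)
    (e₀.map_source hx) (hρ.2 e₀ he₀ x hx hxΩ)
  refine ⟨e₀.trans Φ, ⟨trans_mem_charts he₀ hΦ, fun z hz => ?_⟩, sliceProj (Φ (e₀ x)), ?_, ?_⟩
  · rw [OpenPartialHomeomorph.trans_source] at hz
    rw [hρ.1 e₀ he₀ z hz.1, ← hΦr]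
    rfl
  · rw [OpenPartialHomeomorph.trans_source]
    exact ⟨hx, hΦx⟩
  · symm
    apply slicePt_sliceProj
    rw [hΦr]
    exact comp_eq_zero_of_mem_frontier hΩ hρ he₀ hx hxΩ

end Straighten

/-! ### Gauge transformations of matrix valued connections. -/

section MatrixDerivative

variable {d m : ℕ}

/-- The entrywise partial derivative of a matrix valued function. -/
def pdM (i : Fin d) (M : Eu d → Matrix (Fin m) (Fin m) ℝ) (y : Eu d) : Matrix (Fin m) (Fin m) ℝ :=
  Matrix.of fun k p => pd i (fun z => M z k p) y

variable {M M' : Eu d → Matrix (Fin m) (Fin m) ℝ} {y : Eu d}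

theorem pdM_mul (i : Fin d) (hM : ∀ k p, ContDiffAt ℝ ∞ (fun z => M z k p) y)
    (hM' : ∀ k p, ContDiffAt ℝ ∞ (fun z => M' z k p) y) :
    pdM i (fun z => M z * M' z) y = pdM i M y * M' y + M y * pdM i M' y := by
  ext k p
  simp only [pdM, Matrix.of_apply, Matrix.mul_apply, Matrix.add_apply]
  rw [pd_sum fun a _ => ((hM k a).mul (hM' a p)).diff, ← Finset.sum_add_distrib]
  refine Finset.sum_congr rfl fun a _ => ?_
  rw [pd_mul (hM k a).diff (hM' a p).diff]

theorem pdM_add (i : Fin d) (hM : ∀ k p, ContDiffAt ℝ ∞ (fun z => M z k p) y)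
    (hM' : ∀ k p, ContDiffAt ℝ ∞ (fun z => M' z k p) y) :
    pdM i (fun z => M z + M' z) y = pdM i M y + pdM i M' y := by
  ext k p
  simp only [pdM, Matrix.of_apply, Matrix.add_apply]
  rw [pd_add (hM k p).diff (hM' k p).diff]

theorem pdM_congr {V : Set (Eu d)} (hV : IsOpen V) (hy : y ∈ V) (h : ∀ z ∈ V, M z = M' z)
    (i : Fin d) : pdM i M y = pdM i M' y := by
  ext k p
  exact pd_congr hV hy fun z hz => by rw [h z hz]

theorem pdM_comm (i j : Fin d) (hM : ∀ k p, ContDiffAt ℝ ∞ (fun z => M z k p) y) :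
    pdM i (fun z => pdM j M z) y = pdM j (fun z => pdM i M z) y := by
  ext k p
  exact pd_comm (hM k p) i j

theorem contDiffAt_pdM (i : Fin d) (hM : ∀ k p, ContDiffAt ℝ ∞ (fun z => M z k p) y) (k p : Fin m) :
    ContDiffAt ℝ ∞ (fun z => pdM i M z k p) y := contDiffAt_pd i (hM k p)

/-- Gauge transformations conjugate the curvature. -/
theorem gauge_curvature {V : Set (Eu d)} (hV : IsOpen V) (hy : y ∈ V)
    {J : Eu d → Matrix (Fin m) (Fin m) ℝ} {G A : Fin d → Eu d → Matrix (Fin m) (Fin m) ℝ}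
    (hJ : ∀ k p, ContDiffAt ℝ ∞ (fun z => J z k p) y)
    (hG : ∀ i k p, ContDiffAt ℝ ∞ (fun z => G i z k p) y)
    (hA : ∀ i k p, ContDiffAt ℝ ∞ (fun z => A i z k p) y)
    (h : ∀ z ∈ V, ∀ i, J z * G i z = pdM i J z + A i z * J z) (i j : Fin d) :
    J y * (pdM i (G j) y - pdM j (G i) y + G i y * G j y - G j y * G i y) =
      (pdM i (A j) y - pdM j (A i) y + A i y * A j y - A j y * A i y) * J y := by
  have hmul : ∀ {M M' : Eu d → Matrix (Fin m) (Fin m) ℝ},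
      (∀ k p, ContDiffAt ℝ ∞ (fun z => M z k p) y) → (∀ k p, ContDiffAt ℝ ∞ (fun z => M' z k p) y) →
      ∀ k p, ContDiffAt ℝ ∞ (fun z => (M z * M' z) k p) y := fun h1 h2 k p => by
    simp only [Matrix.mul_apply]
    exact ContDiffAt.sum fun a _ => (h1 k a).mul (h2 a p)
  have hd : ∀ i j, pdM i J y * G j y + J y * pdM i (G j) y =
      pdM i (fun z => pdM j J z) y + (pdM i (A j) y * J y + A j y * pdM i J y) := fun i j => by
    rw [← pdM_mul i hJ (hG j), ← pdM_mul i (hA j) hJ,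
      ← pdM_add i (contDiffAt_pdM j hJ) (hmul (hA j) hJ)]
    exact pdM_congr hV hy (fun z hz => h z hz j) i
  have e1 := hd i j
  have e2 := hd j i
  rw [pdM_comm j i hJ] at e2
  -- Substituting for the first derivatives of `J` and subtracting the two differentiated gauge
  -- laws, the mixed second derivatives of `J` cancel.
  have e3 : ∀ i, pdM i J y = J y * G i y - A i y * J y := fun i => by rw [h y hy i]; abel
  rw [e3 i] at e1
  rw [e3 j] at e2
  have e4 : J y * (pdM i (G j) y - pdM j (G i) y + G i y * G j y - G j y * G i y) -
      (pdM i (A j) y - pdM j (A i) y + A i y * A j y - A j y * A i y) * J y =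
      (((J y * G i y - A i y * J y) * G j y + J y * pdM i (G j) y) -
        (pdM i (A j) y * J y + A j y * (J y * G i y - A i y * J y))) -
      (((J y * G j y - A j y * J y) * G i y + J y * pdM j (G i) y) -
        (pdM j (A i) y * J y + A i y * (J y * G j y - A j y * J y))) := by noncomm_ring
  rw [← sub_eq_zero, e4, e1, e2]
  abel

end MatrixDerivative

/-! ### Naturality of curvature and of scale connections. -/

section Pullback

variable {d : ℕ} {Γ Γ' : Symbols d} {φ : Eu d → Eu d} {y : Eu d}

/-- The Jacobian matrix. -/
def jac {d : ℕ} (φ : Eu d → Eu d) (z : Eu d) : Matrix (Fin d) (Fin d) ℝ :=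
  Matrix.of fun k p => pd p (fun w => φ w k) z

theorem det_fderiv_eq (hφ : DifferentiableAt ℝ φ y) : (fderiv ℝ φ y).det = (jac φ y).det := by
  have h := LinearMap.det_toMatrix (EuclideanSpace.basisFun (Fin d) ℝ).toBasis
    (fderiv ℝ φ y : Eu d →ₗ[ℝ] Eu d)
  rw [ContinuousLinearMap.det, ← h]
  congr 1
  ext k p
  rw [LinearMap.toMatrix_apply]
  have h2 := ((EuclideanSpace.proj (𝕜 := ℝ) k).hasFDerivAt.comp y hφ.hasFDerivAt).fderiv
  simp only [jac, Matrix.of_apply, pd]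
  erw [h2]
  simp

/-- `Γ'` is the pullback of the connection `Γ` by `φ`, at the point `y`. -/
def IsPullback (Γ Γ' : Symbols d) (φ : Eu d → Eu d) (y : Eu d) : Prop :=
  ∀ i j k, ∑ p, Γ' y i j p * pd p (fun z => φ z k) y =
    pd i (pd j (fun z => φ z k)) y + ∑ l, ∑ m, Γ (φ y) l m k *
      pd i (fun z => φ z l) y * pd j (fun z => φ z m) y

/-- The connection matrix `Γ_i`. -/
def connMatrix (Γ : Symbols d) (i : Fin d) (z : Eu d) : Matrix (Fin d) (Fin d) ℝ :=
  Matrix.of fun k j => Γ z i j k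

/-- The connection matrix of the pulled back bundle. -/
def pullMatrix (Γ : Symbols d) (φ : Eu d → Eu d) (i : Fin d) (z : Eu d) :
    Matrix (Fin d) (Fin d) ℝ :=
  Matrix.of fun k m => ∑ l, Γ (φ z) l m k * jac φ z l i

/-- The transformation law of the symbols is a gauge law with the Jacobian as gauge transformation,
relating `Γ'` to the connection of the pulled back bundle. -/
theorem IsPullback.matrix (h : IsPullback Γ Γ' φ y) (i : Fin d) :
    jac φ y * connMatrix Γ' i y = pdM i (jac φ) y + pullMatrix Γ φ i y * jac φ y := by
  ext k j
  have h1 := h i j k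
  simp only [Matrix.mul_apply, Matrix.add_apply, jac, connMatrix, pullMatrix, pdM,
    Matrix.of_apply, Finset.sum_mul]
  rw [Finset.sum_comm (f := fun m l => Γ (φ y) l m k * _ * _), ← h1]
  exact Finset.sum_congr rfl fun p _ => mul_comm _ _

theorem curv_eq_connMatrix (i j k l : Fin d) :
    curv Γ y i j k l = (pdM i (connMatrix Γ j) y - pdM j (connMatrix Γ i) y +
      connMatrix Γ i y * connMatrix Γ j y - connMatrix Γ j y * connMatrix Γ i y) k l := by
  simp only [curv, pdM, connMatrix, Matrix.of_apply, Matrix.add_apply, Matrix.sub_apply,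
    Matrix.mul_apply, Finset.sum_sub_distrib]
  ring

theorem contDiffAt_jac (hφ : ContDiffAt ℝ ∞ φ y) (k p : Fin d) :
    ContDiffAt ℝ ∞ (fun z => jac φ z k p) y := by
  have h : ContDiffAt ℝ ∞ (fun z => φ z k) y :=
    (EuclideanSpace.proj (𝕜 := ℝ) k).contDiff.contDiffAt.comp y hφ
  exact contDiffAt_pd p h

theorem pd_comp_jac {f : Eu d → ℝ} (hf : DifferentiableAt ℝ f (φ y)) (hφ : DifferentiableAt ℝ φ y)
    (i : Fin d) : pd i (fun z => f (φ z)) y = ∑ k, jac φ y k i * pd k f (φ y) :=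
  pd_comp hf hφ

theorem contDiffAt_pullMatrix (hφ : ContDiffAt ℝ ∞ φ y)
    (hΓ : ∀ i j k, ContDiffAt ℝ ∞ (fun z => Γ z i j k) (φ y)) (i k m : Fin d) :
    ContDiffAt ℝ ∞ (fun z => pullMatrix Γ φ i z k m) y := by
  simp only [pullMatrix, Matrix.of_apply]
  exact ContDiffAt.sum fun l _ => ((hΓ l m k).comp y hφ).mul (contDiffAt_jac hφ l i)

/-- The second derivatives of `φ` cancel by symmetry, so the curvature of the pulled back connection
is the pulled back curvature. -/
theorem curv_pullMatrix (hφ : ContDiffAt ℝ ∞ φ y)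
    (hΓ : ∀ i j k, ContDiffAt ℝ ∞ (fun z => Γ z i j k) (φ y)) (i j k m : Fin d) :
    (pdM i (pullMatrix Γ φ j) y - pdM j (pullMatrix Γ φ i) y +
      pullMatrix Γ φ i y * pullMatrix Γ φ j y - pullMatrix Γ φ j y * pullMatrix Γ φ i y) k m =
      ∑ a, ∑ b, jac φ y a i * jac φ y b j * curv Γ (φ y) a b k m := by
  have hd : ∀ i j, pdM i (pullMatrix Γ φ j) y k m =
      ∑ a, ∑ b, jac φ y a i * jac φ y b j * pd a (fun z => Γ z b m k) (φ y) +
        ∑ b, Γ (φ y) b m k * pd i (fun z => jac φ z b j) y := by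
    intro i j
    have hk : ∀ l, ContDiffAt ℝ ∞ (fun z => Γ (φ z) l m k) y := fun l => (hΓ l m k).comp y hφ
    simp only [pdM, pullMatrix, Matrix.of_apply]
    rw [pd_sum fun l _ => ((hk l).mul (contDiffAt_jac hφ l j)).diff,
      Finset.sum_comm, ← Finset.sum_add_distrib]
    refine Finset.sum_congr rfl fun b _ => ?_
    rw [pd_mul (hk b).diff (contDiffAt_jac hφ b j).diff,
      pd_comp_jac (f := fun z => Γ z b m k) (hΓ b m k).diff hφ.diff]
    congr 1
    · rw [Finset.sum_mul]
      exact Finset.sum_congr rfl fun _ _ => by ring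
  have hm : ∀ i j, (pullMatrix Γ φ i y * pullMatrix Γ φ j y) k m =
      ∑ a, ∑ b, jac φ y a i * jac φ y b j * ∑ q, Γ (φ y) a q k * Γ (φ y) b m q := by
    intro i j
    simp only [Matrix.mul_apply, pullMatrix, Matrix.of_apply, Finset.sum_mul_sum]
    simp only [Finset.mul_sum]
    rw [Finset.sum_comm]
    refine Finset.sum_congr rfl fun a _ => ?_
    rw [Finset.sum_comm]
    exact Finset.sum_congr rfl fun b _ => Finset.sum_congr rfl fun q _ => by ring
  have hc : ∀ b, pd i (fun z => jac φ z b j) y = pd j (fun z => jac φ z b i) y := fun b => by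
    have h : ContDiffAt ℝ ∞ (fun z => φ z b) y :=
      (EuclideanSpace.proj (𝕜 := ℝ) b).contDiff.contDiffAt.comp y hφ
    exact pd_comm h i j
  have hsw : ∀ f : Fin d → Fin d → ℝ, ∑ a, ∑ b, jac φ y a j * jac φ y b i * f a b =
      ∑ a, ∑ b, jac φ y a i * jac φ y b j * f b a := fun f => by
    rw [Finset.sum_comm]
    exact Finset.sum_congr rfl fun a _ => Finset.sum_congr rfl fun b _ => by ring
  simp only [Matrix.add_apply, Matrix.sub_apply, hd, hm, hsw, hc, curv]
  simp only [mul_add, mul_sub, Finset.sum_add_distrib, Finset.sum_sub_distrib]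
  ring

/-- Curvature is natural. -/
theorem curv_pullback {V : Set (Eu d)} (hV : IsOpen V) (hy : y ∈ V)
    (h : ∀ z ∈ V, IsPullback Γ Γ' φ z) (hφ : ContDiffAt ℝ ∞ φ y)
    (hΓ : ∀ i j k, ContDiffAt ℝ ∞ (fun z => Γ z i j k) (φ y))
    (hΓ' : ∀ i j k, ContDiffAt ℝ ∞ (fun z => Γ' z i j k) y) (i j k l : Fin d) :
    ∑ p, jac φ y k p * curv Γ' y i j p l =
      ∑ m, (∑ a, ∑ b, jac φ y a i * jac φ y b j * curv Γ (φ y) a b k m) * jac φ y m l := by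
  have h1 := gauge_curvature hV hy (contDiffAt_jac hφ) (G := connMatrix Γ')
    (fun i k p => hΓ' i p k) (contDiffAt_pullMatrix hφ hΓ) (fun z hz i => (h z hz).matrix i) i j
  have h2 := congrFun (congrFun h1 k) l
  rw [Matrix.mul_apply, Matrix.mul_apply] at h2
  simp only [← curv_eq_connMatrix, curv_pullMatrix hφ hΓ] at h2
  exact h2

/-- The tensor determining the curvature of a flat connection is natural. -/
theorem schouten_pullback (hd : 2 ≤ d) {V : Set (Eu d)} (hV : IsOpen V) (hy : y ∈ V)
    (h : ∀ z ∈ V, IsPullback Γ Γ' φ z) (hφ : ContDiffAt ℝ ∞ φ y)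
    (hΓ : ∀ i j k, ContDiffAt ℝ ∞ (fun z => Γ z i j k) (φ y))
    (hΓ' : ∀ i j k, ContDiffAt ℝ ∞ (fun z => Γ' z i j k) y) (hdet : (jac φ y).det ≠ 0)
    {Q Q' : Fin d → Fin d → ℝ}
    (hQ : ∀ i j k l, curv Γ (φ y) i j k l = (if i = k then Q j l else 0) - if j = k then Q i l else 0)
    (hQ' : ∀ i j k l, curv Γ' y i j k l = (if i = k then Q' j l else 0) - if j = k then Q' i l else 0)
    (j l : Fin d) : Q' j l = ∑ a, ∑ b, jac φ y a j * jac φ y b l * Q a b := by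
  set P : Fin d → Fin d → ℝ := fun j l => ∑ a, ∑ b, jac φ y a j * jac φ y b l * Q a b
  -- `Q'` and the pullback `P` of `Q` produce the same curvature; comparing the two expressions
  -- bounds the difference to a tensor of this degenerate type.
  have key : ∀ i j k l, jac φ y k i * (Q' j l - P j l) = jac φ y k j * (Q' i l - P i l) := by
    intro i j k l
    have h1 := curv_pullback hV hy h hφ hΓ hΓ' i j k l
    simp only [hQ, hQ'] at h1
    have hL : ∑ p, jac φ y k p * ((if i = p then Q' j l else 0) - if j = p then Q' i l else 0) =
        jac φ y k i * Q' j l - jac φ y k j * Q' i l := by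
      simp [mul_sub, Finset.sum_sub_distrib]
    have hR1 : ∀ m, ∑ a, ∑ b, jac φ y a i * jac φ y b j *
        ((if a = k then Q b m else 0) - if b = k then Q a m else 0) =
        jac φ y k i * (∑ b, jac φ y b j * Q b m) - jac φ y k j * ∑ a, jac φ y a i * Q a m := by
      intro m
      simp only [mul_sub, Finset.sum_sub_distrib]
      congr 1
      · rw [Finset.sum_comm]
        simp only [mul_ite, mul_zero, Finset.sum_ite_eq', Finset.mem_univ, if_true, Finset.mul_sum]
        exact Finset.sum_congr rfl fun _ _ => by ring
      · simp only [mul_ite, mul_zero, Finset.sum_ite_eq', Finset.mem_univ, if_true, Finset.mul_sum]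
        exact Finset.sum_congr rfl fun _ _ => by ring
    have hP : ∀ j, ∑ m, (∑ b, jac φ y b j * Q b m) * jac φ y m l = P j l := by
      intro j
      simp only [Finset.sum_mul, P]
      rw [Finset.sum_comm]
      exact Finset.sum_congr rfl fun _ _ => Finset.sum_congr rfl fun _ _ => by ring
    simp only [hR1, sub_mul, Finset.sum_sub_distrib, mul_assoc (jac φ y k _), ← Finset.mul_sum,
      hP] at h1
    rw [hL] at h1
    linarith
  -- Dimension at least two provides an index `i ≠ j`. Contracting `key` with row `i` of the inverse
  -- Jacobian isolates the difference on the left and kills the right side.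
  have : Nontrivial (Fin d) := Fin.nontrivial_iff_two_le.2 hd
  obtain ⟨i, hi⟩ := exists_ne j
  have h2 : ∑ k, (jac φ y)⁻¹ i k * (jac φ y k i * (Q' j l - P j l)) =
      ∑ k, (jac φ y)⁻¹ i k * (jac φ y k j * (Q' i l - P i l)) :=
    Finset.sum_congr rfl fun k _ => by rw [key]
  have h3 : ∀ j, ∑ k, (jac φ y)⁻¹ i k * jac φ y k j = if i = j then 1 else 0 := fun j => by
    rw [← Matrix.mul_apply, Matrix.nonsing_inv_mul _ hdet.isUnit, Matrix.one_apply]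
  simp only [← mul_assoc, ← Finset.sum_mul, h3, if_true, if_neg hi, one_mul, zero_mul] at h2
  linarith

/-- The connections of corresponding scales correspond. -/
theorem IsPullback.scaleSymbols {V : Set (Eu d)} (hV : IsOpen V) (hy : y ∈ V)
    (h : IsPullback Γ Γ' φ y) (hφ : ContDiffAt ℝ ∞ φ y) (hdet : (jac φ y).det ≠ 0)
    {τ τ' : Eu d → ℝ} (hτ : DifferentiableAt ℝ τ (φ y)) (h0 : τ (φ y) ≠ 0)
    (hτ' : ∀ z ∈ V, τ' z = |(jac φ z).det| ^ (-1 / ((d : ℝ) + 1)) * τ (φ z)) :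
    IsPullback (scaleSymbols Γ τ) (scaleSymbols Γ' τ') φ y := by
  have hd0 : (d : ℝ) + 1 ≠ 0 := by positivity
  set D := fun z => (jac φ z).det with hD
  have hDs : ContDiffAt ℝ ∞ D y := contDiffAt_det (contDiffAt_jac hφ)
  -- The trace of the gauge law: the logarithmic derivative of the Jacobian determinant is the
  -- difference of the traces of the two connections.
  have htr : ∀ i, pd i D y / D y = (∑ p, Γ' y i p p) -
      ∑ l, jac φ y l i * ∑ k, Γ (φ y) l k k := by
    intro i
    have h1 := pd_det_of_ne_zero (contDiffAt_jac hφ) hdet i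
    have h2 : pdM i (jac φ) y = jac φ y * connMatrix Γ' i y - pullMatrix Γ φ i y * jac φ y := by
      rw [h.matrix i]; abel
    have h3 : ∑ a, ∑ b, (jac φ y)⁻¹ a b * pd i (fun z => jac φ z b a) y =
        ((jac φ y)⁻¹ * pdM i (jac φ) y).trace := rfl
    rw [h3, h2, mul_sub, Matrix.trace_sub, ← mul_assoc, Matrix.nonsing_inv_mul _ hdet.isUnit,
      one_mul, ← mul_assoc, Matrix.trace_mul_comm, ← mul_assoc,
      Matrix.mul_nonsing_inv _ hdet.isUnit, one_mul] at h1
    change pd i D y = D y * _ at h1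
    have hDy : D y ≠ 0 := hdet
    rw [h1, mul_div_cancel_left₀ _ hDy]
    congr 1
    simp only [Matrix.trace, Matrix.diag, pullMatrix, Matrix.of_apply, Finset.mul_sum]
    rw [Finset.sum_comm]
    exact Finset.sum_congr rfl fun _ _ => Finset.sum_congr rfl fun _ _ => by ring
  -- The derivative of the density factor `|det|^{-1/(d+1)}` exactly compensates this difference, so
  -- the one-forms of corresponding scales correspond.
  have hform : ∀ i, scaleForm Γ' τ' y i = ∑ l, jac φ y l i * scaleForm Γ τ (φ y) l := by
    intro i
    have hDne : ∀ᶠ z in 𝓝 y, D z ≠ 0 := hDs.continuousAt.eventually_ne hdet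
    have hev : τ' =ᶠ[𝓝 y] fun z => Real.exp (-1 / ((d : ℝ) + 1) * Real.log (D z)) * τ (φ z) := by
      filter_upwards [hDne, hV.mem_nhds hy] with z hz hzV
      rw [hτ' z hzV, Real.rpow_def_of_pos (abs_pos.2 hz), Real.log_abs, mul_comm (Real.log _)]
    have hE : HasDerivAt (fun x : ℝ => Real.exp (-1 / ((d : ℝ) + 1) * Real.log x))
        (Real.exp (-1 / ((d : ℝ) + 1) * Real.log (D y)) * (-1 / ((d : ℝ) + 1) * (D y)⁻¹)) (D y) :=
      ((Real.hasDerivAt_log hdet).const_mul _).exp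
    have hcomp : DifferentiableAt ℝ (fun z => τ (φ z)) y := hτ.comp y hφ.diff
    have h1 : pd i τ' y / τ' y = -1 / ((d : ℝ) + 1) * (pd i D y / D y) +
        (∑ l, jac φ y l i * pd l τ (φ y)) / τ (φ y) := by
      have hE0 : Real.exp (-1 / ((d : ℝ) + 1) * Real.log (D y)) ≠ 0 := (Real.exp_pos _).ne'
      have hEd : DifferentiableAt ℝ (fun z => Real.exp (-1 / ((d : ℝ) + 1) * Real.log (D z))) y :=
        hE.differentiableAt.comp y hDs.diff
      rw [pd_congr' hev, hev.self_of_nhds, pd_mul hEd hcomp, pd_real_comp hE hDs.diff,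
        pd_comp_jac hτ hφ.diff]
      have : D y ≠ 0 := hdet
      field_simp
    have hτ'0 : τ' y ≠ 0 := by
      rw [hev.self_of_nhds]; exact mul_ne_zero (Real.exp_pos _).ne' h0
    have h2 : ∀ l, scaleForm Γ τ (φ y) l =
        -(pd l τ (φ y) / τ (φ y) + (∑ k, Γ (φ y) l k k) / (d + 1)) := fun l => by
      rw [scaleForm, add_div, mul_div_assoc, div_self h0, mul_one]
    have h3 : scaleForm Γ' τ' y i = -(pd i τ' y / τ' y + (∑ k, Γ' y i k k) / (d + 1)) := by
      rw [scaleForm, add_div, mul_div_assoc, div_self hτ'0, mul_one]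
    rw [h3, h1, htr]
    simp only [h2, mul_neg, mul_add, Finset.sum_neg_distrib, Finset.sum_add_distrib]
    simp only [mul_div_assoc', ← Finset.sum_div]
    field_simp
    ring
  intro i j k
  have hijk := h i j k
  have hl : ∑ p, HarmonicScale.scaleSymbols Γ' τ' y i j p * pd p (fun z => φ z k) y =
      ∑ p, Γ' y i j p * pd p (fun z => φ z k) y +
        (scaleForm Γ' τ' y i * jac φ y k j + scaleForm Γ' τ' y j * jac φ y k i) := by
    simp only [HarmonicScale.scaleSymbols, add_mul, Finset.sum_add_distrib, ite_mul, zero_mul,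
      Finset.sum_ite_eq, Finset.mem_univ, if_true, jac, Matrix.of_apply]
    ring
  have hr : ∑ l, ∑ m, HarmonicScale.scaleSymbols Γ τ (φ y) l m k * pd i (fun z => φ z l) y *
      pd j (fun z => φ z m) y = ∑ l, ∑ m, Γ (φ y) l m k * pd i (fun z => φ z l) y *
      pd j (fun z => φ z m) y + ((∑ l, jac φ y l i * scaleForm Γ τ (φ y) l) * jac φ y k j +
        (∑ l, jac φ y l j * scaleForm Γ τ (φ y) l) * jac φ y k i) := by
    simp only [HarmonicScale.scaleSymbols, add_mul, Finset.sum_add_distrib, ite_mul, zero_mul,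
      Finset.sum_ite_eq', Finset.mem_univ, if_true, jac, Matrix.of_apply, Finset.sum_mul]
    rw [Finset.sum_comm (f := fun l m => if l = k then _ else _)]
    simp only [Finset.sum_ite_eq', Finset.mem_univ, if_true]
    rw [add_assoc]
    congr 2
    · exact Finset.sum_congr rfl fun _ _ => by ring
    · exact Finset.sum_congr rfl fun _ _ => by ring
  rw [hl, hr, hijk, hform, hform]
  ring

end Pullback

/-! ### Chain rule for Jacobian matrices. -/

section JacChain

variable {d : ℕ} {φ ψ : Eu d → Eu d} {y : Eu d}

theorem jac_comp (hψ : DifferentiableAt ℝ ψ (φ y)) (hφ : DifferentiableAt ℝ φ y) :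
    jac (fun z => ψ (φ z)) y = jac ψ (φ y) * jac φ y := by
  ext k i
  have hk : DifferentiableAt ℝ (fun w => ψ w k) (φ y) :=
    (EuclideanSpace.proj (𝕜 := ℝ) k : Eu d →L[ℝ] ℝ).differentiableAt.comp _ hψ
  rw [Matrix.mul_apply]
  simp only [jac, Matrix.of_apply]
  rw [pd_comp (f := fun w => ψ w k) hk hφ]
  exact Finset.sum_congr rfl fun _ _ => mul_comm _ _

theorem jac_congr {V : Set (Eu d)} (hV : IsOpen V) (hy : y ∈ V) (h : ∀ z ∈ V, φ z = ψ z) :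
    jac φ y = jac ψ y := by
  ext k i
  exact pd_congr hV hy fun z hz => by rw [h z hz]

theorem jac_id (y : Eu d) : jac (fun z => z) y = 1 := by
  ext k i
  simp only [jac, Matrix.of_apply, pd_coord, Matrix.one_apply, eq_comm]

end JacChain

/-! ### Exponent identities for a change of boundary chart. -/

section SliceAlgebra

variable {n : ℕ} {a j D D' t : ℝ}

/-- Here `a = ∂_0 φ^0`, `j` is the Jacobian determinant along the slice, and `D, D'` are the
determinants of `B` in the two charts. The power of `D` converts weight one on the boundary into
weight one on the manifold. The proof compares logarithms. -/
theorem boundaryValue_algebra (hn : 0 < n) (ha : 0 < a) (hj : j ≠ 0) (hD : 0 < D) (hD' : 0 < D')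
    (h : a ^ n * D' = j ^ 2 * D) :
    |j| ^ (-1 / (n : ℝ)) * D' ^ (1 / ((n : ℝ) * (n + 2))) =
      |a * j| ^ (-1 / ((n : ℝ) + 2)) * D ^ (1 / ((n : ℝ) * (n + 2))) := by
  have hj' := abs_pos.2 hj
  have haj := abs_pos.2 (mul_ne_zero ha.ne' hj)
  have hn0 : (n : ℝ) ≠ 0 := by positivity
  have hn2 : (n : ℝ) + 2 ≠ 0 := by positivity
  have hlog := congrArg Real.log h
  rw [Real.log_mul (by positivity) hD'.ne', Real.log_mul (by positivity) hD.ne', Real.log_pow,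
    Real.log_pow] at hlog
  have h1 := Real.rpow_pos_of_pos hj' (-1 / (n : ℝ))
  have h2 := Real.rpow_pos_of_pos hD' (1 / ((n : ℝ) * (n + 2)))
  have h3 := Real.rpow_pos_of_pos haj (-1 / ((n : ℝ) + 2))
  have h4 := Real.rpow_pos_of_pos hD (1 / ((n : ℝ) * (n + 2)))
  refine Real.log_injOn_pos (Set.mem_Ioi.2 (mul_pos h1 h2)) (Set.mem_Ioi.2 (mul_pos h3 h4)) ?_
  rw [Real.log_mul h1.ne' h2.ne', Real.log_mul h3.ne' h4.ne', Real.log_rpow hj', Real.log_rpow hD',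
    Real.log_rpow haj, Real.log_rpow hD, Real.log_abs, Real.log_abs, Real.log_mul ha.ne' hj]
  have : Real.log D' = 2 * Real.log j + Real.log D - n * Real.log a := by
    push_cast at hlog; linarith
  rw [this]
  field_simp
  ring

theorem transversal_algebra (ha : 0 < a) (hj : j ≠ 0) (hD : 0 < D) (hD' : 0 < D') (ht : 0 < t)
    (h : a ^ n * D' = j ^ 2 * D) :
    a * (D' ^ (1 / ((n : ℝ) + 2)) * (|a * j| ^ (-1 / ((n : ℝ) + 2)) * t) ^ 2) =
      D ^ (1 / ((n : ℝ) + 2)) * t ^ 2 := by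
  have haj := abs_pos.2 (mul_ne_zero ha.ne' hj)
  have hn2 : (n : ℝ) + 2 ≠ 0 := by positivity
  have hlog := congrArg Real.log h
  rw [Real.log_mul (by positivity) hD'.ne', Real.log_mul (by positivity) hD.ne', Real.log_pow,
    Real.log_pow] at hlog
  have h2 := Real.rpow_pos_of_pos hD' (1 / ((n : ℝ) + 2))
  have h3 := Real.rpow_pos_of_pos haj (-1 / ((n : ℝ) + 2))
  have h4 := Real.rpow_pos_of_pos hD (1 / ((n : ℝ) + 2))
  refine Real.log_injOn_pos (Set.mem_Ioi.2 (by positivity)) (Set.mem_Ioi.2 (by positivity)) ?_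
  rw [Real.log_mul ha.ne' (by positivity), Real.log_mul h2.ne' (by positivity), Real.log_pow,
    Real.log_mul h3.ne' ht.ne', Real.log_mul h4.ne' (by positivity), Real.log_rpow hD',
    Real.log_rpow haj, Real.log_rpow hD, Real.log_abs, Real.log_mul ha.ne' hj, Real.log_pow]
  have : Real.log D' = 2 * Real.log j + Real.log D - n * Real.log a := by
    push_cast at hlog; linarith
  rw [this]
  field_simp
  push_cast
  ring

end SliceAlgebra

/-! ### Coordinate changes preserving the boundary. -/

section SliceMap

/-- A coordinate change preserving the half space `{y 0 < 0}`. -/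
structure SliceMap {n : ℕ} (W : Set (Eu (n + 1))) (φ : Eu (n + 1) → Eu (n + 1)) : Prop where
  isOpen : IsOpen W
  smooth : ∀ z ∈ W, ContDiffAt ℝ ∞ φ z
  neg_iff : ∀ z ∈ W, φ z 0 < 0 ↔ z 0 < 0
  det_ne : ∀ z ∈ W, (jac φ z).det ≠ 0

/-- The induced map of the slice. -/
def sliceMap {n : ℕ} (φ : Eu (n + 1) → Eu (n + 1)) (v : Eu n) : Eu n := sliceProj (φ (slicePt v))

namespace SliceMap

variable {n : ℕ} {W : Set (Eu (n + 1))} {φ : Eu (n + 1) → Eu (n + 1)} (H : SliceMap W φ)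

include H

theorem isOpen_slice : IsOpen {v : Eu n | slicePt v ∈ W} :=
  H.isOpen.preimage (contDiff_slicePt (_k := 0)).continuous

theorem smooth_apply {z : Eu (n + 1)} (hz : z ∈ W) (k : Fin (n + 1)) :
    ContDiffAt ℝ ∞ (fun w => φ w k) z :=
  (EuclideanSpace.proj (𝕜 := ℝ) k).contDiff.contDiffAt.comp z (H.smooth z hz)

variable {v : Eu n} (hv : slicePt v ∈ W)

include hv

theorem apply_zero : φ (slicePt v) 0 = 0 := by
  refine le_antisymm ?_ ?_
  · refine le_of_tendsto ((H.smooth_apply hv 0).continuousAt.tendsto.comp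
      (tendsto_firstLine (slicePt v))) ?_
    filter_upwards [(tendsto_firstLine (slicePt v)).eventually (H.isOpen.mem_nhds hv),
      self_mem_nhdsWithin] with t ht ht0
    refine ((H.neg_iff _ ht).2 ?_).le
    rw [firstLine_zero, slicePt_zero]
    simpa using ht0
  · by_contra h
    have := (H.neg_iff _ hv).1 (not_le.1 h)
    rw [slicePt_zero] at this
    exact lt_irrefl _ this

theorem slicePt_sliceMap : slicePt (sliceMap φ v) = φ (slicePt v) :=
  slicePt_sliceProj (H.apply_zero hv)

theorem jac_zero_succ (a : Fin n) : jac φ (slicePt v) 0 a.succ = 0 := by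
  rw [jac, Matrix.of_apply, ← pd_slice (H.smooth_apply hv 0).diff,
    pd_congr H.isOpen_slice (g := fun _ => 0) hv fun w hw => H.apply_zero hw, pd_const]

theorem jac_succ_succ (c a : Fin n) :
    jac φ (slicePt v) c.succ a.succ = jac (sliceMap φ) v c a := by
  simp only [jac, Matrix.of_apply]
  rw [← pd_slice (H.smooth_apply hv _).diff]
  rfl

theorem det_jac : (jac φ (slicePt v)).det = jac φ (slicePt v) 0 0 * (jac (sliceMap φ) v).det := by
  rw [Matrix.det_succ_row_zero, Fin.sum_univ_succ]
  simp only [H.jac_zero_succ hv, mul_zero, zero_mul, Finset.sum_const_zero, add_zero, Fin.val_zero,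
    pow_zero, one_mul]
  congr 2
  ext c a
  rw [← H.jac_succ_succ hv]
  simp [Matrix.submatrix_apply]

theorem det_sliceMap_ne : (jac (sliceMap φ) v).det ≠ 0 := fun h => by
  have := H.det_ne _ hv
  rw [H.det_jac hv, h, mul_zero] at this
  exact this rfl

/-- The Jacobian is block triangular along the slice, so this entry is nonzero. It is nonnegative
because the map preserves the side `y 0 < 0`. -/
theorem jac_zero_zero_pos : 0 < jac φ (slicePt v) 0 0 := by
  have hne : jac φ (slicePt v) 0 0 ≠ 0 := fun h => by
    have := H.det_ne _ hv
    rw [H.det_jac hv, h, zero_mul] at this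
    exact this rfl
  refine lt_of_le_of_ne ?_ hne.symm
  have h := (hasDerivAt_firstLine (H.smooth_apply hv 0).diff).hasDerivWithinAt (s := Set.Iio 0)
  have h2 := (hasDerivWithinAt_iff_tendsto_slope' (by simp)).1 h
  refine ge_of_tendsto h2 ?_
  filter_upwards [(tendsto_firstLine (slicePt v)).eventually (H.isOpen.mem_nhds hv),
    self_mem_nhdsWithin] with t ht ht0
  have hneg : φ (slicePt v + t • (EuclideanSpace.single 0 1 : Eu (n + 1))) 0 < 0 := by
    rw [H.neg_iff _ ht, firstLine_zero, slicePt_zero]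
    simpa using ht0
  simp only [slope, sub_zero, zero_smul, add_zero, H.apply_zero hv, vsub_eq_sub, smul_eq_mul]
  exact (mul_pos_of_neg_of_neg (inv_lt_zero.2 ht0) hneg).le

theorem contDiffAt_sliceMap : ContDiffAt ℝ ∞ (sliceMap φ) v :=
  contDiff_sliceProj.contDiffAt.comp v
    (ContDiffAt.comp v (H.smooth _ hv) contDiff_slicePt.contDiffAt)

variable {Γ Γ' : Symbols (n + 1)}

/-- Tangential second derivatives of `φ^0` vanish on the slice, so the inhomogeneous term in the law
for `Γ_ab^0` disappears, and only the entry `∂_0 φ^0` survives on the left. -/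
theorem sliceForm_pullback (hp : IsPullback Γ Γ' φ (slicePt v)) :
    jac φ (slicePt v) 0 0 • sliceForm Γ' v =
      (jac (sliceMap φ) v).transpose * sliceForm Γ (sliceMap φ v) * jac (sliceMap φ) v := by
  ext a b
  have h := hp a.succ b.succ 0
  have h2 : pd a.succ (pd b.succ (fun z => φ z 0)) (slicePt v) = 0 := by
    rw [← pd_slice (f := pd b.succ (fun z => φ z 0)) (contDiffAt_pd _ (H.smooth_apply hv 0)).diff,
      pd_congr (f := fun v => pd b.succ (fun z => φ z 0) (slicePt v)) H.isOpen_slice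
        (g := fun _ => 0) hv fun w hw => H.jac_zero_succ hw b, pd_const]
  have hj : ∀ k p, pd p (fun z => φ z k) (slicePt v) = jac φ (slicePt v) k p := fun _ _ => rfl
  simp only [h2, hj] at h
  simp only [Fin.sum_univ_succ (n := n), H.jac_zero_succ hv, H.jac_succ_succ hv, mul_zero, zero_mul,
    Finset.sum_const_zero, add_zero, zero_add] at h
  simp only [Matrix.smul_apply, smul_eq_mul, Matrix.mul_apply, Matrix.transpose_apply, sliceForm,
    Matrix.of_apply, H.slicePt_sliceMap hv, Finset.sum_mul]
  rw [mul_neg, mul_comm, h, Finset.sum_comm, ← Finset.sum_neg_distrib]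
  refine Finset.sum_congr rfl fun c _ => ?_
  rw [← Finset.sum_neg_distrib]
  exact Finset.sum_congr rfl fun d _ => by ring

theorem det_sliceForm_pullback (hp : IsPullback Γ Γ' φ (slicePt v)) :
    jac φ (slicePt v) 0 0 ^ n * (sliceForm Γ' v).det =
      (jac (sliceMap φ) v).det ^ 2 * (sliceForm Γ (sliceMap φ v)).det := by
  have h := congrArg Matrix.det (H.sliceForm_pullback hv hp)
  rw [Matrix.det_smul, Fintype.card_fin, Matrix.det_mul, Matrix.det_mul, Matrix.det_transpose] at h
  rw [h]; ring

theorem sum_inv_pullback (hp : IsPullback Γ Γ' φ (slicePt v)) {q q' : Fin n → Fin n → ℝ}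
    (hq : ∀ a b, q' a b = ∑ c, ∑ d, jac (sliceMap φ) v c a * jac (sliceMap φ) v d b * q c d) :
    ∑ a, ∑ b, (sliceForm Γ' v)⁻¹ a b * q' a b =
      jac φ (slicePt v) 0 0 * ∑ a, ∑ b, (sliceForm Γ (sliceMap φ v))⁻¹ a b * q a b := by
  set J := jac (sliceMap φ) v
  set α := jac φ (slicePt v) 0 0
  have hα : α ≠ 0 := (H.jac_zero_zero_pos hv).ne'
  have hJ : IsUnit J.det := (H.det_sliceMap_ne hv).isUnit
  have hB : sliceForm Γ' v = α⁻¹ • (J.transpose * sliceForm Γ (sliceMap φ v) * J) := by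
    rw [← H.sliceForm_pullback hv hp, smul_smul, inv_mul_cancel₀ hα, one_smul]
  have hBi : (sliceForm Γ' v)⁻¹ = α • (J⁻¹ * (sliceForm Γ (sliceMap φ v))⁻¹ * J.transpose⁻¹) := by
    have hu : α⁻¹ • (J.transpose * sliceForm Γ (sliceMap φ v) * J) =
        (α⁻¹ • J.transpose) * (sliceForm Γ (sliceMap φ v) * J) := by
      rw [Matrix.smul_mul, Matrix.mul_assoc]
    have hi : (α⁻¹ • J.transpose)⁻¹ = α • J.transpose⁻¹ := by
      refine Matrix.inv_eq_left_inv ?_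
      rw [Matrix.smul_mul, Matrix.mul_smul, smul_smul, mul_inv_cancel₀ hα, one_smul,
        Matrix.nonsing_inv_mul _ (by rwa [Matrix.det_transpose])]
    rw [hB, hu, Matrix.mul_inv_rev, Matrix.mul_inv_rev, hi, Matrix.mul_smul]
  have hq' : (Matrix.of q').transpose = J.transpose * (Matrix.of q).transpose * J := by
    ext b a
    simp only [Matrix.transpose_apply, Matrix.of_apply, hq, Matrix.mul_apply, Finset.sum_mul]
    exact Finset.sum_congr rfl fun _ _ => Finset.sum_congr rfl fun _ _ => by ring
  have ht : ∀ (B : Matrix (Fin n) (Fin n) ℝ) (q : Fin n → Fin n → ℝ),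
      ∑ a, ∑ b, B a b * q a b = (B * (Matrix.of q).transpose).trace := fun B q => rfl
  rw [ht, ht, hBi, hq', Matrix.smul_mul, Matrix.trace_smul, smul_eq_mul]
  congr 1
  have hJt : J.transpose⁻¹ * J.transpose = 1 :=
    Matrix.nonsing_inv_mul _ (by rwa [Matrix.det_transpose])
  calc (J⁻¹ * (sliceForm Γ (sliceMap φ v))⁻¹ * J.transpose⁻¹ *
        (J.transpose * (Matrix.of q).transpose * J)).trace
      = (J⁻¹ * ((sliceForm Γ (sliceMap φ v))⁻¹ * (J.transpose⁻¹ * J.transpose) *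
          (Matrix.of q).transpose * J)).trace := by simp only [Matrix.mul_assoc]
    _ = _ := by
      rw [Matrix.trace_mul_comm, hJt, mul_one, Matrix.mul_assoc, Matrix.mul_nonsing_inv _ hJ,
        mul_one]

/-- The harmonicity condition does not depend on the chart. -/
theorem sliceTrace_pullback (hn : 1 ≤ n) {V V' U : Set (Eu (n + 1))}
    {r r' τ τ' : Eu (n + 1) → ℝ} (L : LocalBoundary V Γ r) (L' : LocalBoundary V' Γ' r')
    (hWV : W ⊆ V') (hU : IsOpen U) (hUV : U ⊆ V) (hφU : φ (slicePt v) ∈ U)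
    (hp : ∀ z ∈ W, IsPullback Γ Γ' φ z)
    (hτ : ∀ z ∈ U, ContDiffAt ℝ ∞ τ z) (h0 : ∀ z ∈ U, τ z ≠ 0)
    (hτ' : ∀ z ∈ W, φ z ∈ U → ContDiffAt ℝ ∞ τ' z)
    (hττ' : ∀ z ∈ W, φ z ∈ U →
      τ' z = |(jac φ z).det| ^ (-1 / ((n : ℝ) + 2)) * τ (φ z)) :
    sliceTrace Γ' τ' v / τ' (slicePt v) =
      jac φ (slicePt v) 0 0 * (sliceTrace Γ τ (sliceMap φ v) / τ (φ (slicePt v))) := by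
  have hcont : ContinuousOn φ W := fun z hz => (H.smooth z hz).continuousAt.continuousWithinAt
  have hW' : IsOpen (W ∩ φ ⁻¹' U) := hcont.isOpen_inter_preimage H.isOpen hU
  have hvW' : slicePt v ∈ W ∩ φ ⁻¹' U := ⟨hv, hφU⟩
  have hdpos : ∀ z ∈ W, 0 < |(jac φ z).det| ^ (-1 / ((n : ℝ) + 2)) := fun z hz =>
    Real.rpow_pos_of_pos (abs_pos.2 (H.det_ne z hz)) _
  have h0' : ∀ z ∈ W ∩ φ ⁻¹' U, τ' z ≠ 0 := fun z hz => by
    rw [hττ' z hz.1 hz.2]; exact mul_ne_zero (hdpos z hz.1).ne' (h0 _ hz.2)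
  have hps : ∀ z ∈ W ∩ φ ⁻¹' U, IsPullback (scaleSymbols Γ τ) (scaleSymbols Γ' τ') φ z := by
    intro z hz
    refine (hp z hz.1).scaleSymbols hW' hz (H.smooth z hz.1) (H.det_ne z hz.1) (hτ _ hz.2).diff
      (h0 _ hz.2) fun w hw => ?_
    rw [hττ' w hw.1 hw.2]
    congr 3
    push_cast
    ring
  have hVy := hUV hφU
  have hV'v := hWV hv
  -- The tensors `τ⁻¹ D D τ` in the two charts are identified through the curvatures that they
  -- determine, without transforming second derivatives of densities.
  have hQ := fun i j k l => curv_scaleSymbols hU hφU (L.symm _ hVy) (L.smooth _ hVy) (L.weyl _ hVy)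
    hτ h0 i j k l
  have hQ' := fun i j k l => curv_scaleSymbols hW' hvW' (L'.symm _ hV'v) (L'.smooth _ hV'v)
    (L'.weyl _ hV'v) (fun z hz => hτ' z hz.1 hz.2) h0' i j k l
  have hs := schouten_pullback (by omega) hW' hvW' hps (H.smooth _ hv)
    (contDiffAt_scaleSymbols (L.smooth _ hVy) (hτ _ hφU) (h0 _ hφU))
    (contDiffAt_scaleSymbols (L'.smooth _ hV'v) (hτ' _ hv hφU) (h0' _ hvW')) (H.det_ne _ hv)
    (Q := fun j l => scaleHess Γ τ (φ (slicePt v)) j l / τ (φ (slicePt v)))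
    (Q' := fun j l => scaleHess Γ' τ' (slicePt v) j l / τ' (slicePt v)) hQ hQ'
  have h := H.sum_inv_pullback hv (hp _ hv)
    (q := fun c d => scaleHess Γ τ (φ (slicePt v)) c.succ d.succ / τ (φ (slicePt v)))
    (q' := fun a b => scaleHess Γ' τ' (slicePt v) a.succ b.succ / τ' (slicePt v)) (fun a b => by
      -- The first component of a tangential vector stays zero, so only the tangential block of the
      -- Jacobian enters.
      rw [hs, Fin.sum_univ_succ]
      simp only [Fin.sum_univ_succ (n := n), H.jac_zero_succ hv, H.jac_succ_succ hv, mul_zero,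
        zero_mul, Finset.sum_const_zero, zero_add])
  simp only [sliceTrace, H.slicePt_sliceMap hv, Finset.sum_div, mul_div_assoc]
  exact h

end SliceMap

end SliceMap

/-! ### Transport of densities and harmonic jets between charts. -/

section ChartChange

variable {n : ℕ} {N : Type*} [TopologicalSpace N] [ChartedSpace (Eu (n + 1)) N]
  {e e' e'' : OpenPartialHomeomorph N (Eu (n + 1))} {Ω : Set N}

/-- The domain of the coordinate change from `e'` to `e`. -/
def overlap (e e' : OpenPartialHomeomorph N (Eu (n + 1))) : Set (Eu (n + 1)) :=
  e'.target ∩ e'.symm ⁻¹' e.source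

theorem isOpen_overlap (e e' : OpenPartialHomeomorph N (Eu (n + 1))) : IsOpen (overlap e e') :=
  e'.symm.isOpen_inter_preimage e.open_source

theorem chg_mem_overlap {y : Eu (n + 1)} (hy : y ∈ overlap e e') : chg e e' y ∈ overlap e' e := by
  refine ⟨e.map_source hy.2, ?_⟩
  change e.symm (e (e'.symm y)) ∈ e'.source
  rw [e.left_inv hy.2]
  exact e'.map_target hy.1

theorem chg_chg {y : Eu (n + 1)} (hy : y ∈ overlap e e') : chg e' e (chg e e' y) = y := by
  rw [chg, chg, e.left_inv hy.2, e'.right_inv hy.1]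

variable [IsManifold 𝓘(ℝ, Eu (n + 1)) ∞ N]

theorem contDiffAt_chg' (he : e ∈ charts n N) (he' : e' ∈ charts n N) {y : Eu (n + 1)}
    (hy : y ∈ overlap e e') : ContDiffAt ℝ ∞ (chg e e') y :=
  contDiffAt_chg he he' hy.1 hy.2

theorem det_jac_chg_ne (he : e ∈ charts n N) (he' : e' ∈ charts n N) {y : Eu (n + 1)}
    (hy : y ∈ overlap e e') : (jac (chg e e') y).det ≠ 0 := by
  have h1 : jac (fun z => chg e' e (chg e e' z)) y = 1 := by
    rw [jac_congr (isOpen_overlap e e') hy fun z hz => chg_chg hz, jac_id]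
  rw [jac_comp (contDiffAt_chg' he' he (chg_mem_overlap hy)).diff
    (contDiffAt_chg' he he' hy).diff] at h1
  have h2 := congrArg Matrix.det h1
  rw [Matrix.det_mul, Matrix.det_one] at h2
  exact right_ne_zero_of_mul_eq_one h2

theorem sliceMap_chg (he : e ∈ boundaryCharts (n := n) Ω) (he' : e' ∈ boundaryCharts (n := n) Ω) :
    SliceMap (overlap e e') (chg e e') := by
  refine ⟨isOpen_overlap e e', fun z hz => contDiffAt_chg' he.1 he'.1 hz, fun z hz => ?_,
    fun z hz => det_jac_chg_ne he.1 he'.1 hz⟩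
  rw [← mem_iff_of_boundaryChart he' hz.1, he.2 _ hz.2]

variable {nabla : CovariantDerivative 𝓘(ℝ, Eu (n + 1)) (Eu (n + 1))
    (TangentSpace 𝓘(ℝ, Eu (n + 1)) : N → Type _)} {ρ : ProjDensity n N 2}

theorem isPullback_chg (he : e ∈ charts n N) (he' : e' ∈ charts n N) {y : Eu (n + 1)}
    (hy : y ∈ overlap e e') :
    IsPullback (christoffel nabla e) (christoffel nabla e') (chg e e') y := fun i j k =>
  christoffel_chg nabla he he' hy.1 hy.2 i j k

/-- The density with component `f` in the chart `e`, in the chart `e'`. -/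
def transport (e : OpenPartialHomeomorph N (Eu (n + 1))) (f : Eu (n + 1) → ℝ)
    (e' : OpenPartialHomeomorph N (Eu (n + 1))) (y : Eu (n + 1)) : ℝ :=
  |(jac (chg e e') y).det| ^ (-1 / ((n : ℝ) + 2)) * f (chg e e' y)

theorem contDiffAt_abs_rpow {d : ℕ} {D : Eu d → ℝ} {y : Eu d} (hD : ContDiffAt ℝ ∞ D y)
    (h0 : D y ≠ 0) (c : ℝ) : ContDiffAt ℝ ∞ (fun z => |D z| ^ c) y := by
  refine (((hD.log h0).mul contDiffAt_const).exp (f := fun z => Real.log (D z) * c)).congr_of_eventuallyEq ?_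
  filter_upwards [hD.continuousAt.eventually_ne h0] with z hz
  rw [Real.rpow_def_of_pos (abs_pos.2 hz), Real.log_abs]

theorem contDiffAt_transport (he : e ∈ charts n N) (he' : e' ∈ charts n N) {f : Eu (n + 1) → ℝ}
    {y : Eu (n + 1)} (hy : y ∈ overlap e e') (hf : ContDiffAt ℝ ∞ f (chg e e' y)) :
    ContDiffAt ℝ ∞ (transport e f e') y :=
  (contDiffAt_abs_rpow (contDiffAt_det (contDiffAt_jac (contDiffAt_chg' he he' hy)))
    (det_jac_chg_ne he he' hy) _).mul (hf.comp y (contDiffAt_chg' he he' hy))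

theorem transport_pos (he : e ∈ charts n N) (he' : e' ∈ charts n N) {f : Eu (n + 1) → ℝ}
    {y : Eu (n + 1)} (hy : y ∈ overlap e e') (hf : 0 < f (chg e e' y)) :
    0 < transport e f e' y :=
  mul_pos (Real.rpow_pos_of_pos (abs_pos.2 (det_jac_chg_ne he he' hy)) _) hf

/-- The cocycle property of the density factors, from the chain rule and multiplicativity of
determinants. -/
theorem transport_transport (he : e ∈ charts n N) (he' : e' ∈ charts n N) (he'' : e'' ∈ charts n N)
    (f : Eu (n + 1) → ℝ) {y : Eu (n + 1)} (hy : y ∈ overlap e e'') (hy' : y ∈ overlap e' e'') :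
    transport e f e'' y =
      |(jac (chg e' e'') y).det| ^ (-1 / ((n : ℝ) + 2)) * transport e f e' (chg e' e'' y) := by
  have hcc : ∀ z ∈ overlap e' e'', chg e e' (chg e' e'' z) = chg e e'' z := fun z hz => by
    rw [chg, chg, e'.left_inv hz.2]
  have hm : chg e' e'' y ∈ overlap e e' := by
    refine ⟨e'.map_source hy'.2, ?_⟩
    change e'.symm (e' (e''.symm y)) ∈ e.source
    rw [e'.left_inv hy'.2]
    exact hy.2
  have hj : jac (chg e e'') y = jac (chg e e') (chg e' e'' y) * jac (chg e' e'') y := by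
    rw [← jac_comp (contDiffAt_chg' he he' hm).diff (contDiffAt_chg' he' he'' hy').diff]
    exact jac_congr (isOpen_overlap e' e'') hy' fun z hz => (hcc z hz).symm
  rw [transport, transport, hcc y hy', hj, Matrix.det_mul, abs_mul,
    Real.mul_rpow (abs_nonneg _) (abs_nonneg _)]
  ring

theorem boundaryValue_chg (hn : 0 < n) (hL : ∀ e ∈ boundaryCharts (n := n) Ω,
      LocalBoundary e.target (christoffel nabla e) (ρ.comp e))
    (κ : ConfDensity (n := n) Ω 1) (he : e ∈ boundaryCharts (n := n) Ω)
    (he' : e' ∈ boundaryCharts (n := n) Ω) {v : Eu n} (hv : slicePt v ∈ overlap e e') :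
    boundaryValue nabla κ e' v = |(jac (chg e e') (slicePt v)).det| ^ (-1 / ((n : ℝ) + 2)) *
      boundaryValue nabla κ e (sliceMap (chg e e') v) := by
  have H := sliceMap_chg he he'
  have hv' : slicePt (sliceMap (chg e e') v) ∈ e.target := by
    rw [H.slicePt_sliceMap hv]; exact (chg_mem_overlap hv).1
  have h := boundaryValue_algebra hn (H.jac_zero_zero_pos hv) (H.det_sliceMap_ne hv)
    ((hL e he).det_sliceForm_pos hv') ((hL e' he').det_sliceForm_pos hv.1)
    (H.det_sliceForm_pullback hv (isPullback_chg he.1 he'.1 hv))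
  have ht := κ.trans e he e' he' v hv.1 hv.2
  have hd := det_fderiv_eq (H.contDiffAt_sliceMap hv).diff
  change κ.comp e' v = |(fderiv ℝ (sliceMap (chg e e')) v).det| ^ (-1 / (n : ℝ)) *
    κ.comp e (sliceMap (chg e e') v) at ht
  rw [boundaryValue, boundaryValue, ht, hd, H.det_jac hv]
  linear_combination κ.comp e (sliceMap (chg e e') v) * h

/-- The function `f` in the chart `e` has the first order Taylor coefficient along the boundary
that harmonicity prescribes, for the boundary value `κ`. -/
def HasHarmonicJet (nabla : CovariantDerivative 𝓘(ℝ, Eu (n + 1)) (Eu (n + 1))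
    (TangentSpace 𝓘(ℝ, Eu (n + 1)) : N → Type _)) (κ : ConfDensity (n := n) Ω 1)
    (e : OpenPartialHomeomorph N (Eu (n + 1))) (f : Eu (n + 1) → ℝ) (v : Eu n) : Prop :=
  f (slicePt v) = boundaryValue nabla κ e v ∧
    n * pd 0 f (slicePt v) + sliceOp (christoffel nabla e) (boundaryValue nabla κ e) v = 0

theorem HasHarmonicJet.transport (hn : 0 < n) (hL : ∀ e ∈ boundaryCharts (n := n) Ω,
      LocalBoundary e.target (christoffel nabla e) (ρ.comp e))
    {κ : ConfDensity (n := n) Ω 1} (he : e ∈ boundaryCharts (n := n) Ω)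
    (he' : e' ∈ boundaryCharts (n := n) Ω) {U : Set (Eu (n + 1))} (hU : IsOpen U)
    (hUe : U ⊆ e.target) {f : Eu (n + 1) → ℝ} (hf : ∀ z ∈ U, ContDiffAt ℝ ∞ f z)
    (hf0 : ∀ z ∈ U, 0 < f z) (hj : ∀ v, slicePt v ∈ U → HasHarmonicJet nabla κ e f v)
    {v : Eu n} (hv : slicePt v ∈ overlap e e') (hvU : chg e e' (slicePt v) ∈ U) :
    HasHarmonicJet nabla κ e' (transport e f e') v := by
  have H := sliceMap_chg he he'
  have L := hL e he
  have L' := hL e' he'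
  have hcont : ContinuousOn (chg e e') (overlap e e') := fun z hz =>
    (H.smooth z hz).continuousAt.continuousWithinAt
  have hW : IsOpen (overlap e e' ∩ chg e e' ⁻¹' U) := hcont.isOpen_inter_preimage H.isOpen hU
  have hval : ∀ w, slicePt w ∈ overlap e e' ∩ chg e e' ⁻¹' U →
      HarmonicScale.transport e f e' (slicePt w) = boundaryValue nabla κ e' w := fun w hw => by
    have hw' : slicePt (sliceMap (chg e e') w) ∈ U := by
      rw [H.slicePt_sliceMap hw.1]; exact hw.2
    rw [boundaryValue_chg hn hL κ he he' hw.1, ← (hj _ hw').1, H.slicePt_sliceMap hw.1]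
    rfl
  have hts : ∀ z ∈ overlap e e', chg e e' z ∈ U →
      ContDiffAt ℝ ∞ (HarmonicScale.transport e f e') z := fun z hz hzU =>
    contDiffAt_transport he.1 he'.1 hz (hf _ hzU)
  have hvU' : slicePt (sliceMap (chg e e') v) ∈ U := by
    rw [H.slicePt_sliceMap hv]; exact hvU
  have h1 := sliceTrace_eq hU hf hvU' (L.symm _ (hUe hvU'))
    (L.det_sliceForm_pos (hUe hvU')).ne' (s := boundaryValue nabla κ e) fun w hw => (hj w hw).1
  rw [(hj _ hvU').2] at h1
  have h2 := sliceTrace_eq hW (fun z hz => hts z hz.1 hz.2) ⟨hv, hvU⟩ (L'.symm _ hv.1)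
    (L'.det_sliceForm_pos hv.1).ne' hval
  -- With equal boundary values, the jet condition is the vanishing of `sliceTrace`, and this
  -- vanishing is independent of the chart.
  have h3 := H.sliceTrace_pullback hv hn L L' (fun z hz => hz.1) hU hUe hvU
    (fun z hz => isPullback_chg he.1 he'.1 hz) hf (fun z hz => (hf0 z hz).ne') hts
    (τ' := HarmonicScale.transport e f e') fun z _ _ => rfl
  rw [h1, zero_div, mul_zero, div_eq_zero_iff] at h3
  refine ⟨hval v ⟨hv, hvU⟩, ?_⟩
  rw [← h2]
  exact h3.resolve_right (transport_pos he.1 he'.1 hv (hf0 _ hvU)).ne'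

end ChartChange

/-! ### Local extension of boundary data. -/

section LocalExtension

variable {n : ℕ}

/-- A positive function with prescribed value and normal derivative along the slice. -/
theorem exists_positive_extension {V : Set (Eu (n + 1))} (hV : IsOpen V) {s q : Eu n → ℝ}
    (hs : ∀ v, slicePt v ∈ V → ContDiffAt ℝ ∞ s v) (hq : ∀ v, slicePt v ∈ V → ContDiffAt ℝ ∞ q v)
    (hpos : ∀ v, slicePt v ∈ V → 0 < s v) :
    ∃ (U : Set (Eu (n + 1))) (f : Eu (n + 1) → ℝ), IsOpen U ∧ U ⊆ V ∧
      (∀ v, slicePt v ∈ V → slicePt v ∈ U) ∧ (∀ z ∈ U, ContDiffAt ℝ ∞ f z) ∧ (∀ z ∈ U, 0 < f z) ∧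
      ∀ v, slicePt v ∈ V → f (slicePt v) = s v ∧ pd 0 f (slicePt v) = q v := by
  have hc : Continuous fun y : Eu (n + 1) => slicePt (sliceProj y) :=
    (contDiff_slicePt (_k := 0)).continuous.comp (contDiff_sliceProj (_k := 0)).continuous
  have hsm : ∀ y : Eu (n + 1), slicePt (sliceProj y) ∈ V →
      ContDiffAt ℝ ∞ (fun y => s (sliceProj y) * Real.exp (y 0 * (q (sliceProj y) /
        s (sliceProj y)))) y := fun y hy => by
    have h1 : ContDiffAt ℝ ∞ (fun y => s (sliceProj y)) y :=
      ContDiffAt.comp y (hs _ hy) contDiff_sliceProj.contDiffAt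
    have h2 : ContDiffAt ℝ ∞ (fun y => q (sliceProj y)) y :=
      ContDiffAt.comp y (hq _ hy) contDiff_sliceProj.contDiffAt
    have h3 : ContDiffAt ℝ ∞ (fun y : Eu (n + 1) => y 0) y :=
      (EuclideanSpace.proj (0 : Fin (n + 1)) : Eu (n + 1) →L[ℝ] ℝ).contDiff.contDiffAt
    exact h1.mul (h3.mul (h2.div h1 (hpos _ hy).ne')).exp
  -- The exponential form `s · exp (y 0 · q / s)` has value `s` and normal derivative `q` on the
  -- slice and stays positive wherever it is defined.
  refine ⟨V ∩ (fun y => slicePt (sliceProj y)) ⁻¹' V, fun y => s (sliceProj y) *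
    Real.exp (y 0 * (q (sliceProj y) / s (sliceProj y))), hV.inter (hV.preimage hc),
    Set.inter_subset_left, fun v hv => ⟨hv, ?_⟩, fun z hz => hsm z hz.2,
    fun z hz => mul_pos (hpos _ hz.2) (Real.exp_pos _), fun v hv => ⟨?_, ?_⟩⟩
  · rwa [Set.mem_preimage, sliceProj_slicePt]
  · simp [sliceProj_slicePt, slicePt_zero]
  · have h1 := hasDerivAt_firstLine (hsm (slicePt v) (by rwa [sliceProj_slicePt])).diff
    have hp : ∀ t : ℝ, sliceProj (slicePt v + t • (EuclideanSpace.single 0 1 : Eu (n + 1))) = v :=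
      fun t => by
        ext a
        simp [sliceProj, slicePt]
    simp only [hp, firstLine_zero, slicePt_zero, zero_add] at h1
    have h2 : HasDerivAt (fun t : ℝ => s v * Real.exp (t * (q v / s v)))
        (s v * (Real.exp (0 * (q v / s v)) * (1 * (q v / s v)))) 0 :=
      (((hasDerivAt_id (0 : ℝ)).mul_const (q v / s v)).exp).const_mul (s v)
    rw [h1.unique h2]
    have := (hpos v hv).ne'
    simp
    field_simp

namespace LocalBoundary

variable {V : Set (Eu (n + 1))} {Γ : Symbols (n + 1)} {r : Eu (n + 1) → ℝ}
  (L : LocalBoundary V Γ r) {u : Eu n} (hu : slicePt u ∈ V)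

include L hu

theorem contDiffAt_sliceForm (a b : Fin n) : ContDiffAt ℝ ∞ (fun v => sliceForm Γ v a b) u :=
  (ContDiffAt.comp u (L.smooth _ hu _ _ _) contDiff_slicePt.contDiffAt).neg

theorem contDiffAt_det_sliceForm : ContDiffAt ℝ ∞ (fun v => (sliceForm Γ v).det) u :=
  contDiffAt_det fun a b => L.contDiffAt_sliceForm hu a b

theorem contDiffAt_sliceOp {s : Eu n → ℝ} (hs : ContDiffAt ℝ ∞ s u) :
    ContDiffAt ℝ ∞ (sliceOp Γ s) u := by
  have h1 := contDiffAt_inv_apply (fun a b => L.contDiffAt_sliceForm hu a b)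
    (L.det_sliceForm_pos hu).ne'
  have h2 : ∀ i j k, ContDiffAt ℝ ∞ (fun v => coordSymbols Γ (slicePt v) i j k) u := fun i j k =>
    ContDiffAt.comp u (contDiffAt_coordSymbols (L.smooth _ hu) i j k) contDiff_slicePt.contDiffAt
  have h3 : ∀ i j, ContDiffAt ℝ ∞ (fun v => projSchouten (coordSymbols Γ) (slicePt v) i j) u :=
    fun i j => ContDiffAt.comp u (contDiffAt_projSchouten (contDiffAt_coordSymbols (L.smooth _ hu))
      i j) contDiff_slicePt.contDiffAt
  exact ContDiffAt.sum fun a _ => ContDiffAt.sum fun b _ => (h1 a b).mul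
    (((contDiffAt_pd a (contDiffAt_pd b hs)).sub
      (ContDiffAt.sum fun c _ => (h2 _ _ _).mul (contDiffAt_pd c hs))).add ((h3 _ _).mul hs))

end LocalBoundary

end LocalExtension

/-! ### Local solutions of the extension problem. -/

section LocalHarmonic

variable {n : ℕ} {N : Type*} [TopologicalSpace N] [ChartedSpace (Eu (n + 1)) N]
  {e : OpenPartialHomeomorph N (Eu (n + 1))} {Ω : Set N} [IsManifold 𝓘(ℝ, Eu (n + 1)) ∞ N]
  {nabla : CovariantDerivative 𝓘(ℝ, Eu (n + 1)) (Eu (n + 1))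
    (TangentSpace 𝓘(ℝ, Eu (n + 1)) : N → Type _)} {ρ : ProjDensity n N 2}
  (hL : ∀ e ∈ boundaryCharts (n := n) Ω, LocalBoundary e.target (christoffel nabla e) (ρ.comp e))
  {κ : ConfDensity (n := n) Ω 1} (hκ : IsConfScale κ)

include hL in
theorem contDiffAt_boundaryValue (κ : ConfDensity (n := n) Ω 1)
    (he : e ∈ boundaryCharts (n := n) Ω) {u : Eu n}
    (hu : slicePt u ∈ e.target) : ContDiffAt ℝ ∞ (boundaryValue nabla κ e) u := by
  have hD := (hL e he).det_sliceForm_pos hu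
  refine (contDiffAt_of_mem (hL e he).isOpen_slice (κ.smooth e he) hu).mul ?_
  refine (contDiffAt_abs_rpow ((hL e he).contDiffAt_det_sliceForm hu) hD.ne'
    (1 / ((n : ℝ) * (n + 2)))).congr_of_eventuallyEq ?_
  filter_upwards [(hL e he).isOpen_slice.mem_nhds hu] with v hv
  rw [abs_of_pos ((hL e he).det_sliceForm_pos hv)]

include hL hκ in
theorem boundaryValue_pos (he : e ∈ boundaryCharts (n := n) Ω) {u : Eu n}
    (hu : slicePt u ∈ e.target) : 0 < boundaryValue nabla κ e u :=
  mul_pos (hκ e he u hu) (Real.rpow_pos_of_pos ((hL e he).det_sliceForm_pos hu) _)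

include hL hκ in
theorem exists_chart_harmonicJet (hn : 0 < n) (he : e ∈ boundaryCharts (n := n) Ω) :
    ∃ (U : Set (Eu (n + 1))) (f : Eu (n + 1) → ℝ), IsOpen U ∧ U ⊆ e.target ∧
      (∀ v, slicePt v ∈ e.target → slicePt v ∈ U) ∧ (∀ z ∈ U, ContDiffAt ℝ ∞ f z) ∧
      (∀ z ∈ U, 0 < f z) ∧ ∀ v, slicePt v ∈ U → HasHarmonicJet nabla κ e f v := by
  obtain ⟨U, f, h1, h2, h3, h4, h5, h6⟩ := exists_positive_extension (hL e he).isOpen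
    (s := boundaryValue nabla κ e)
    (q := fun v => -(1 / (n : ℝ)) * sliceOp (christoffel nabla e) (boundaryValue nabla κ e) v)
    (fun v hv => contDiffAt_boundaryValue hL κ he hv)
    (fun v hv => contDiffAt_const.mul
      ((hL e he).contDiffAt_sliceOp hv (contDiffAt_boundaryValue hL κ he hv)))
    (fun v hv => boundaryValue_pos hL hκ he hv)
  refine ⟨U, f, h1, h2, h3, h4, h5, fun v hv => ⟨(h6 v (h2 hv)).1, ?_⟩⟩
  rw [(h6 v (h2 hv)).2]
  have : (n : ℝ) ≠ 0 := by positivity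
  field_simp
  ring

include hL hκ in
/-- Local solutions of the harmonic extension problem, near every point of the manifold. -/
theorem exists_local_harmonicJet (hn : 0 < n) (hΩ : IsOpen Ω) (hρ : IsDefiningDensity Ω ρ) (x : N) :
    ∃ e ∈ charts n N, ∃ (U : Set (Eu (n + 1))) (f : Eu (n + 1) → ℝ), x ∈ e.source ∧ e x ∈ U ∧
      IsOpen U ∧ U ⊆ e.target ∧ (∀ z ∈ U, ContDiffAt ℝ ∞ f z) ∧ (∀ z ∈ U, 0 < f z) ∧
      ∀ e' ∈ boundaryCharts (n := n) Ω, ∀ v, slicePt v ∈ overlap e e' →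
        chg e e' (slicePt v) ∈ U → HasHarmonicJet nabla κ e' (transport e f e') v := by
  by_cases hx : x ∈ frontier Ω
  · obtain ⟨e, he, u, hxe, hu⟩ := exists_boundaryChart hΩ hρ hx
    obtain ⟨U, f, h1, h2, h3, h4, h5, h6⟩ := exists_chart_harmonicJet hL hκ hn he
    refine ⟨e, he.1, U, f, hxe, ?_, h1, h2, h4, h5, fun e' he' v hv hvU =>
      HasHarmonicJet.transport hn hL he he' h1 h2 h4 h5 h6 hv hvU⟩
    rw [hu]
    exact h3 u (hu ▸ e.map_source hxe)
  -- Away from the boundary the constant density in a chart serves. Its domain avoids `frontier Ω`,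
  -- so the jet condition is vacuous.
  · set e := chartAt (Eu (n + 1)) x
    have hxe : x ∈ e.source := mem_chart_source _ x
    refine ⟨e, IsManifold.chart_mem_maximalAtlas x, e.target ∩ e.symm ⁻¹' (frontier Ω)ᶜ, fun _ => 1,
      hxe, ⟨e.map_source hxe, ?_⟩,
      e.symm.isOpen_inter_preimage isClosed_frontier.isOpen_compl, Set.inter_subset_left,
      fun _ _ => contDiffAt_const, fun _ _ => one_pos, fun e' he' v hv hvU => ?_⟩
    · change e.symm (e x) ∉ frontier Ω
      rwa [e.left_inv hxe]
    · refine absurd (symm_slicePt_mem_frontier hΩ he' hv.1) ?_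
      have h : e.symm (e (e'.symm (slicePt v))) ∉ frontier Ω := hvU.2
      rwa [e.left_inv hv.2] at h

end LocalHarmonic

/-! ### Gluing by a partition of unity. -/

section Glue

variable {n : ℕ} {N : Type*} [TopologicalSpace N] [ChartedSpace (Eu (n + 1)) N]
  {e e' : OpenPartialHomeomorph N (Eu (n + 1))} {Ω : Set N} [IsManifold 𝓘(ℝ, Eu (n + 1)) ∞ N]
  {nabla : CovariantDerivative 𝓘(ℝ, Eu (n + 1)) (Eu (n + 1))
    (TangentSpace 𝓘(ℝ, Eu (n + 1)) : N → Type _)} {ρ : ProjDensity n N 2}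

/-- Positive local densities of weight one, indexed by the points of the manifold. -/
structure LocalScales (n : ℕ) (N : Type*) [TopologicalSpace N] [ChartedSpace (Eu (n + 1)) N] where
  chart : N → OpenPartialHomeomorph N (Eu (n + 1))
  dom : N → Set (Eu (n + 1))
  comp : N → Eu (n + 1) → ℝ
  chart_mem : ∀ x, chart x ∈ charts n N
  mem_source : ∀ x, x ∈ (chart x).source
  mem_dom : ∀ x, chart x x ∈ dom x
  isOpen : ∀ x, IsOpen (dom x)
  smooth : ∀ x, ∀ z ∈ dom x, ContDiffAt ℝ ∞ (comp x) z
  pos : ∀ x, ∀ z ∈ dom x, 0 < comp x z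

set_option linter.unusedSectionVars false

namespace LocalScales

variable (S : LocalScales n N)

/-- The open subset of the manifold on which a local scale is defined. -/
def opens (x : N) : Set N := (S.chart x).source ∩ S.chart x ⁻¹' S.dom x

theorem exists_partition [T2Space N] [SigmaCompactSpace N] :
    ∃ χ : SmoothPartitionOfUnity N 𝓘(ℝ, Eu (n + 1)) N Set.univ, χ.IsSubordinate S.opens :=
  SmoothPartitionOfUnity.exists_isSubordinate _ isClosed_univ S.opens
    (fun x => (S.chart x).isOpen_inter_preimage (S.isOpen x))
    fun x _ => Set.mem_iUnion.2 ⟨x, S.mem_source x, S.mem_dom x⟩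

variable (χ : SmoothPartitionOfUnity N 𝓘(ℝ, Eu (n + 1)) N Set.univ)

/-- The component in a chart of the density glued from local scales by a partition of unity. -/
def glue (e : OpenPartialHomeomorph N (Eu (n + 1))) (y : Eu (n + 1)) : ℝ :=
  ∑ᶠ x, χ x (e.symm y) * transport (S.chart x) (S.comp x) e y

theorem contDiffAt_partition (he : e ∈ charts n N) {y : Eu (n + 1)} (hy : y ∈ e.target) (x : N) :
    ContDiffAt ℝ ∞ (fun z => χ x (e.symm z)) y := by
  have h1 : ContMDiffOn 𝓘(ℝ, Eu (n + 1)) 𝓘(ℝ, ℝ) ∞ (fun y => χ x (e.symm y)) e.target :=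
    (χ x).contMDiff.comp_contMDiffOn (contMDiffOn_symm_of_mem_maximalAtlas he)
  exact contDiffAt_of_mem e.open_target h1.contDiffOn hy

/-- One finite index set serves near `y` for both the glued sum and the partition identity, so both
may be differentiated termwise. -/
theorem eventually_glue_eq {y : Eu (n + 1)} (hy : y ∈ e.target) :
    ∀ᶠ z in 𝓝 y, S.glue χ e z = ∑ x ∈ χ.fintsupport (e.symm y),
        χ x (e.symm z) * transport (S.chart x) (S.comp x) e z ∧
      ∑ x ∈ χ.fintsupport (e.symm y), χ x (e.symm z) = 1 := by
  filter_upwards [(e.symm.continuousAt hy).eventually (χ.eventually_finsupport_subset _)] with z hz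
  refine ⟨finsum_eq_sum_of_support_subset _ fun x hx => hz ?_, χ.sum_finsupport' _ trivial hz⟩
  rw [χ.mem_finsupport]
  exact left_ne_zero_of_mul hx

variable {χ} (hχ : χ.IsSubordinate S.opens)
include hχ

theorem mem_of_mem_fintsupport {y : Eu (n + 1)} (hy : y ∈ e.target) {x : N}
    (hx : x ∈ χ.fintsupport (e.symm y)) :
    y ∈ overlap (S.chart x) e ∧ chg (S.chart x) e y ∈ S.dom x := by
  have h := hχ x ((χ.mem_fintsupport_iff _ _).1 hx)
  exact ⟨⟨hy, h.1⟩, h.2⟩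

theorem contDiffAt_glue (he : e ∈ charts n N) {y : Eu (n + 1)} (hy : y ∈ e.target) :
    ContDiffAt ℝ ∞ (S.glue χ e) y := by
  have h : ContDiffAt ℝ ∞ (fun z => ∑ x ∈ χ.fintsupport (e.symm y),
      χ x (e.symm z) * transport (S.chart x) (S.comp x) e z) y := ContDiffAt.sum fun x hx => by
    obtain ⟨h1, h2⟩ := S.mem_of_mem_fintsupport hχ hy hx
    exact (contDiffAt_partition χ he hy x).mul
      (contDiffAt_transport (S.chart_mem x) he h1 (S.smooth x _ h2))
  refine h.congr_of_eventuallyEq ?_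
  filter_upwards [S.eventually_glue_eq χ hy] with z hz using hz.1

theorem glue_pos (he : e ∈ charts n N) {y : Eu (n + 1)} (hy : y ∈ e.target) :
    0 < S.glue χ e y := by
  obtain ⟨h1, h2⟩ := (S.eventually_glue_eq χ hy).self_of_nhds
  have hp : ∀ x ∈ χ.fintsupport (e.symm y), 0 < transport (S.chart x) (S.comp x) e y :=
    fun x hx => by
      obtain ⟨h3, h4⟩ := S.mem_of_mem_fintsupport hχ hy hx
      exact transport_pos (S.chart_mem x) he h3 (S.pos x _ h4)
  rw [h1]
  obtain ⟨x, hx, hx0⟩ := Finset.exists_ne_zero_of_sum_ne_zero (h2.trans_ne one_ne_zero)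
  exact Finset.sum_pos' (fun x hx => mul_nonneg (χ.nonneg x _) (hp x hx).le)
    ⟨x, hx, mul_pos ((χ.nonneg x _).lt_of_ne' hx0) (hp x hx)⟩

theorem glue_chg (he : e ∈ charts n N) (he' : e' ∈ charts n N) {y : Eu (n + 1)}
    (hy : y ∈ overlap e e') :
    S.glue χ e' y = |(jac (chg e e') y).det| ^ (-1 / ((n : ℝ) + 2)) * S.glue χ e (chg e e' y) := by
  have hp : e.symm (chg e e' y) = e'.symm y := e.left_inv hy.2
  rw [((S.eventually_glue_eq χ hy.1).self_of_nhds).1,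
    ((S.eventually_glue_eq χ (chg_mem_overlap hy).1).self_of_nhds).1, hp, Finset.mul_sum]
  refine Finset.sum_congr rfl fun x hx => ?_
  rw [transport_transport (S.chart_mem x) he he' _ (S.mem_of_mem_fintsupport hχ hy.1 hx).1 hy]
  ring

/-- All local densities share the boundary value, so the terms with derivatives of the partition
functions add up to zero. What remains is a convex combination of equal normal derivatives. -/
theorem hasHarmonicJet_glue {κ : ConfDensity (n := n) Ω 1} (he : e ∈ charts n N)
    {v : Eu n} (hv : slicePt v ∈ e.target)
    (h : ∀ x, slicePt v ∈ overlap (S.chart x) e → chg (S.chart x) e (slicePt v) ∈ S.dom x →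
      HasHarmonicJet nabla κ e (transport (S.chart x) (S.comp x) e) v) :
    HasHarmonicJet nabla κ e (S.glue χ e) v := by
  have hev := S.eventually_glue_eq χ hv
  set T := χ.fintsupport (e.symm (slicePt v))
  have hT : ∀ x ∈ T, HasHarmonicJet nabla κ e (transport (S.chart x) (S.comp x) e) v :=
    fun x hx => h x (S.mem_of_mem_fintsupport hχ hv hx).1 (S.mem_of_mem_fintsupport hχ hv hx).2
  have hd : ∀ x ∈ T, DifferentiableAt ℝ (transport (S.chart x) (S.comp x) e) (slicePt v) :=
    fun x hx => by
      obtain ⟨h1, h2⟩ := S.mem_of_mem_fintsupport hχ hv hx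
      exact (contDiffAt_transport (S.chart_mem x) he h1 (S.smooth x _ h2)).diff
  have hχd : ∀ x, DifferentiableAt ℝ (fun z => χ x (e.symm z)) (slicePt v) :=
    fun x => (contDiffAt_partition χ he hv x).diff
  obtain ⟨h1, h2⟩ := hev.self_of_nhds
  have h3 : ∑ x ∈ T, pd 0 (fun z => χ x (e.symm z)) (slicePt v) = 0 := by
    rw [← pd_sum fun x _ => hχd x, pd_congr' (g := fun _ => 1)
      (hev.mono fun z hz => hz.2), pd_const]
  have h4 : pd 0 (S.glue χ e) (slicePt v) = ∑ x ∈ T,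
      (pd 0 (fun z => χ x (e.symm z)) (slicePt v) * boundaryValue nabla κ e v +
        χ x (e.symm (slicePt v)) * pd 0 (transport (S.chart x) (S.comp x) e) (slicePt v)) := by
    rw [pd_congr' (hev.mono fun z hz => hz.1),
      pd_sum (F := fun x z => χ x (e.symm z) * transport (S.chart x) (S.comp x) e z)
        fun x hx => (hχd x).mul (hd x hx)]
    refine Finset.sum_congr rfl fun x hx => ?_
    rw [pd_mul (hχd x) (hd x hx), (hT x hx).1]
  refine ⟨?_, ?_⟩
  · rw [h1, Finset.sum_congr rfl fun x hx => by rw [(hT x hx).1], ← Finset.sum_mul, h2, one_mul]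
  · rw [h4, Finset.sum_add_distrib, ← Finset.sum_mul, h3, zero_mul, zero_add, Finset.mul_sum]
    have h5 : ∀ x ∈ T, (n : ℝ) * (χ x (e.symm (slicePt v)) *
        pd 0 (transport (S.chart x) (S.comp x) e) (slicePt v)) =
        χ x (e.symm (slicePt v)) * -sliceOp (christoffel nabla e) (boundaryValue nabla κ e) v :=
      fun x hx => by linear_combination χ x (e.symm (slicePt v)) * (hT x hx).2
    rw [Finset.sum_congr rfl h5, ← Finset.sum_mul, h2]
    ring

end LocalScales

/-- Every conformal scale has a harmonic extension, up to the existence of affine normal fields. -/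
theorem exists_harmonic_extension [T2Space N] [SecondCountableTopology N] (hn : 2 ≤ n)
    (hL : ∀ e ∈ boundaryCharts (n := n) Ω,
      LocalBoundary e.target (christoffel nabla e) (ρ.comp e))
    (hΩ : IsOpen Ω) (hρ : IsDefiningDensity Ω ρ)
    {κ : ConfDensity (n := n) Ω 1} (hκ : IsConfScale κ) :
    ∃ τ : ProjDensity n N 1, IsHarmonic nabla Ω ρ τ ∧ ∀ e ∈ boundaryCharts (n := n) Ω, ∀ u,
      slicePt u ∈ e.target → τ.comp e (slicePt u) = boundaryValue nabla κ e u := by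
  have : LocallyCompactSpace N := ChartedSpace.locallyCompactSpace (Eu (n + 1)) N
  choose E hE U F h1 h2 h3 h4 h5 h6 h7 using
    exists_local_harmonicJet (nabla := nabla) hL hκ (by omega) hΩ hρ
  let S : LocalScales n N := ⟨E, U, F, hE, h1, h2, h3, h5, h6⟩
  obtain ⟨χ, hχ⟩ := S.exists_partition
  let τ : ProjDensity n N 1 :=
    { comp := S.glue χ
      smooth := fun e he y hy => (S.contDiffAt_glue hχ he hy).contDiffWithinAt
      trans := fun e he e' he' x hx => by
        have hy : e' x ∈ overlap e e' := by
          refine ⟨e'.map_source hx.2, ?_⟩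
          change e'.symm (e' x) ∈ e.source
          rw [e'.left_inv hx.2]
          exact hx.1
        have h := S.glue_chg hχ he he' hy
        rw [← det_fderiv_eq (contDiffAt_chg' he he' hy).diff] at h
        rwa [show chg e e' (e' x) = e x by rw [chg, e'.left_inv hx.2]] at h }
  have hjet : ∀ e ∈ boundaryCharts (n := n) Ω, ∀ v, slicePt v ∈ e.target →
      HasHarmonicJet nabla κ e (τ.comp e) v := fun e he v hv =>
    S.hasHarmonicJet_glue hχ he.1 hv fun x hx hxU => h7 x e he v hx hxU
  refine ⟨τ, (isHarmonic_iff hL).2 ⟨fun e he y hy => S.glue_pos hχ he hy, fun e he u hu => ?_⟩,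
    fun e he u hu => (hjet e he u hu).1⟩
  rw [sliceTrace_eq e.open_target (fun z hz => τ.contDiffAt he.1 hz) hu ((hL e he).symm _ hu)
    ((hL e he).det_sliceForm_pos hu).ne' (s := boundaryValue nabla κ e)
    fun v hv => (hjet e he v hv).1]
  exact (hjet e he u hu).2

end Glue

/-! ### Solving `η = 0` for a given transversal component. -/

section NormalField

variable {n : ℕ} {Γ Γ' : Symbols (n + 1)}

/-- The field along the slice with transversal component `X` and `η = 0`. -/
def normalField (Γ : Symbols (n + 1)) (X : Eu n → ℝ) (u : Eu n) : Fin (n + 1) → ℝ :=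
  Fin.cons (X u) fun b => ∑ a, (sliceForm Γ u)⁻¹ b a * (pd a X u + Γ (slicePt u) a.succ 0 0 * X u)

/-- Since `Γ_ab^0 = -B_ab`, the condition `η = 0` is a linear system with matrix `B` for the
tangential components, uniquely solvable when `B` is nondegenerate. Uniqueness is what makes the
field natural. -/
theorem eq_normalField_iff {X : Eu n → ℝ} {u : Eu n} (hdet : (sliceForm Γ u).det ≠ 0)
    {ζ : Fin (n + 1) → ℝ} :
    ζ = normalField Γ X u ↔
      ζ 0 = X u ∧ ∀ a : Fin n, pd a X u + ∑ j, Γ (slicePt u) a.succ j 0 * ζ j = 0 := by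
  set B := sliceForm Γ u
  set c : Fin n → ℝ := fun a => pd a X u + Γ (slicePt u) a.succ 0 0 * X u
  have h1 : ∀ a : Fin n, ∑ j : Fin n, Γ (slicePt u) a.succ j.succ 0 * ζ j.succ =
      -(B.mulVec (fun b => ζ b.succ)) a := fun a => by
    simp only [B, Matrix.mulVec, dotProduct, sliceForm, Matrix.of_apply]
    rw [← Finset.sum_neg_distrib]
    exact Finset.sum_congr rfl fun _ _ => by ring
  have h2 : ζ = normalField Γ X u ↔ ζ 0 = X u ∧ (fun b : Fin n => ζ b.succ) = B⁻¹.mulVec c := by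
    constructor
    · rintro rfl
      exact ⟨rfl, rfl⟩
    · rintro ⟨h3, h4⟩
      funext k
      refine Fin.cases h3 (fun b => ?_) k
      exact congrFun h4 b
  rw [h2]
  refine and_congr_right fun h3 => ?_
  have h4 : (∀ a : Fin n, pd a X u + ∑ j, Γ (slicePt u) a.succ j 0 * ζ j = 0) ↔
      B.mulVec (fun b => ζ b.succ) = c := by
    rw [funext_iff]
    refine forall_congr' fun a => ?_
    rw [Fin.sum_univ_succ, h1, h3]
    constructor <;> intro h <;> simp only [c] at * <;> linarith
  rw [h4]
  constructor
  · intro h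
    rw [h, Matrix.mulVec_mulVec, Matrix.mul_nonsing_inv _ hdet.isUnit, Matrix.one_mulVec]
  · intro h
    rw [← h, Matrix.mulVec_mulVec, Matrix.nonsing_inv_mul _ hdet.isUnit, Matrix.one_mulVec]

/-- Agreement of the transversal component near `u`, not just at `u`, is needed because `η` contains
its derivative. -/
theorem etaForm_normalField {X : Eu n → ℝ} {u : Eu n} (hdet : (sliceForm Γ u).det ≠ 0)
    {ξ : Eu n → Fin (n + 1) → ℝ} (hξu : ξ u = normalField Γ X u)
    (hξ : (fun v => ξ v 0) =ᶠ[𝓝 u] X) (a : Fin n) : etaForm Γ ξ u a = 0 := by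
  rw [etaForm, transPart, covXi, pd_congr' hξ, ((eq_normalField_iff hdet).1 hξu).2 a, zero_div]

theorem contDiffAt_normalField {X : Eu n → ℝ} {u : Eu n} (hdet : (sliceForm Γ u).det ≠ 0)
    (hΓ : ∀ i j k, ContDiffAt ℝ ∞ (fun z => Γ z i j k) (slicePt u)) (hX : ContDiffAt ℝ ∞ X u)
    (k : Fin (n + 1)) : ContDiffAt ℝ ∞ (fun v => normalField Γ X v k) u := by
  have h1 : ∀ i j k, ContDiffAt ℝ ∞ (fun v => Γ (slicePt v) i j k) u := fun i j k =>
    ContDiffAt.comp u (hΓ i j k) contDiff_slicePt.contDiffAt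
  have h2 := contDiffAt_inv_apply (g := sliceForm Γ) (fun a b => (h1 _ _ _).neg) hdet
  refine Fin.cases hX (fun b => ?_) k
  change ContDiffAt ℝ ∞ (fun v => ∑ a, (sliceForm Γ v)⁻¹ b a *
    (pd a X v + Γ (slicePt v) a.succ 0 0 * X v)) u
  exact ContDiffAt.sum fun a _ => (h2 b a).mul ((contDiffAt_pd a hX).add ((h1 _ _ _).mul hX))

/-- Naturality of `normalField` under coordinate changes. -/
theorem SliceMap.normalField_pullback {W : Set (Eu (n + 1))} {φ : Eu (n + 1) → Eu (n + 1)}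
    (H : SliceMap W φ) {v : Eu n} (hv : slicePt v ∈ W) (hp : IsPullback Γ Γ' φ (slicePt v))
    (hdet : (sliceForm Γ (sliceMap φ v)).det ≠ 0) (hdet' : (sliceForm Γ' v).det ≠ 0)
    {X X' : Eu n → ℝ} (hX : DifferentiableAt ℝ X (sliceMap φ v)) (hX' : DifferentiableAt ℝ X' v)
    (hXX' : ∀ w, slicePt w ∈ W → X (sliceMap φ w) = jac φ (slicePt w) 0 0 * X' w) :
    (fun k => ∑ p, jac φ (slicePt v) k p * normalField Γ' X' v p) =
      normalField Γ X (sliceMap φ v) := by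
  set ξ' := normalField Γ' X' v with hξ'
  obtain ⟨h0, hη⟩ := (eq_normalField_iff hdet').1 hξ'
  set ζ : Fin (n + 1) → ℝ := fun k => ∑ p, jac φ (slicePt v) k p * ξ' p with hζ
  have hζ0 : ζ 0 = X (sliceMap φ v) := by
    simp only [hζ, Fin.sum_univ_succ (n := n), H.jac_zero_succ hv, zero_mul, Finset.sum_const_zero,
      add_zero]
    rw [h0, hXX' v hv]
  refine (eq_normalField_iff hdet).2 ⟨hζ0, ?_⟩
  -- It is enough to verify the system for the pushed forward field after contraction with the
  -- Jacobian of the slice, which is invertible.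
  have hsum : ∀ a : Fin n, ∑ c, jac (sliceMap φ) v c a * (pd c X (sliceMap φ v) +
      ∑ j, Γ (φ (slicePt v)) c.succ j 0 * ζ j) = 0 := by
    intro a
    have h1 := pd_comp_jac hX (H.contDiffAt_sliceMap hv).diff a
    have hj0 := contDiffAt_jac (H.smooth _ hv) 0 0
    have hj0' : DifferentiableAt ℝ (fun w => jac φ (slicePt w) 0 0) v :=
      (ContDiffAt.comp v hj0 contDiff_slicePt.contDiffAt).diff
    rw [pd_congr H.isOpen_slice hv hXX', pd_mul hj0' hX', pd_slice hj0.diff] at h1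
    have h2 : ∀ b : Fin n, pd a.succ (pd b.succ (fun z => φ z 0)) (slicePt v) = 0 := fun b => by
      rw [← pd_slice (f := pd b.succ (fun z => φ z 0))
          (contDiffAt_pd _ (H.smooth_apply hv 0)).diff,
        pd_congr (f := fun v => pd b.succ (fun z => φ z 0) (slicePt v)) H.isOpen_slice
          (g := fun _ => 0) hv fun w hw => H.jac_zero_succ hw b, pd_const]
    have hj : ∀ k p, pd p (fun z => φ z k) (slicePt v) = jac φ (slicePt v) k p := fun _ _ => rfl
    have h3 : ∀ j, Γ' (slicePt v) a.succ j 0 * jac φ (slicePt v) 0 0 =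
        pd a.succ (pd j (fun z => φ z 0)) (slicePt v) + ∑ c : Fin n, ∑ m,
          Γ (φ (slicePt v)) c.succ m 0 * jac (sliceMap φ) v c a * jac φ (slicePt v) m j := by
      intro j
      have h := hp a.succ j 0
      simp only [hj] at h
      rw [Fin.sum_univ_succ] at h
      rw [Fin.sum_univ_succ (n := n) (f := fun l => ∑ m, Γ (φ (slicePt v)) l m 0 *
        jac φ (slicePt v) l a.succ * jac φ (slicePt v) m j)] at h
      simpa only [H.jac_zero_succ hv, H.jac_succ_succ hv, mul_zero, zero_mul,
        Finset.sum_const_zero, add_zero, zero_add] using h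
    have h4 : jac φ (slicePt v) 0 0 * ∑ j, Γ' (slicePt v) a.succ j 0 * ξ' j =
        pd a.succ (pd 0 (fun z => φ z 0)) (slicePt v) * X' v +
          ∑ c, jac (sliceMap φ) v c a * ∑ j, Γ (φ (slicePt v)) c.succ j 0 * ζ j := by
      have h5 : ∀ j, jac φ (slicePt v) 0 0 * (Γ' (slicePt v) a.succ j 0 * ξ' j) =
          pd a.succ (pd j (fun z => φ z 0)) (slicePt v) * ξ' j + ∑ c : Fin n, ∑ m,
            Γ (φ (slicePt v)) c.succ m 0 * jac (sliceMap φ) v c a *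
              (jac φ (slicePt v) m j * ξ' j) := fun j => by
        rw [mul_comm, mul_right_comm, h3, add_mul, Finset.sum_mul]
        simp only [Finset.sum_mul, mul_assoc]
      rw [Finset.mul_sum, Finset.sum_congr rfl fun j _ => h5 j, Finset.sum_add_distrib,
        Fin.sum_univ_succ]
      simp only [h2, zero_mul, Finset.sum_const_zero, add_zero, h0]
      congr 1
      rw [Finset.sum_comm]
      refine Finset.sum_congr rfl fun c _ => ?_
      rw [Finset.sum_comm, Finset.mul_sum]
      refine Finset.sum_congr rfl fun m _ => ?_
      rw [← Finset.mul_sum]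
      simp only [hζ]
      ring
    have h6 : pd a.succ (fun z => jac φ z 0 0) (slicePt v) =
        pd a.succ (pd 0 (fun z => φ z 0)) (slicePt v) := rfl
    simp only [mul_add, Finset.sum_add_distrib]
    -- The derivative of `∂_0 φ^0` from the product rule cancels against the second derivative in
    -- the transformation law of the symbols.
    linear_combination -h1 - h4 + jac φ (slicePt v) 0 0 * hη a + X' v * h6
  have hz : (jac (sliceMap φ) v).transpose.mulVec (fun c => pd c X (sliceMap φ v) +
      ∑ j, Γ (φ (slicePt v)) c.succ j 0 * ζ j) = 0 := funext hsum
  have := Matrix.eq_zero_of_mulVec_eq_zero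
    (by rw [Matrix.det_transpose]; exact H.det_sliceMap_ne hv) hz
  intro a
  rw [H.slicePt_sliceMap hv]
  exact congrFun this a

end NormalField

/-! ### Existence of the affine normal field and of harmonic scales. -/

section AffineNormal

variable {n : ℕ} {N : Type*} [TopologicalSpace N] [ChartedSpace (Eu (n + 1)) N]
  {e e' : OpenPartialHomeomorph N (Eu (n + 1))} {Ω : Set N} [IsManifold 𝓘(ℝ, Eu (n + 1)) ∞ N]
  {nabla : CovariantDerivative 𝓘(ℝ, Eu (n + 1)) (Eu (n + 1))
    (TangentSpace 𝓘(ℝ, Eu (n + 1)) : N → Type _)} {ρ : ProjDensity n N 2}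

/-- The transversal component of the affine normal field of a scale. -/
def normalSpeed (nabla : CovariantDerivative 𝓘(ℝ, Eu (n + 1)) (Eu (n + 1))
    (TangentSpace 𝓘(ℝ, Eu (n + 1)) : N → Type _)) (τ : ProjDensity n N 1)
    (e : OpenPartialHomeomorph N (Eu (n + 1))) (u : Eu n) : ℝ :=
  (sliceForm (christoffel nabla e) u).det ^ (1 / ((n : ℝ) + 2)) * τ.comp e (slicePt u) ^ 2

/-- The components of the affine normal field of a scale in a boundary chart. -/
def normalComp (nabla : CovariantDerivative 𝓘(ℝ, Eu (n + 1)) (Eu (n + 1))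
    (TangentSpace 𝓘(ℝ, Eu (n + 1)) : N → Type _)) (τ : ProjDensity n N 1)
    (e : OpenPartialHomeomorph N (Eu (n + 1))) (u : Eu n) : Fin (n + 1) → ℝ :=
  normalField (tauSymbols nabla τ e) (normalSpeed nabla τ e) u

theorem ProjDensity.comp_chg (τ : ProjDensity n N 1) (he : e ∈ charts n N) (he' : e' ∈ charts n N)
    {y : Eu (n + 1)} (hy : y ∈ overlap e e') :
    τ.comp e' y = |(jac (chg e e') y).det| ^ (-1 / ((n : ℝ) + 2)) * τ.comp e (chg e e' y) := by
  have h := τ.trans e he e' he' (e'.symm y) ⟨hy.2, e'.map_target hy.1⟩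
  rwa [e'.right_inv hy.1, det_fderiv_eq (contDiffAt_chg' he he' hy).diff] at h

variable (hL : ∀ e ∈ boundaryCharts (n := n) Ω,
  LocalBoundary e.target (christoffel nabla e) (ρ.comp e))

include hL

theorem contDiffAt_normalSpeed (τ : ProjDensity n N 1) (he : e ∈ boundaryCharts (n := n) Ω)
    {u : Eu n} (hu : slicePt u ∈ e.target) : ContDiffAt ℝ ∞ (normalSpeed nabla τ e) u := by
  have hD := (hL e he).det_sliceForm_pos hu
  refine ContDiffAt.mul ?_ ((ContDiffAt.comp u (τ.contDiffAt he.1 hu)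
    contDiff_slicePt.contDiffAt).pow 2)
  refine (contDiffAt_abs_rpow ((hL e he).contDiffAt_det_sliceForm hu) hD.ne'
    (1 / ((n : ℝ) + 2))).congr_of_eventuallyEq ?_
  filter_upwards [(hL e he).isOpen_slice.mem_nhds hu] with v hv
  rw [abs_of_pos ((hL e he).det_sliceForm_pos hv)]

theorem det_sliceForm_tauSymbols_ne (τ : ProjDensity n N 1) (he : e ∈ boundaryCharts (n := n) Ω)
    {u : Eu n} (hu : slicePt u ∈ e.target) : (sliceForm (tauSymbols nabla τ e) u).det ≠ 0 := by
  rw [tauSymbols, sliceForm_scaleSymbols]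
  exact ((hL e he).det_sliceForm_pos hu).ne'

/-- The scale connections correspond under the coordinate change, and `transversal_algebra` shows
that the transversal components transform as those of one vector. Naturality of `normalField` does
the rest. -/
theorem normalComp_chg {τ : ProjDensity n N 1} (hτ : IsProjScale τ)
    (he : e ∈ boundaryCharts (n := n) Ω) (he' : e' ∈ boundaryCharts (n := n) Ω) {v : Eu n}
    (hv : slicePt v ∈ overlap e e') :
    (fun k => ∑ p, jac (chg e e') (slicePt v) k p * normalComp nabla τ e' v p) =
      normalComp nabla τ e (sliceMap (chg e e') v) := by
  have H := sliceMap_chg he he'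
  have hm : ∀ w, slicePt w ∈ overlap e e' → slicePt (sliceMap (chg e e') w) ∈ e.target :=
    fun w hw => by
      rw [H.slicePt_sliceMap hw]; exact (chg_mem_overlap hw).1
  refine H.normalField_pullback hv ?_ (det_sliceForm_tauSymbols_ne hL τ he (hm v hv))
    (det_sliceForm_tauSymbols_ne hL τ he' hv.1) (contDiffAt_normalSpeed hL τ he (hm v hv)).diff
    (contDiffAt_normalSpeed hL τ he' hv.1).diff fun w hw => ?_
  · refine (isPullback_chg he.1 he'.1 hv).scaleSymbols H.isOpen hv (H.smooth _ hv) (H.det_ne _ hv)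
      (τ.contDiffAt he.1 (chg_mem_overlap hv).1).diff
      (hτ e he.1 _ (chg_mem_overlap hv).1).ne' fun w hw => ?_
    rw [τ.comp_chg he.1 he'.1 hw]
    congr 3
    push_cast
    ring
  · rw [normalSpeed, normalSpeed, τ.comp_chg he.1 he'.1 hw, H.slicePt_sliceMap hw, H.det_jac hw]
    exact (transversal_algebra (H.jac_zero_zero_pos hw) (H.det_sliceMap_ne hw)
      ((hL e he).det_sliceForm_pos (hm w hw)) ((hL e' he').det_sliceForm_pos hw.1)
      (hτ e he.1 _ (chg_mem_overlap hw).1)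
      (H.det_sliceForm_pullback hw (isPullback_chg he.1 he'.1 hw))).symm

/-- At a boundary point the vector is defined by one boundary chart, and `normalComp_chg` shows that
it has the right components in all others. Elsewhere the zero vector will do, as the condition is
empty. -/
theorem exists_normalVector (hΩ : IsOpen Ω) (hρ : IsDefiningDensity Ω ρ) {τ : ProjDensity n N 1}
    (hτ : IsProjScale τ) (x : N) :
    ∃ w : TangentSpace 𝓘(ℝ, Eu (n + 1)) x, ∀ e ∈ boundaryCharts (n := n) Ω, ∀ u,
      slicePt u ∈ e.target → e.symm (slicePt u) = x → ∀ k,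
        coordComp e x w k = normalComp nabla τ e u k := by
  by_cases hx : x ∈ frontier Ω
  · obtain ⟨e₀, he₀, u₀, hx₀, hu₀⟩ := exists_boundaryChart hΩ hρ hx
    refine ⟨∑ p, normalComp nabla τ e₀ u₀ p • coordField e₀ p x, fun e he u hu hux k => ?_⟩
    have hxe : x ∈ e.source := hux ▸ e.map_target hu
    have hx0 : e₀.symm (slicePt u₀) = x := by rw [← hu₀, e₀.left_inv hx₀]
    have hov : slicePt u₀ ∈ overlap e e₀ := by
      refine ⟨hu₀ ▸ e₀.map_source hx₀, ?_⟩
      rw [Set.mem_preimage, hx0]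
      exact hxe
    have hs : sliceMap (chg e e₀) u₀ = u := by
      rw [sliceMap, chg, hx0, ← hux, e.right_inv hu, sliceProj_slicePt]
    rw [coordComp_sum_smul, ← hs, ← normalComp_chg hL hτ he he₀ hov]
    refine Finset.sum_congr rfl fun p _ => ?_
    rw [coordComp_coordField he.1 he₀.1 hxe hx₀, hu₀, mul_comm]
    rfl
  · refine ⟨0, fun e he u hu hux => absurd ?_ hx⟩
    rw [← hux]
    exact symm_slicePt_mem_frontier hΩ he hu

theorem exists_affineNormal [T2Space N] [CovariantDerivative.ContMDiffCovariantDerivative nabla ∞]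
    (hΩ : IsOpen Ω) (hρ : IsDefiningDensity Ω ρ) {τ : ProjDensity n N 1} (hτ : IsProjScale τ) :
    ∃ ξ, IsAffineNormal nabla Ω τ ξ := by
  choose ξ hξ using exists_normalVector (nabla := nabla) hL hΩ hρ hτ
  have hal : ∀ e ∈ boundaryCharts (n := n) Ω, ∀ u, slicePt u ∈ e.target →
      alongM ξ e u = normalComp nabla τ e u := fun e he u hu =>
    funext fun k => hξ _ e he u hu rfl k
  refine ⟨ξ, fun e he => ⟨fun k u hu => ?_, fun u hu => ?_⟩⟩
  · have h := contDiffAt_normalField (det_sliceForm_tauSymbols_ne hL τ he hu)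
      (contDiffAt_scaleSymbols (contDiffAt_christoffel nabla he.1 hu) (τ.contDiffAt he.1 hu)
        (hτ e he.1 _ hu).ne') (contDiffAt_normalSpeed hL τ he hu) k
    exact h.contDiffWithinAt.congr (fun v hv => congrFun (hal e he v hv) k)
      (congrFun (hal e he u hu) k)
  · have hD := (hL e he).det_sliceForm_pos hu
    have ht := hτ e he.1 _ hu
    have h0 : alongM ξ e u 0 = (sliceForm (christoffel nabla e) u).det ^ (1 / ((n : ℝ) + 2)) *
        τ.comp e (slicePt u) ^ 2 := by rw [hal e he u hu]; rfl
    have hpos : 0 < alongM ξ e u 0 := by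
      rw [h0]
      exact mul_pos (Real.rpow_pos_of_pos hD _) (pow_pos ht 2)
    refine ⟨hpos, ?_, fun a => ?_⟩
    · rw [det_affineMetric_tauSymbols]
      exact (normalization_iff ht hpos hD).2 h0
    · refine etaForm_normalField (det_sliceForm_tauSymbols_ne hL τ he hu) (hal e he u hu) ?_ a
      filter_upwards [(hL e he).isOpen_slice.mem_nhds hu] with v hv
      rw [hal e he v hv]
      rfl

/-- The normalization fixes `vol_h` in terms of `τ|_M` and `det B`, so for the affine normal field
just constructed the identification with `κ` is the formula defining `boundaryValue`, read
backwards. -/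
theorem restrictsTo_of_comp_slicePt [T2Space N]
    [CovariantDerivative.ContMDiffCovariantDerivative nabla ∞] (hn : 0 < n)
    (hΩ : IsOpen Ω) (hρ : IsDefiningDensity Ω ρ) {τ : ProjDensity n N 1} (hτ : IsProjScale τ)
    {κ : ConfDensity (n := n) Ω 1} (h : ∀ e ∈ boundaryCharts (n := n) Ω, ∀ u,
      slicePt u ∈ e.target → τ.comp e (slicePt u) = boundaryValue nabla κ e u) :
    RestrictsTo nabla Ω τ κ := by
  obtain ⟨ξ, hξ⟩ := exists_affineNormal hL hΩ hρ hτ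
  refine ⟨ξ, hξ, fun e he u hu => ?_⟩
  have hD := (hL e he).det_sliceForm_pos hu
  rw [hMetric, det_affineMetric_tauSymbols, rpow_sqrt_normalization hn (hτ e he.1 _ hu)
    ((hξ e he).2 u hu).1 hD (hξ.xi_zero hL hτ he hu), h e he u hu, boundaryValue,
    mul_inv_cancel_right₀ (Real.rpow_pos_of_pos hD _).ne']

end AffineNormal

end

end HarmonicScale

theorem proposition5p9 {n : ℕ} (hn : 2 ≤ n) {N : Type*} [TopologicalSpace N] [T2Space N]
    [SecondCountableTopology N] [ChartedSpace (Eu (n + 1)) N]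
    [IsManifold 𝓘(ℝ, Eu (n + 1)) ∞ N]
    (nabla : CovariantDerivative 𝓘(ℝ, Eu (n + 1)) (Eu (n + 1))
      (TangentSpace 𝓘(ℝ, Eu (n + 1)) : N → Type _))
    [CovariantDerivative.ContMDiffCovariantDerivative nabla ∞] (htorsion : nabla.torsion = 0)
    (hflat : IsLocallyFlat nabla)
    (Ω : Set N) (hopen : IsOpen Ω) (hconn : IsConnected Ω) (hcpt : IsCompact (closure Ω))
    (ρ : ProjDensity n N 2)
    (hρ : IsFefferman nabla Ω ρ)
    (hconv : IsStrictlyConvex nabla Ω ρ) :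
    -- (i) harmonic extension of conformal scales
    (∀ κ : ConfDensity (n := n) Ω 1, IsConfScale κ →
      (∃ τ : ProjDensity n N 1, IsHarmonic nabla Ω ρ τ ∧
        RestrictsTo nabla Ω τ κ) ∧
      ∀ τ τ' : ProjDensity n N 1,
        IsHarmonic nabla Ω ρ τ → RestrictsTo nabla Ω τ κ →
        IsHarmonic nabla Ω ρ τ' → RestrictsTo nabla Ω τ' κ →
        IsBigORho Ω ρ 2 (fun e y => τ.comp e y - τ'.comp e y)) ∧
    -- (ii) rescalings of harmonic scales
    (∀ τ : ProjDensity n N 1, IsHarmonic nabla Ω ρ τ →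
      ∀ ξ, IsAffineNormal nabla Ω τ ξ →
      ∀ (Υ : N → ℝ) (hΥ : ContMDiff 𝓘(ℝ, Eu (n + 1)) 𝓘(ℝ, ℝ) ∞ Υ),
        IsHarmonic nabla Ω ρ (rescale τ Υ hΥ) ↔
        ∀ e ∈ boundaryCharts (n := n) Ω, ∀ u, slicePt u ∈ e.target →
          (mfderiv 𝓘(ℝ, Eu (n + 1)) 𝓘(ℝ, ℝ) Υ
              (e.symm (slicePt u)) (ξ (e.symm (slicePt u))) : ℝ) =
            (1 / (n : ℝ)) *
              (laplacian (hMetric nabla τ ξ e)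
                  (fun v => Υ (e.symm (slicePt v))) u +
                gradSq (hMetric nabla τ ξ e)
                  (fun v => Υ (e.symm (slicePt v))) u)) ∧
    -- (iii) the trace of the shape operator
    (∀ τ : ProjDensity n N 1, IsProjScale τ →
      ∀ ξ, IsAffineNormal nabla Ω τ ξ →
        (IsHarmonic nabla Ω ρ τ ↔
          ∀ e ∈ boundaryCharts (n := n) Ω, ∀ u, slicePt u ∈ e.target →
            traceShape (tauSymbols nabla τ e)
                (alongM ξ e) u =
              (1 / ((n : ℝ) - 1)) *
                (scal (hMetric nabla τ ξ e) u -
                  fubiniPickSq (tauSymbols nabla τ e)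
                    (alongM ξ e) u))) := by
  -- Flatness, strict convexity and the Monge-Ampere condition enter only through this local
  -- structure.
  have hL : ∀ e ∈ boundaryCharts (n := n) Ω,
      LocalBoundary e.target (christoffel nabla e) (ρ.comp e) := fun e he =>
    localBoundary hn htorsion hflat hopen hρ hconv he
  refine ⟨fun κ hκ => ⟨?_, fun τ τ' hτ hτκ hτ' hτκ' =>
    harmonic_unique hL hn hτ hτκ hτ' hτκ'⟩, fun τ hτ ξ hξ Υ hΥ =>
    isHarmonic_rescale_iff hL hn hτ hξ Υ hΥ, fun τ hτ ξ hξ =>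
    isHarmonic_iff_traceShape hL hn hτ hξ⟩
  obtain ⟨τ, hτ, h⟩ := exists_harmonic_extension (nabla := nabla) hn hL hopen hρ.1 hκ
  exact ⟨τ, hτ, restrictsTo_of_comp_slicePt hL (by omega) hopen hρ.1 hτ.1 h⟩
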